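/- Let $\mathcal G$ be a digraph on a finite set $\mathcal V$ of $n>1$ agents; a link $i\to j$ is an edge with $i\ne j$. Every agent also has immediate access to its own variables. A maximal delay $\bar\tau_{ji}\in\mathbb N\cup\{\infty\}$ is allowed on each link $i\to j$, and $\bar\tau$ denotes the maximum of these ($0$ if there is no link). Admissible delays are arbitrary finite $\tau_{ji}(k)\in\mathbb N$ (the delay of the packet that $i$ sends to $j$ at time $k\ge 0$) with $\tau_{ji}(k)\le\bar\tau_{ji}$ for all links and all $k$, and $\tau_{jj}(k)=0$. Let $d_i^{\rm out}$ be the number of out-neighbours $l\neq i$ of $i$, and let $N_j(k)$ be the number of packets from in-neighbours $i\ne j$ that arrive at $j$ exactly at time $k$, i.e. of pairs $(i,\delta)$ with $i\to j$ a link, $0\le\delta\le k$ and $\tau_{ji}(k-\delta)=\delta$. For $\delta\ge 0$ define the $n\times n$ matrices $R^{(\delta)}(k)$, $C^{(\delta)}(k)$ by $$r^{(\delta)}_{ji}(k)=\frac1{1+N_j(k)}\ \text{ if } (i=j \text{ or } i\to j),\ \delta\le k,\ \tau_{ji}(k-\delta)=\delta,\qquad c^{(\delta)}_{ji}(k)=\frac1{1+d_i^{\rm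 out}}\ \text{ if } (i=j\text{ or } i\to j),\ \tau_{ji}(k)=\delta,$$ and $0$ otherwise. The augmented RPPAC iteration with surplus gain $\gamma$ has states $x^{(\delta)}_j(k)$ and surpluses $s^{(\delta)}_j(k)$, $0\le\delta\le\bar\tau$ ($\delta\in\mathbb N$; level $0$ is the agent $j$, the levels $\delta\ge1$ are its virtual buffer nodes), and reads $$\begin{bmatrix}\tilde x(k+1)\\ \tilde s(k+1)\end{bmatrix}=\begin{bmatrix}\tilde R(k)&H\\ J(k)&\tilde C(k)-H\end{bmatrix}\begin{bmatrix}\tilde x(k)\\ \tilde s(k)\end{bmatrix},$$ where $\tilde R(k)$ has block row $0$ equal to $R^{(0)}(k),R^{(1)}(k),\dots$ and identity blocks on the subdiagonal; $\tilde C(k)$ has block column $0$ equal to $C^{(0)}(k),C^{(1)}(k),\dots$ and identity blocks on the superdiagonal; $H$ has the block $\gamma I$ at position $(0,0)$; $J(k)$ has block row $0$ equal to $I-R^{(0)}(k),-R^{(1)}(k),-R^{(2)}(k),\dots$; all other blocks vanish. Initially $x_j^{(0)}(0)=x_j(0)$ is arbitrary, and all other entries are $0$. Say that the algorithm achieves asymptotic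 average consensus with gain $\gamma$ if, for all admissible (time-varying, heterogeneous) delays and all initial values $x_j(0)$, one has $x^{(0)}_j(k)\to\frac1n\sum_{i}x_i(0)$ and $s^{(0)}_j(k)\to0$ as $k\to\infty$ for every agent $j$. Theorem. There is $\gamma_0>0$, depending only on $\mathcal G$ and on the maximal delays $\bar\tau_{ji}$, such that for every $0<\gamma<\gamma_0$ the algorithm achieves asymptotic average consensus with gain $\gamma$ if and only if $\mathcal G$ is strongly connected and the transmission delays are bounded, i.e. there is a finite $D$ with $\bar\tau_{ji}\le D$ for all links $i\to j$. -/

import Mathlib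

open Filter Topology

namespace RPPAC

noncomputable section

universe u

/-- `i → j` is a transmission link of the digraph: an edge between distinct agents. Every agent also
has immediate access to its own variables; that self-loop is treated separately and is never counted
as a link. -/
def IsLink {V : Type u} (G : Digraph V) (i j : V) : Prop := i ≠ j ∧ G.Adj i j

/-- Every agent is reachable from every other agent along directed edges. -/
def StronglyConnected {V : Type u} (G : Digraph V) : Prop :=
  ∀ i j : V, Relation.ReflTransGen G.Adj i j

/-- Number of out-neighbours of `i`, the agent itself excluded. -/
def outDegree {V : Type u} (G : Digraph V) (i : V) : ℕ := {l : V | IsLink G i l}.ncard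

/-- `τ j i k` is the delay of the packet that `i` sends to `j` at time `k`; each delay is a finite
number of steps. `B j i` is the maximal delay allowed on the link `i → j`, where `⊤` means that no
bound is imposed. An agent has immediate access to its own variables. -/
def Admissible {V : Type u} (G : Digraph V) (B : V → V → ℕ∞) (τ : V → V → ℕ → ℕ) : Prop :=
  (∀ j i, IsLink G i j → ∀ k, (τ j i k : ℕ∞) ≤ B j i) ∧ ∀ j k, τ j j k = 0

/-- The transmission delays are bounded: one finite number bounds the maximal delay of each link. -/
def BoundedDelays {V : Type u} (G : Digraph V) (B : V → V → ℕ∞) : Prop :=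
  ∃ D : ℕ, ∀ j i, IsLink G i j → B j i ≤ (D : ℕ∞)

/-- The packet sent by `i` to `j` at time `k - δ ≥ 0` has delay `δ`, so that it arrives at time `k`.
No packet was sent before time `0`. -/
def Arrives {V : Type u} (τ : V → V → ℕ → ℕ) (j i : V) (k δ : ℕ) : Prop :=
  δ ≤ k ∧ τ j i (k - δ) = δ

/-- Number of packets from in-neighbours that arrive at `j` exactly at time `k`. -/
def virtualInDegree {V : Type u} (G : Digraph V) (τ : V → V → ℕ → ℕ) (j : V) (k : ℕ) : ℕ :=
  {p : V × ℕ | IsLink G p.1 j ∧ Arrives τ j p.1 k p.2}.ncard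

open Classical in
/-- The pull weights `R^(δ)(k)`, with row `j` (receiver) and column `i` (sender). -/
def pull {V : Type u} (G : Digraph V) (τ : V → V → ℕ → ℕ) (k δ : ℕ) : Matrix V V ℝ :=
  Matrix.of fun j i =>
    if (i = j ∨ IsLink G i j) ∧ Arrives τ j i k δ then 1 / (1 + (virtualInDegree G τ j k : ℝ)) else 0

open Classical in
/-- The push weights `C^(δ)(k)`: the share of the surplus of `i` which is sent to `j` at time `k`, if
that packet has delay `δ`. -/
def push {V : Type u} (G : Digraph V) (τ : V → V → ℕ → ℕ) (k δ : ℕ) : Matrix V V ℝ :=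
  Matrix.of fun j i =>
    if (i = j ∨ IsLink G i j) ∧ τ j i k = δ then 1 / (1 + (outDegree G i : ℝ)) else 0

/-- The largest of the maximal delays of all links, `0` if there is no link. -/
def maxDelay {V : Type u} (G : Digraph V) (B : V → V → ℕ∞) : ℕ∞ :=
  ⨆ (j : V) (i : V) (_ : IsLink G i j), B j i

/-- Nodes of the augmented digraph: `(0, j)` is the agent `j`, and `(δ, j)` with `1 ≤ δ ≤ T` is its
virtual buffer node of level `δ`. If `T = ⊤` there is one buffer node for every `δ ≥ 1`. -/
abbrev Node (V : Type u) (T : ℕ∞) : Type u := {δ : ℕ // (δ : ℕ∞) ≤ T} × V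

/-- The actual agent `j` as a node of the augmented digraph. -/
def agent {V : Type u} (T : ℕ∞) (j : V) : Node V T := (⟨0, by simp⟩, j)

open Classical in
/-- Block row `0` is `R^(0)(k), R^(1)(k), …`; below it are identity blocks on the subdiagonal. -/
def Rtilde {V : Type u} (G : Digraph V) (τ : V → V → ℕ → ℕ) (T : ℕ∞) (k : ℕ) :
    Matrix (Node V T) (Node V T) ℝ :=
  Matrix.of fun a b =>
    if a.1.1 = 0 then pull G τ k b.1.1 a.2 b.2
    else if a.1.1 = b.1.1 + 1 ∧ a.2 = b.2 then 1 else 0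

open Classical in
/-- Block column `0` is `C^(0)(k), C^(1)(k), …`; identity blocks on the superdiagonal. -/
def Ctilde {V : Type u} (G : Digraph V) (τ : V → V → ℕ → ℕ) (T : ℕ∞) (k : ℕ) :
    Matrix (Node V T) (Node V T) ℝ :=
  Matrix.of fun a b =>
    if b.1.1 = 0 then push G τ k a.1.1 a.2 b.2
    else if b.1.1 = a.1.1 + 1 ∧ a.2 = b.2 then 1 else 0

open Classical in
/-- `γ I` in the block of the actual agents, zero elsewhere. -/
def Hmat {V : Type u} (T : ℕ∞) (γ : ℝ) : Matrix (Node V T) (Node V T) ℝ :=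
  Matrix.of fun a b => if a.1.1 = 0 ∧ a = b then γ else 0

open Classical in
/-- Block row `0` is `I - R^(0)(k), -R^(1)(k), -R^(2)(k), …`, zero elsewhere. -/
def Jmat {V : Type u} (G : Digraph V) (τ : V → V → ℕ → ℕ) (T : ℕ∞) (k : ℕ) :
    Matrix (Node V T) (Node V T) ℝ :=
  Matrix.of fun a b =>
    if a.1.1 = 0 then (if a = b then 1 else 0) - pull G τ k b.1.1 a.2 b.2 else 0

/-- The matrix `M(k)` of the augmented iteration. -/
def Mmat {V : Type u} (G : Digraph V) (τ : V → V → ℕ → ℕ) (T : ℕ∞) (γ : ℝ) (k : ℕ) :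
    Matrix (Node V T ⊕ Node V T) (Node V T ⊕ Node V T) ℝ :=
  Matrix.fromBlocks (Rtilde G τ T k) (Hmat T γ) (Jmat G τ T k) (Ctilde G τ T k - Hmat T γ)

/-- Every row of `M(k)` has only finitely many nonzero entries, also if `T = ⊤`. -/
theorem Mmat_row_finite {V : Type u} [Finite V] (G : Digraph V) (τ : V → V → ℕ → ℕ) (T : ℕ∞) (γ : ℝ)
    (k : ℕ) (a : Node V T ⊕ Node V T) : (Function.support (Mmat G τ T γ k a)).Finite := by
  have hfin : ∀ m : ℕ, {b : Node V T | b.1.1 ≤ m}.Finite := by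
    intro m
    refine Set.Finite.of_finite_image (f := fun b : Node V T => (b.1.1, b.2)) ?_ ?_
    · refine ((Set.finite_Iic m).prod (Set.finite_univ (α := V))).subset ?_
      rintro _ ⟨b, hb, rfl⟩
      exact ⟨hb, trivial⟩
    · rintro ⟨⟨x, hx⟩, v⟩ _ ⟨⟨y, hy⟩, w⟩ _ h
      simpa using h
  obtain ⟨m, hm⟩ : ∃ m, ∀ b : Node V T, m < b.1.1 →
      Mmat G τ T γ k a (Sum.inl b) = 0 ∧ Mmat G τ T γ k a (Sum.inr b) = 0 := by
    rcases a with a | a <;> refine ⟨k + a.1.1 + 1, fun b hb => ?_⟩ <;>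
    · have h1 : a ≠ b := by rintro rfl; omega
      have h2 : ¬ b.1.1 ≤ k := by omega
      have h3 : b.1.1 ≠ 0 := by omega
      have h4 : ¬ a.1.1 = b.1.1 + 1 := by omega
      have h5 : ¬ b.1.1 = a.1.1 + 1 := by omega
      simp [Mmat, Rtilde, Hmat, Jmat, Ctilde, pull, Arrives, h1, h2, h3, h4, h5]
  refine (((hfin m).image Sum.inl).union ((hfin m).image Sum.inr)).subset ?_
  rintro (b | b) hb
  · exact Or.inl ⟨b, not_lt.1 fun h => hb (hm b h).1, rfl⟩
  · exact Or.inr ⟨b, not_lt.1 fun h => hb (hm b h).2, rfl⟩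

open Classical in
/-- The augmented trajectory: the states `x̃(k)` on the left summand and the surpluses `s̃(k)` on the
right one. Agent `j` starts with state `x₀ j` and surplus `0`, and all buffers are empty. The rows of
`M(k)` are finite, so that the sum is the product of `M(k)` with the previous vector. -/
def traj {V : Type u} (G : Digraph V) (τ : V → V → ℕ → ℕ) (T : ℕ∞) (γ : ℝ) (x₀ : V → ℝ) :
    ℕ → (Node V T ⊕ Node V T → ℝ)
  | 0 => Sum.elim (fun a => if a.1.1 = 0 then x₀ a.2 else 0) (fun _ => 0)
  | k + 1 => fun a => ∑ᶠ b, Mmat G τ T γ k a b * traj G τ T γ x₀ k b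

/-- Asymptotic average consensus with surplus gain `γ`: for arbitrary (time-varying, heterogeneous)
admissible delays and arbitrary initial states, the state of each agent tends to the average of the
initial states and the surplus of each agent tends to `0`. -/
def AchievesAverageConsensus {V : Type u} [Fintype V] (G : Digraph V) (B : V → V → ℕ∞) (γ : ℝ) :
    Prop :=
  ∀ τ : V → V → ℕ → ℕ, Admissible G B τ → ∀ x₀ : V → ℝ, ∀ j : V,
    Tendsto (fun k => traj G τ (maxDelay G B) γ x₀ k (Sum.inl (agent (maxDelay G B) j))) atTop
      (𝓝 ((∑ i, x₀ i) / (Fintype.card V : ℝ))) ∧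
    Tendsto (fun k => traj G τ (maxDelay G B) γ x₀ k (Sum.inr (agent (maxDelay G B) j))) atTop (𝓝 0)

end

end RPPAC

/-!
The iteration conserves the total mass: the states of the agents plus all surpluses, including the
surplus under way. A rest state (equal states, zero surplus) therefore has the average as its common
value, and the question is whether the iteration comes to rest.

*Bounded delays, strongly connected digraph.* The augmented digraph is finite, and the transition
matrices over some window of fixed length have entries bounded below in the columns (pull) and rows
(push) of the agents, uniformly in the delays (`exists_mixing_window`). Hence the oscillation `d` of
the states contracts, and so does the `ℓ¹` distance `e` of the surplus from a multiple of the
distribution into which the push weights spread a unit of surplus. There remains one slow mode, the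
value `m` which the states would attain if no more surplus were turned into state. By conservation
of mass, the total surplus is about `-n * m` if `d` is small, and every agent holds a fixed fraction
of it, so that `m` contracts at a rate proportional to `γ` (`abs_slow_mode_le`). The couplings of
these modes are of order `γ`, except that `d` drives `e`, and a weighted sum of the three decreases
for small `γ` (`exists_small_gain`, `exists_gain_tendsto_zero`).

*A digraph that is not strongly connected.* Without delays, information never reaches the agents that
are not reachable from some agent `i`. They stay at `0` if only `i` starts with a value other than `0`
(`not_achieves_of_not_stronglyConnected`).

*Unbounded delays on a link `p → q`.* Let this be the only link with delays, and let `p` start at `1`,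
all others at `0`. While all packets on the link are withheld, the iteration on the other links comes
exponentially close to a rest state, because `q` still influences all agents and the surplus drains
from `p` into the link; while the packets that arrive, one at each step, come from such a rest state,
the iteration is held there (`exists_phaseBounds`). The adversary works in blocks of growing length.
At the beginning of a block all packets sent while the previous block had not come to rest arrive at
once. They are many, but `q` only takes a mean of their values and their surplus is summable, so the
disturbance is bounded (it grows at most geometrically with the number of the block). The rested
packets of the previous block follow one by one and pull the iteration back to the previous rest
state with an error that decays exponentially in the length of the phase; then the link is silent
while the iteration comes to rest again (`PhaseBounds.block`). If the blocks are long enough, the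
errors are summable, and the limit is nearly the value that `q` has in the first block
(`PhaseBounds.abs_limit_sub_le`). But this value depends on whether the packet sent at time `0`
is delivered at once or in the second block (`PhaseBounds.separation`), while the average does not.
-/

namespace RPPAC

open Matrix Finset

universe u

/-! ### Products of stochastic matrices -/

section Evolution

variable {ι : Type*} [Fintype ι] [DecidableEq ι]

/-- The transition matrix `P (k + i - 1) * ⋯ * P k` over `i` steps from time `k`. -/
def evol (P : ℕ → Matrix ι ι ℝ) (k : ℕ) : ℕ → Matrix ι ι ℝ
  | 0 => 1
  | i + 1 => P (k + i) * evol P k i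

@[simp] lemma evol_zero (P : ℕ → Matrix ι ι ℝ) (k : ℕ) : evol P k 0 = 1 := rfl

lemma evol_succ (P : ℕ → Matrix ι ι ℝ) (k i : ℕ) :
    evol P k (i + 1) = P (k + i) * evol P k i := rfl

lemma evol_add (P : ℕ → Matrix ι ι ℝ) (k i j : ℕ) :
    evol P k (i + j) = evol P (k + i) j * evol P k i := by
  induction j with
  | zero => simp
  | succ j ih => rw [← add_assoc, evol_succ, ih, evol_succ, Matrix.mul_assoc, add_assoc]

lemma evol_one (P : ℕ → Matrix ι ι ℝ) (k : ℕ) : evol P k 1 = P k := by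
  simp [evol_succ]

lemma evol_succ' (P : ℕ → Matrix ι ι ℝ) (k i : ℕ) :
    evol P k (i + 1) = evol P (k + 1) i * P k := by
  rw [add_comm, evol_add, evol_one]

lemma evol_mem {S : Submonoid (Matrix ι ι ℝ)} {P : ℕ → Matrix ι ι ℝ} (hP : ∀ k, P k ∈ S)
    (k i : ℕ) : evol P k i ∈ S := by
  induction i with
  | zero => exact S.one_mem
  | succ i ih => exact S.mul_mem (hP _) ih

lemma evol_nonneg {P : ℕ → Matrix ι ι ℝ} (hP : ∀ k a b, 0 ≤ P k a b) (k i : ℕ) (a b : ι) :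
    0 ≤ evol P k i a b := by
  induction i generalizing a with
  | zero => by_cases h : a = b <;> simp [h]
  | succ i ih => exact Finset.sum_nonneg fun c _ => mul_nonneg (hP _ _ _) (ih c)

/-- In `i` steps from time `k`, the entry at `c` influences the one at `a` with weight at least
`β ^ i`. -/
def Reach (P : ℕ → Matrix ι ι ℝ) (β : ℝ) (k i : ℕ) (a c : ι) : Prop := β ^ i ≤ evol P k i a c

lemma Reach.refl (P : ℕ → Matrix ι ι ℝ) (β : ℝ) (k : ℕ) (a : ι) : Reach P β k 0 a a := by
  simp [Reach]

lemma Reach.trans {P : ℕ → Matrix ι ι ℝ} (hP : ∀ k a b, 0 ≤ P k a b) {β : ℝ} (hβ : 0 ≤ β)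
    {k i j : ℕ} {a b c : ι} (h₁ : Reach P β k i b c) (h₂ : Reach P β (k + i) j a b) :
    Reach P β k (i + j) a c := by
  unfold Reach at *
  rw [evol_add, Matrix.mul_apply, pow_add, mul_comm]
  calc β ^ j * β ^ i ≤ evol P (k + i) j a b * evol P k i b c :=
        mul_le_mul h₂ h₁ (by positivity) (evol_nonneg hP _ _ _ _)
    _ ≤ _ := Finset.single_le_sum (f := fun b => evol P (k + i) j a b * evol P k i b c)
        (fun d _ => mul_nonneg (evol_nonneg hP _ _ _ _) (evol_nonneg hP _ _ _ _))
        (Finset.mem_univ b)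

lemma Reach.one {P : ℕ → Matrix ι ι ℝ} {β : ℝ} {k : ℕ} {a c : ι} (h : β ≤ P k a c) :
    Reach P β k 1 a c := by
  simpa [Reach, evol_one] using h

lemma Reach.stay {P : ℕ → Matrix ι ι ℝ} (hP : ∀ k a b, 0 ≤ P k a b) {β : ℝ} (hβ : 0 ≤ β)
    {a : ι} (h : ∀ k, β ≤ P k a a) (k i : ℕ) : Reach P β k i a a := by
  induction i with
  | zero => exact Reach.refl ..
  | succ i ih => exact ih.trans hP hβ (Reach.one (h _))

/-- If each hop of a path takes exactly `T` steps, and if the nodes of the path keep their values,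
then the number of steps can be chosen uniformly over all pairs of connected nodes, and it depends
only on the digraph. -/
lemma Reach.exists_uniform {α : Type*} [Finite α] (r : α → α → Prop) : ∃ h : ℕ,
    ∀ {P : ℕ → Matrix ι ι ℝ} {β : ℝ} (f : α → ι) {T : ℕ}, (∀ k a b, 0 ≤ P k a b) → 0 ≤ β →
      (∀ a k, β ≤ P k (f a) (f a)) → (∀ k a c, r a c → Reach P β k T (f a) (f c)) →
      ∀ a c, Relation.ReflTransGen r a c → ∀ k, Reach P β k (h * T) (f a) (f c) := by
  have key : ∀ p : α × α, ∃ m : ℕ,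
      ∀ {P : ℕ → Matrix ι ι ℝ} {β : ℝ} (f : α → ι) {T : ℕ}, (∀ k a b, 0 ≤ P k a b) → 0 ≤ β →
      (∀ k a c, r a c → Reach P β k T (f a) (f c)) →
      Relation.ReflTransGen r p.1 p.2 → ∀ k, Reach P β k (m * T) (f p.1) (f p.2) := by
    rintro ⟨a, c⟩
    by_cases h : Relation.ReflTransGen r a c
    · induction h with
      | refl => exact ⟨0, fun f _ _ _ _ _ k => by simpa using Reach.refl ..⟩
      | tail _ hbc ih =>
        obtain ⟨m, hm⟩ := ih
        refine ⟨m + 1, fun f T hP hβ hop _ k => ?_⟩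
        rw [add_mul, one_mul, add_comm]
        exact (hop k _ _ hbc).trans hP hβ (hm f hP hβ hop ‹_› _)
    · exact ⟨0, fun _ _ _ _ _ h' => absurd h' h⟩
  choose m hm using key
  have := Fintype.ofFinite α
  refine ⟨∑ p, m p, fun f T hP hβ hself hop a c hac k => ?_⟩
  obtain ⟨d, hd⟩ := Nat.exists_eq_add_of_le
    (Finset.single_le_sum (f := m) (fun _ _ => Nat.zero_le _) (Finset.mem_univ (a, c)))
  rw [hd, add_mul]
  exact (hm (a, c) f hP hβ hop hac k).trans hP hβ (Reach.stay hP hβ (hself a) _ _)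

end Evolution

/-! ### Oscillation and the `ℓ¹` norm -/

section Norms

variable {ι : Type*}

/-- The oscillation `max x - min x` of a vector. -/
noncomputable def osc (x : ι → ℝ) : ℝ := ⨆ p : ι × ι, |x p.1 - x p.2|

lemma osc_le {x : ι → ℝ} {c : ℝ} (hc : 0 ≤ c) (h : ∀ a b, |x a - x b| ≤ c) : osc x ≤ c :=
  Real.iSup_le (fun p => h p.1 p.2) hc

lemma osc_nonneg (x : ι → ℝ) : 0 ≤ osc x := Real.iSup_nonneg fun _ => abs_nonneg _

lemma osc_le_two_mul {x : ι → ℝ} {c : ℝ} (h : ∀ a, |x a| ≤ c) (hc : 0 ≤ c) : osc x ≤ 2 * c :=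
  osc_le (by linarith) fun a b => (abs_sub _ _).trans (by linarith [h a, h b])

variable [Fintype ι]

/-- The `ℓ¹` norm of a vector. -/
def l1 (r : ι → ℝ) : ℝ := ∑ a, |r a|

lemma abs_sub_le_osc (x : ι → ℝ) (a b : ι) : |x a - x b| ≤ osc x :=
  le_ciSup (f := fun p : ι × ι => |x p.1 - x p.2|) (Set.finite_range _).bddAbove (a, b)

lemma osc_add (x y : ι → ℝ) : osc (x + y) ≤ osc x + osc y :=
  osc_le (add_nonneg (osc_nonneg x) (osc_nonneg y)) fun a b => by
    have h : (x + y) a - (x + y) b = (x a - x b) + (y a - y b) := by simp; ring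
    rw [h]
    exact (abs_add_le _ _).trans (add_le_add (abs_sub_le_osc x a b) (abs_sub_le_osc y a b))

lemma l1_nonneg (r : ι → ℝ) : 0 ≤ l1 r := Finset.sum_nonneg fun _ _ => abs_nonneg _

lemma abs_le_l1 (r : ι → ℝ) (a : ι) : |r a| ≤ l1 r :=
  Finset.single_le_sum (f := fun a => |r a|) (fun _ _ => abs_nonneg _) (Finset.mem_univ a)

lemma abs_sum_le_l1 (r : ι → ℝ) : |∑ a, r a| ≤ l1 r := Finset.abs_sum_le_sum_abs _ _

lemma l1_add (r s : ι → ℝ) : l1 (r + s) ≤ l1 r + l1 s := by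
  unfold l1
  rw [← Finset.sum_add_distrib]
  exact Finset.sum_le_sum fun a _ => abs_add_le _ _

lemma l1_smul (c : ℝ) (r : ι → ℝ) : l1 (c • r) = |c| * l1 r := by
  simp [l1, abs_mul, Finset.mul_sum]

lemma osc_mulVec_le_of_le [DecidableEq ι] {P : Matrix ι ι ℝ} (hP : P ∈ rowStochastic ℝ ι) {η : ℝ}
    {j : ι} (hη : ∀ a, η ≤ P a j) (x : ι → ℝ) : osc (P *ᵥ x) ≤ (1 - η) * osc x := by
  rw [mem_rowStochastic_iff_sum] at hP
  have hη1 : η ≤ 1 := (hη j).trans (by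
    rw [← hP.2 j]; exact Finset.single_le_sum (fun b _ => hP.1 j b) (Finset.mem_univ j))
  have : Nonempty ι := ⟨j⟩
  obtain ⟨u, hu⟩ := Finite.exists_max x
  obtain ⟨l, hl⟩ := Finite.exists_min x
  have hup : ∀ a, (P *ᵥ x) a ≤ (1 - η) * x u + η * x j := by
    intro a
    have h1 : ∑ b, P a b * (x u - x b) ≥ P a j * (x u - x j) :=
      Finset.single_le_sum (f := fun b => P a b * (x u - x b))
        (fun b _ => mul_nonneg (hP.1 a b) (by linarith [hu b])) (Finset.mem_univ j)
    have h2 : ∑ b, P a b * (x u - x b) = x u - (P *ᵥ x) a := by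
      simp only [mul_sub, Finset.sum_sub_distrib, ← Finset.sum_mul, hP.2 a, one_mul]
      rfl
    have h3 : η * (x u - x j) ≤ P a j * (x u - x j) :=
      mul_le_mul_of_nonneg_right (hη a) (by linarith [hu j])
    linarith
  have hlo : ∀ a, (1 - η) * x l + η * x j ≤ (P *ᵥ x) a := by
    intro a
    have h1 : ∑ b, P a b * (x b - x l) ≥ P a j * (x j - x l) :=
      Finset.single_le_sum (f := fun b => P a b * (x b - x l))
        (fun b _ => mul_nonneg (hP.1 a b) (by linarith [hl b])) (Finset.mem_univ j)
    have h2 : ∑ b, P a b * (x b - x l) = (P *ᵥ x) a - x l := by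
      simp only [mul_sub, Finset.sum_sub_distrib, ← Finset.sum_mul, hP.2 a, one_mul]
      rfl
    have h3 : η * (x j - x l) ≤ P a j * (x j - x l) :=
      mul_le_mul_of_nonneg_right (hη a) (by linarith [hl j])
    linarith
  have hul : x u - x l ≤ osc x := (le_abs_self _).trans (abs_sub_le_osc x u l)
  have h4 : (1 - η) * (x u - x l) ≤ (1 - η) * osc x :=
    mul_le_mul_of_nonneg_left hul (by linarith)
  refine osc_le (mul_nonneg (by linarith) (osc_nonneg x)) fun a b => abs_le.2 ⟨?_, ?_⟩
  · linarith [hup b, hlo a]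
  · linarith [hup a, hlo b]

lemma osc_mulVec_le [DecidableEq ι] {P : Matrix ι ι ℝ} (hP : P ∈ rowStochastic ℝ ι) (x : ι → ℝ) :
    osc (P *ᵥ x) ≤ osc x := by
  rcases isEmpty_or_nonempty ι with h | ⟨⟨j⟩⟩
  · exact osc_le (osc_nonneg x) fun a => h.elim a
  · simpa using osc_mulVec_le_of_le hP (η := 0) (j := j)
      (fun a => (mem_rowStochastic.1 hP).1 a j) x

lemma abs_sub_mulVec_le [DecidableEq ι] {P : Matrix ι ι ℝ} (hP : P ∈ rowStochastic ℝ ι)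
    (x : ι → ℝ) (a b : ι) : |x b - (P *ᵥ x) a| ≤ osc x := by
  rw [mem_rowStochastic_iff_sum] at hP
  have h : x b - (P *ᵥ x) a = ∑ c, P a c * (x b - x c) := by
    simp only [mul_sub, Finset.sum_sub_distrib, ← Finset.sum_mul, hP.2 a, one_mul]
    rfl
  rw [h]
  calc |∑ c, P a c * (x b - x c)| ≤ ∑ c, P a c * osc x :=
        (Finset.abs_sum_le_sum_abs _ _).trans (Finset.sum_le_sum fun c _ => by
          rw [abs_mul, abs_of_nonneg (hP.1 a c)]
          exact mul_le_mul_of_nonneg_left (abs_sub_le_osc x b c) (hP.1 a c))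
    _ = osc x := by rw [← Finset.sum_mul, hP.2 a, one_mul]

lemma sum_mulVec [DecidableEq ι] {C : Matrix ι ι ℝ} (hC : C ∈ colStochastic ℝ ι) (r : ι → ℝ) :
    ∑ a, (C *ᵥ r) a = ∑ a, r a := by
  rw [mem_colStochastic_iff_sum] at hC
  simp only [mulVec, dotProduct]
  rw [Finset.sum_comm]
  exact Finset.sum_congr rfl fun b _ => by rw [← Finset.sum_mul, hC.2 b, one_mul]

lemma l1_mulVec_le [DecidableEq ι] {C : Matrix ι ι ℝ} {c : ℝ} (h0 : ∀ a b, 0 ≤ C a b)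
    (h1 : ∀ b, ∑ a, C a b ≤ c) (r : ι → ℝ) : l1 (C *ᵥ r) ≤ c * l1 r := by
  unfold l1
  calc ∑ a, |(C *ᵥ r) a| ≤ ∑ a, ∑ b, C a b * |r b| :=
        Finset.sum_le_sum fun a _ => (Finset.abs_sum_le_sum_abs _ _).trans
          (Finset.sum_le_sum fun b _ => by rw [abs_mul, abs_of_nonneg (h0 a b)])
    _ = ∑ b, (∑ a, C a b) * |r b| := by
        rw [Finset.sum_comm]; exact Finset.sum_congr rfl fun b _ => by rw [Finset.sum_mul]
    _ ≤ ∑ b, c * |r b| :=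
        Finset.sum_le_sum fun b _ => mul_le_mul_of_nonneg_right (h1 b) (abs_nonneg _)
    _ = c * ∑ a, |r a| := by rw [Finset.mul_sum]

lemma l1_mulVec_le_self [DecidableEq ι] {C : Matrix ι ι ℝ} (hC : C ∈ colStochastic ℝ ι)
    (r : ι → ℝ) : l1 (C *ᵥ r) ≤ l1 r := by
  rw [mem_colStochastic_iff_sum] at hC
  simpa using l1_mulVec_le hC.1 (fun b => (hC.2 b).le) r

lemma l1_mulVec_le_of_le [DecidableEq ι] {C : Matrix ι ι ℝ} (hC : C ∈ colStochastic ℝ ι) {η : ℝ}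
    {j : ι} (hη : ∀ b, η ≤ C j b) {r : ι → ℝ} (hr : ∑ a, r a = 0) :
    l1 (C *ᵥ r) ≤ (1 - η) * l1 r := by
  rw [mem_colStochastic_iff_sum] at hC
  -- subtracting a multiple of the functional that vanishes on `r` does not change the product
  let C' : Matrix ι ι ℝ := C - Matrix.of fun a _ => if a = j then η else 0
  have hC' : C' *ᵥ r = C *ᵥ r := by
    ext a
    rw [Matrix.sub_mulVec, Pi.sub_apply]
    have : (Matrix.of (fun a _ => if a = j then η else 0) *ᵥ r) a = 0 := by
      change ∑ b, (if a = j then η else 0) * r b = 0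
      rw [← Finset.mul_sum, hr, mul_zero]
    rw [this, sub_zero]
  rw [← hC']
  refine l1_mulVec_le (fun a b => ?_) (fun b => ?_) r
  · by_cases h : a = j
    · subst h; simpa [C'] using hη b
    · simpa [C', h] using hC.1 a b
  · simp [C', Finset.sum_sub_distrib, hC.2 b]

end Norms

/-! ### Adapted functionals -/

section Adapted

variable {ι : Type*} [Fintype ι] [DecidableEq ι]

/-- The sum of `p` over a window of `L` steps of the evolution that starts with `x` at time `k`. If
`p` does not increase along the evolution and contracts over `L` steps, then this functional is
equivalent to `p` and contracts in each single step. -/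
def adapted (P : ℕ → Matrix ι ι ℝ) (p : (ι → ℝ) → ℝ) (L k : ℕ) (x : ι → ℝ) : ℝ :=
  ∑ i ∈ range L, p (evol P k i *ᵥ x)

variable {P : ℕ → Matrix ι ι ℝ} {p : (ι → ℝ) → ℝ} {L : ℕ}

lemma evol_le (hle : ∀ k x, p (P k *ᵥ x) ≤ p x) (k i : ℕ) (x : ι → ℝ) :
    p (evol P k i *ᵥ x) ≤ p x := by
  induction i with
  | zero => simp
  | succ i ih => rw [evol_succ, ← Matrix.mulVec_mulVec]; exact (hle _ _).trans ih

lemma adapted_le (hle : ∀ k x, p (P k *ᵥ x) ≤ p x) (k : ℕ) (x : ι → ℝ) :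
    adapted P p L k x ≤ L * p x := by
  calc adapted P p L k x ≤ ∑ _i ∈ range L, p x := Finset.sum_le_sum fun i _ => evol_le hle k i x
    _ = L * p x := by simp

lemma le_adapted (h0 : ∀ x, 0 ≤ p x) (hL : 0 < L) (k : ℕ) (x : ι → ℝ) :
    p x ≤ adapted P p L k x := by
  have := Finset.single_le_sum (f := fun i => p (evol P k i *ᵥ x)) (fun i _ => h0 _)
    (Finset.mem_range.2 hL)
  simpa [adapted] using this

lemma adapted_nonneg (h0 : ∀ x, 0 ≤ p x) (k : ℕ) (x : ι → ℝ) : 0 ≤ adapted P p L k x :=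
  Finset.sum_nonneg fun _ _ => h0 _

lemma adapted_add (hadd : ∀ x y, p (x + y) ≤ p x + p y) (k : ℕ) (x y : ι → ℝ) :
    adapted P p L k (x + y) ≤ adapted P p L k x + adapted P p L k y := by
  unfold adapted
  rw [← Finset.sum_add_distrib]
  exact Finset.sum_le_sum fun i _ => by rw [Matrix.mulVec_add]; exact hadd _ _

lemma adapted_step (hle : ∀ k x, p (P k *ᵥ x) ≤ p x) (hL : 0 < L) {η : ℝ} (hη : 0 ≤ η) {k : ℕ}
    {x : ι → ℝ} (hx : p (evol P k L *ᵥ x) ≤ (1 - η) * p x) :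
    adapted P p L (k + 1) (P k *ᵥ x) ≤ (1 - η / L) * adapted P p L k x := by
  have h1 : adapted P p L (k + 1) (P k *ᵥ x) + p x
      = adapted P p L k x + p (evol P k L *ᵥ x) := by
    have h := Finset.sum_range_succ (fun i => p (evol P k i *ᵥ x)) L
    rw [Finset.sum_range_succ'] at h
    simpa [adapted, evol_succ', Matrix.mulVec_mulVec] using h
  have h2 := adapted_le (L := L) hle k x
  have hL' : (0 : ℝ) < L := by exact_mod_cast hL
  have h3 : η / L * adapted P p L k x ≤ η * p x := by
    rw [div_mul_eq_mul_div, div_le_iff₀ hL']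
    calc η * adapted P p L k x ≤ η * (L * p x) := mul_le_mul_of_nonneg_left h2 hη
      _ = η * p x * L := by ring
  linarith

end Adapted

/-! ### Small-gain inequalities -/

/-- Small gain for a slow mode `m` (contracting at rate `c * γ`), a fast mode `d` that is driven with
gain `O(γ)`, and a fast mode `e` that is driven by `d`. -/
lemma exists_small_gain {C ρ c : ℝ} (hC : 0 ≤ C) (hρ1 : ρ < 1) (hc : 0 < c) :
    ∃ γ₀ > 0, ∃ a > 0, ∃ b > 0, ∀ γ, 0 < γ → γ < γ₀ → ∃ lam, 0 ≤ lam ∧ lam < 1 ∧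
      ∀ m d e m' d' e' : ℝ, 0 ≤ m → 0 ≤ d → 0 ≤ e →
        m' ≤ (1 - c * γ) * m + C * γ * (d + e) →
        d' ≤ ρ * d + C * γ * (m + d + e) →
        e' ≤ ρ * e + C * d + C * γ * (m + d + e) →
        m' + a * d' + b * e' ≤ lam * (m + a * d + b * e) := by
  set δ := 1 - ρ with hδ
  have hδ0 : 0 < δ := by linarith
  -- `a` and `b` are small against `c`: the feedback of `m` through the fast modes is then a fraction
  -- of `c * γ`; and `b` is small against `a`, so that `a * d` absorbs the drive of `e` by `d`
  set a := c / (4 * (C + 1)) with ha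
  have ha0 : 0 < a := by positivity
  have haC : a * (4 * (C + 1)) = c := by rw [ha]; field_simp
  set u := min 1 (δ / (4 * (C + 1))) with hu
  have hu0 : 0 < u := lt_min one_pos (by positivity)
  have hu1 : u ≤ 1 := min_le_left _ _
  have huC : u * (4 * (C + 1)) ≤ δ := by
    rw [← le_div_iff₀ (by positivity)]; exact min_le_right _ _
  set b := a * u with hb
  have hb0 : 0 < b := by positivity
  have hba : b ≤ a := by rw [hb]; nlinarith
  have hbC : b * (4 * (C + 1)) ≤ a * δ := by rw [hb]; nlinarith
  -- for this range of `γ` both fast modes still contract faster than the slow mode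
  set γ₁ := min (b * δ / (4 * (C + 1) * (1 + a + b))) (min (δ / (2 * c)) (1 / c)) with hγ₁
  refine ⟨γ₁, ?_, a, ha0, b, hb0, fun γ hγ hγ₁' => ?_⟩
  · exact lt_min (by positivity) (lt_min (by positivity) (by positivity))
  have h1 : γ * (4 * (C + 1) * (1 + a + b)) ≤ b * δ := by
    rw [← le_div_iff₀ (by positivity)]; exact hγ₁'.le.trans (min_le_left _ _)
  have h2 : γ * (2 * c) ≤ δ := by
    rw [← le_div_iff₀ (by positivity)]
    exact hγ₁'.le.trans ((min_le_right _ _).trans (min_le_left _ _))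
  have h3 : γ * c ≤ 1 := by
    rw [← le_div_iff₀ (by positivity)]
    exact hγ₁'.le.trans ((min_le_right _ _).trans (min_le_right _ _))
  have hcg : 0 < c * γ := by positivity
  refine ⟨1 - c * γ / 2, by linarith, by linarith, ?_⟩
  intro m d e m' d' e' hm hd he h4 h5 h6
  have hCg : 0 ≤ C * γ := by positivity
  have h7 : C * γ * (1 + a + b) ≤ b * δ / 4 := by
    nlinarith [mul_nonneg hγ.le ha0.le, mul_nonneg hγ.le hb0.le]
  have h8 : C * γ * (a + b) ≤ c * γ / 2 := by
    have : C * (a + b) ≤ c / 2 := by nlinarith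
    nlinarith
  have hcg2 : c * γ / 2 ≤ δ / 4 := by linarith
  have hd' : C * γ * (1 + a + b) + a * ρ + b * C ≤ (1 - c * γ / 2) * a := by
    have : b * δ / 4 ≤ a * δ / 4 := by nlinarith
    have : b * C ≤ a * δ / 4 := by nlinarith
    have : a * ρ = a - a * δ := by rw [hδ]; ring
    have := mul_le_mul_of_nonneg_right hcg2 ha0.le
    have : 0 < a * δ := by positivity
    linarith
  have he' : C * γ * (1 + a + b) + b * ρ ≤ (1 - c * γ / 2) * b := by
    have : b * ρ = b - b * δ := by rw [hδ]; ring
    have := mul_le_mul_of_nonneg_right hcg2 hb0.le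
    have : 0 < b * δ := by positivity
    linarith
  have h5' := mul_le_mul_of_nonneg_left h5 ha0.le
  have h6' := mul_le_mul_of_nonneg_left h6 hb0.le
  have h8' := mul_le_mul_of_nonneg_right h8 hm
  have hd'' := mul_le_mul_of_nonneg_right hd' hd
  have he'' := mul_le_mul_of_nonneg_right he' he
  linarith

/-- Small gain for two fast modes without slow mode, with an external disturbance `F`. The rate does
not depend on `γ`. -/
lemma exists_small_gain_two {C ρ : ℝ} (hC : 0 ≤ C) (hρ0 : 0 ≤ ρ) (hρ1 : ρ < 1) :
    ∃ γ₀ > 0, ∃ b > 0, ∃ lam, 0 < lam ∧ lam < 1 ∧ ∀ γ, 0 < γ → γ < γ₀ →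
      ∀ d e d' e' F : ℝ, 0 ≤ d → 0 ≤ e →
        d' ≤ ρ * d + C * γ * e + C * F →
        e' ≤ ρ * e + C * d + C * γ * e + C * F →
        d' + b * e' ≤ lam * (d + b * e) + (C + b * C) * F := by
  set δ := 1 - ρ with hδ
  have hδ0 : 0 < δ := by linarith
  set b := δ / (2 * (C + 1)) with hb
  have hb0 : 0 < b := by positivity
  have hbC : b * (2 * (C + 1)) = δ := by rw [hb]; field_simp
  refine ⟨b * δ / (2 * (C + 1) * (1 + b)), by positivity, b, hb0, (1 + ρ) / 2, by linarith,
    by linarith, fun γ hγ hγ₁ d e d' e' F hd he h4 h5 => ?_⟩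
  have h1 : γ * (2 * (C + 1) * (1 + b)) ≤ b * δ := by
    rw [← le_div_iff₀ (by positivity)]; exact hγ₁.le
  have h2 : C * γ * (1 + b) ≤ b * δ / 2 := by nlinarith [mul_nonneg hγ.le hb0.le]
  have h3 : ρ + b * C ≤ (1 + ρ) / 2 := by nlinarith
  have h6 : C * γ * (1 + b) + b * ρ ≤ (1 + ρ) / 2 * b := by
    have : b * ρ = b - b * δ := by rw [hδ]; ring
    have : (1 + ρ) / 2 * b = b - b * δ / 2 := by rw [hδ]; ring
    linarith
  have h5' := mul_le_mul_of_nonneg_left h5 hb0.le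
  have h3' := mul_le_mul_of_nonneg_right h3 hd
  have h6' := mul_le_mul_of_nonneg_right h6 he
  linarith

lemma le_pow_of_step {V : ℕ → ℝ} {lam B : ℝ} (h0 : 0 ≤ lam) (h1 : lam < 1) (hB : 0 ≤ B) {N : ℕ}
    (h : ∀ k < N, V (k + 1) ≤ lam * V k + B) : ∀ k ≤ N, V k ≤ lam ^ k * V 0 + B / (1 - lam) := by
  have h2 : 0 < 1 - lam := by linarith
  intro k
  induction k with
  | zero => intro _; have : 0 ≤ B / (1 - lam) := by positivity
            simp; linarith
  | succ k ih =>
    intro hk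
    have h3 := mul_le_mul_of_nonneg_left (ih (by omega)) h0
    have h4 : lam * (B / (1 - lam)) + B = B / (1 - lam) := by field_simp; ring
    have h5 := h k (by omega)
    rw [pow_succ]
    linarith

/-! ### Consensus under uniformly mixing weights -/

section Consensus

variable {ι : Type*} [DecidableEq ι]

/-- The vector that agrees with `y` on `S` and vanishes elsewhere. -/
def restrict (S : Finset ι) (y : ι → ℝ) : ι → ℝ := fun a => if a ∈ S then y a else 0

lemma restrict_add (S : Finset ι) (y z : ι → ℝ) :
    restrict S (y + z) = restrict S y + restrict S z := by
  ext a; by_cases h : a ∈ S <;> simp [restrict, h]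

lemma restrict_smul (S : Finset ι) (c : ℝ) (y : ι → ℝ) :
    restrict S (c • y) = c • restrict S y := by
  ext a; by_cases h : a ∈ S <;> simp [restrict, h]

lemma abs_restrict_le (S : Finset ι) (y : ι → ℝ) (a : ι) : |restrict S y a| ≤ |y a| := by
  by_cases h : a ∈ S <;> simp [restrict, h]

variable [Fintype ι]

lemma l1_restrict_le (S : Finset ι) (y : ι → ℝ) : l1 (restrict S y) ≤ l1 y :=
  Finset.sum_le_sum fun a _ => abs_restrict_le S y a

lemma sum_restrict (S : Finset ι) (y : ι → ℝ) : ∑ a, restrict S y a = ∑ a ∈ S, y a := by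
  simp [restrict, Finset.sum_ite_mem]

lemma l1_restrict_le_card (S : Finset ι) {y : ι → ℝ} {c : ℝ} (h : ∀ a, |y a| ≤ c) :
    l1 (restrict S y) ≤ S.card * c := by
  have : l1 (restrict S y) = ∑ a ∈ S, |y a| := by
    rw [← sum_restrict S (fun a => |y a|)]
    exact Finset.sum_congr rfl fun a _ => by by_cases h : a ∈ S <;> simp [restrict, h]
  rw [this, ← nsmul_eq_mul]
  exact Finset.sum_le_card_nsmul _ _ _ fun a _ => h a

lemma abs_mulVec_le_l1 {P : Matrix ι ι ℝ} (hP : P ∈ rowStochastic ℝ ι) (y : ι → ℝ) (a : ι) :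
    |(P *ᵥ y) a| ≤ l1 y := by
  refine (Finset.abs_sum_le_sum_abs _ _).trans (Finset.sum_le_sum fun b _ => ?_)
  rw [abs_mul, abs_of_nonneg (nonneg_of_mem_rowStochastic hP)]
  exact mul_le_of_le_one_left (abs_nonneg _) (le_one_of_mem_rowStochastic hP)

/-- A column of `N` that is bounded below stays so under averaging from the left. -/
lemma le_mul_apply_of_rowStochastic {M N : Matrix ι ι ℝ} (hM : M ∈ rowStochastic ℝ ι) {η : ℝ}
    {a : ι} (hN : ∀ b, η ≤ N b a) (b : ι) : η ≤ (M * N) b a := by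
  rw [mem_rowStochastic_iff_sum] at hM
  calc η = ∑ c, M b c * η := by rw [← Finset.sum_mul, hM.2, one_mul]
    _ ≤ _ := Finset.sum_le_sum fun c _ => mul_le_mul_of_nonneg_left (hN c) (hM.1 b c)

lemma le_mul_apply_of_colStochastic {M N : Matrix ι ι ℝ} (hN : N ∈ colStochastic ℝ ι) {η : ℝ}
    {a : ι} (hM : ∀ b, η ≤ M a b) (b : ι) : η ≤ (M * N) a b := by
  rw [mem_colStochastic_iff_sum] at hN
  calc η = ∑ c, η * N c b := by rw [← Finset.mul_sum, hN.2, mul_one]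
    _ ≤ _ := Finset.sum_le_sum fun c _ => mul_le_mul_of_nonneg_right (hM c) (hN.1 c b)

/-- The surplus iteration with nodes `ι`, agents `S`, pull weights `R` and push weights `C`, centred
so that the conserved total mass is zero. -/
structure SurplusIteration (S : Finset ι) (R C : ℕ → Matrix ι ι ℝ) (γ : ℝ) (x s : ℕ → ι → ℝ) :
    Prop where
  pull_mem : ∀ k, R k ∈ rowStochastic ℝ ι
  push_mem : ∀ k, C k ∈ colStochastic ℝ ι
  state_step : ∀ k, x (k + 1) = R k *ᵥ x k + γ • restrict S (s k)
  surplus_step : ∀ k, s (k + 1) =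
    C k *ᵥ s k + (restrict S (x k - R k *ᵥ x k) - γ • restrict S (s k))
  mass_zero : ∑ a ∈ S, x 0 a + ∑ a, s 0 a = 0

variable {S : Finset ι} {R C : ℕ → Matrix ι ι ℝ} {γ : ℝ} {x s : ℕ → ι → ℝ}

lemma SurplusIteration.mass_eq (h : SurplusIteration S R C γ x s) (k : ℕ) :
    ∑ a, s k a = -∑ a ∈ S, x k a := by
  induction k with
  | zero => linarith [h.mass_zero]
  | succ k ih =>
    rw [h.state_step, h.surplus_step, ← sum_restrict S, restrict_add]
    have h1 : restrict S (restrict S (s k)) = restrict S (s k) := by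
      ext a; by_cases ha : a ∈ S <;> simp [restrict, ha]
    have h2 : restrict S (x k - R k *ᵥ x k) = restrict S (x k) - restrict S (R k *ᵥ x k) := by
      ext a; by_cases ha : a ∈ S <;> simp [restrict, ha]
    rw [restrict_smul, h1, h2]
    simp only [Pi.add_apply, Pi.sub_apply, Finset.sum_add_distrib, Finset.sum_sub_distrib,
      sum_mulVec (h.push_mem k), ih, sum_restrict S (x k)]
    ring

/-- The average value `m` of `x` as seen from the far future moves at rate proportional to `γ`
towards zero: the surplus is spread over all nodes according to `π`, and each agent turns the
fraction `γ` of its own surplus into state. -/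
lemma abs_slow_mode_le {S : Finset ι} {E R : Matrix ι ι ℝ} (hE : E ∈ rowStochastic ℝ ι)
    (hR : R ∈ rowStochastic ℝ ι) {b : ι} {η γ : ℝ} (hη : 0 ≤ η) (hγ : 0 ≤ γ)
    (hγS : γ * S.card ≤ 1) {π r y : ι → ℝ} (hEη : ∀ a ∈ S, η ≤ E b a) (hπ0 : ∀ a, 0 ≤ π a)
    (hπ1 : ∑ a, π a = 1) (hπη : ∀ a ∈ S, η ≤ π a) {σ : ℝ} (hσ : σ = -∑ a ∈ S, y a) :
    |(E *ᵥ (R *ᵥ y + γ • restrict S (σ • π + r))) b| ≤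
      (1 - (S.card : ℝ) ^ 2 * η ^ 2 * γ) * |((E * R) *ᵥ y) b| +
        γ * (S.card * osc y + l1 r) := by
  set n : ℝ := (S.card : ℝ) with hn
  have hn0 : 0 ≤ n := Nat.cast_nonneg _
  set M := ((E * R) *ᵥ y) b with hM
  set w := (E *ᵥ restrict S π) b with hw
  have hwsum : w = ∑ a ∈ S, E b a * π a := by
    rw [hw]
    change ∑ a, E b a * restrict S π a = _
    rw [← sum_restrict S (fun a => E b a * π a)]
    exact Finset.sum_congr rfl fun a _ => by by_cases h : a ∈ S <;> simp [restrict, h]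
  have hw1 : w ≤ 1 := by
    rw [hwsum, ← hπ1]
    calc ∑ a ∈ S, E b a * π a ≤ ∑ a ∈ S, π a := Finset.sum_le_sum fun a _ =>
          mul_le_of_le_one_left (hπ0 a) (le_one_of_mem_rowStochastic hE)
      _ ≤ ∑ a, π a := Finset.sum_le_univ_sum_of_nonneg hπ0
  have hwη : n * η ^ 2 ≤ w := by
    rw [hwsum, hn, ← nsmul_eq_mul]
    refine Finset.card_nsmul_le_sum _ _ _ fun a ha => ?_
    rw [pow_two]
    exact mul_le_mul (hEη a ha) (hπη a ha) hη (hη.trans (hEη a ha))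
  have hexp : (E *ᵥ (R *ᵥ y + γ • restrict S (σ • π + r))) b
      = M + γ * (σ * w + (E *ᵥ restrict S r) b) := by
    rw [restrict_add, restrict_smul]
    simp only [Matrix.mulVec_add, Matrix.mulVec_smul, Matrix.mulVec_mulVec, Pi.add_apply,
      Pi.smul_apply, smul_eq_mul, hM, hw]
  -- the total surplus is nearly `-n * M`, because the agents have nearly the value `M`
  have herr : |σ + n * M| ≤ n * osc y := by
    have h1 : σ + n * M = ∑ a ∈ S, (M - y a) := by
      rw [Finset.sum_sub_distrib, hσ, hn, Finset.sum_const, nsmul_eq_mul]; ring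
    rw [h1]
    refine (Finset.abs_sum_le_sum_abs _ _).trans ?_
    rw [hn, ← nsmul_eq_mul]
    refine Finset.sum_le_card_nsmul _ _ _ fun a _ => ?_
    rw [abs_sub_comm]
    exact abs_sub_mulVec_le (mul_mem hE hR) y b a
  have hr : |(E *ᵥ restrict S r) b| ≤ l1 r :=
    (abs_mulVec_le_l1 hE _ b).trans (l1_restrict_le S r)
  have hw0 : 0 ≤ w := le_trans (by positivity) hwη
  have hsplit : M + γ * (σ * w + (E *ᵥ restrict S r) b)
      = (1 - γ * n * w) * M + γ * ((σ + n * M) * w + (E *ᵥ restrict S r) b) := by ring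
  have hcoef : 0 ≤ 1 - γ * n * w := by
    have : γ * n * w ≤ 1 * 1 := mul_le_mul hγS hw1 hw0 zero_le_one
    linarith
  have hcoef' : 1 - γ * n * w ≤ 1 - n ^ 2 * η ^ 2 * γ := by
    have : γ * n * (n * η ^ 2) ≤ γ * n * w := mul_le_mul_of_nonneg_left hwη (by positivity)
    linarith
  rw [hexp, hsplit]
  calc _ ≤ |(1 - γ * n * w) * M| + |γ * ((σ + n * M) * w + (E *ᵥ restrict S r) b)| :=
        abs_add_le _ _
    _ = (1 - γ * n * w) * |M| + γ * |(σ + n * M) * w + (E *ᵥ restrict S r) b| := by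
        rw [abs_mul, abs_mul, abs_of_nonneg hcoef, abs_of_nonneg hγ]
    _ ≤ (1 - n ^ 2 * η ^ 2 * γ) * |M| + γ * (n * osc y + l1 r) := by
        refine add_le_add (mul_le_mul_of_nonneg_right hcoef' (abs_nonneg _))
          (mul_le_mul_of_nonneg_left ?_ hγ)
        refine (abs_add_le _ _).trans (add_le_add ?_ hr)
        rw [abs_mul, abs_of_nonneg hw0]
        exact (mul_le_of_le_one_right (abs_nonneg _) hw1).trans herr

/-- If the weights mix uniformly over windows of length `L`, then the centred surplus iteration
converges to zero for small gains, uniformly in the weights. -/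
theorem exists_gain_tendsto_zero (S : Finset ι) {o : ι} (ho : o ∈ S) {L : ℕ} (hL : 0 < L) {η : ℝ}
    (hη : 0 < η) : ∃ γ₀ > 0, ∀ γ, 0 < γ → γ < γ₀ → ∀ (R C : ℕ → Matrix ι ι ℝ) (x s : ℕ → ι → ℝ),
      SurplusIteration S R C γ x s → (∀ k, ∀ a ∈ S, ∀ b, η ≤ evol R k L b a) →
      (∀ k, ∀ a ∈ S, ∀ b, η ≤ evol C k L a b) → ∀ a,
        Tendsto (fun k => x k a) atTop (𝓝 0) ∧ Tendsto (fun k => s k a) atTop (𝓝 0) := by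
  have hL' : (0 : ℝ) < L := by exact_mod_cast hL
  have hn0 : (0 : ℝ) < S.card := by exact_mod_cast Finset.card_pos.2 ⟨o, ho⟩
  obtain ⟨γ₁, hγ₁, wa, hwa, wb, hwb, hgain⟩ := exists_small_gain (C := 2 * L * (S.card + 1))
    (ρ := 1 - η / L) (c := (S.card : ℝ) ^ 2 * η ^ 2) (by positivity)
    (by have : 0 < η / L := by positivity
        linarith) (by positivity)
  refine ⟨min γ₁ (1 / S.card), lt_min hγ₁ (by positivity), ?_⟩
  intro γ hγ hγlt R C x s hit hRη hCη
  obtain ⟨lam, hlam0, hlam1, hstep⟩ := hgain γ hγ (hγlt.trans_le (min_le_left _ _))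
  have hγS : γ * S.card ≤ 1 := by
    rw [← le_div_iff₀ hn0]; exact hγlt.le.trans (min_le_right _ _)
  set n : ℝ := (S.card : ℝ) with hn
  have hLC : (1 : ℝ) ≤ L := by exact_mod_cast hL
  -- the distribution of a unit of surplus, bounded below on the agents from time `L` on
  let π : ℕ → ι → ℝ := fun k => evol C 0 k *ᵥ Pi.single o 1
  let σ : ℕ → ℝ := fun k => ∑ a, s k a
  let r : ℕ → ι → ℝ := fun k => s k - σ k • π k
  let g : ℕ → ι → ℝ := fun k => restrict S (x k - R k *ᵥ x k) - γ • restrict S (s k)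
  have hevR := fun k i => evol_mem hit.pull_mem k i
  have hevC := fun k i => evol_mem hit.push_mem k i
  have hπap : ∀ k a, π k a = evol C 0 k a o := fun k a => by simp [π]
  have hπ0 : ∀ k a, 0 ≤ π k a := fun k a => by
    rw [hπap]; exact (mem_colStochastic_iff_sum.1 (hevC 0 k)).1 a o
  have hπ1 : ∀ k, ∑ a, π k a = 1 := fun k => by
    simp only [hπap]; exact (mem_colStochastic_iff_sum.1 (hevC 0 k)).2 o
  have hπl1 : ∀ k, l1 (π k) = 1 := fun k => by
    rw [← hπ1 k]; exact Finset.sum_congr rfl fun a _ => abs_of_nonneg (hπ0 k a)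
  have hπstep : ∀ k, C k *ᵥ π k = π (k + 1) := fun k => by
    simp only [π, evol_succ, Matrix.mulVec_mulVec, zero_add]
  have hπη : ∀ k, L ≤ k → ∀ a ∈ S, η ≤ π k a := by
    intro k hk a ha
    obtain ⟨j, rfl⟩ := Nat.exists_eq_add_of_le' hk
    rw [hπap, evol_add]
    exact le_mul_apply_of_colStochastic (hevC 0 j) (hCη _ a ha) o
  have hr0 : ∀ k, ∑ a, r k a = 0 := fun k => by
    simp only [r, Pi.sub_apply, Pi.smul_apply, smul_eq_mul, Finset.sum_sub_distrib,
      ← Finset.mul_sum, hπ1]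
    simp [σ]
  have hs : ∀ k, s k = σ k • π k + r k := fun k => by simp [r]
  have hσ : ∀ k, σ k = -∑ a ∈ S, x k a := hit.mass_eq
  have hrstep : ∀ k, r (k + 1) = C k *ᵥ r k + (g k - (∑ a, g k a) • π (k + 1)) := by
    intro k
    have h1 : σ (k + 1) = σ k + ∑ a, g k a := by
      simp only [σ, hit.surplus_step k, Pi.add_apply, Finset.sum_add_distrib,
        sum_mulVec (hit.push_mem k)]
      rfl
    have h2 : s (k + 1) = C k *ᵥ s k + g k := hit.surplus_step k
    simp only [r]
    rw [h1, h2, Matrix.mulVec_sub, Matrix.mulVec_smul, hπstep, add_smul]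
    abel
  -- the three modes; `M K k` is `x k`, averaged with the weights of its influence on `o` at time
  -- `K + L`, which are bounded below on the agents as long as `k ≤ K`
  let d : ℕ → ℝ := fun k => adapted R osc L k (x k)
  let e : ℕ → ℝ := fun k => adapted C l1 L k (r k)
  let M : ℕ → ℕ → ℝ := fun K k => |(evol R k (K + L - k) *ᵥ x k) o|
  have hosc_le : ∀ k y, osc (R k *ᵥ y) ≤ osc y := fun k y => osc_mulVec_le (hit.pull_mem k) y
  have hl1_le : ∀ k y, l1 (C k *ᵥ y) ≤ l1 y := fun k y => l1_mulVec_le_self (hit.push_mem k) y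
  have hd0 : ∀ k, 0 ≤ d k := fun k => adapted_nonneg osc_nonneg _ _
  have he0 : ∀ k, 0 ≤ e k := fun k => adapted_nonneg l1_nonneg _ _
  have hd : ∀ k, osc (x k) ≤ d k := fun k => le_adapted osc_nonneg hL _ _
  have he : ∀ k, l1 (r k) ≤ e k := fun k => le_adapted l1_nonneg hL _ _
  have hxM : ∀ K k a, |x k a| ≤ M K k + d k := by
    intro K k a
    have h1 := abs_sub_mulVec_le (hevR k (K + L - k)) (x k) o a
    have h2 : x k a = (evol R k (K + L - k) *ᵥ x k) o
      + (x k a - (evol R k (K + L - k) *ᵥ x k) o) := by ring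
    rw [h2]
    exact (abs_add_le _ _).trans (add_le_add le_rfl (h1.trans (hd k)))
  have hsM : ∀ K k, l1 (s k) ≤ n * M K k + n * d k + e k := by
    intro K k
    have h1 : |σ k| ≤ n * (M K k + d k) := by
      rw [hσ, abs_neg, hn, ← nsmul_eq_mul]
      exact (Finset.abs_sum_le_sum_abs _ _).trans
        (Finset.sum_le_card_nsmul _ _ _ fun a _ => hxM K k a)
    calc l1 (s k) = l1 (σ k • π k + r k) := by rw [← hs k]
      _ ≤ |σ k| * 1 + l1 (r k) := by rw [← hπl1 k, ← l1_smul]; exact l1_add _ _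
      _ ≤ n * M K k + n * d k + e k := by linarith [he k]
  have hdstep : ∀ K k, d (k + 1) ≤
      (1 - η / L) * d k + 2 * L * (n + 1) * γ * (M K k + d k + e k) := by
    intro K k
    have h1 : osc (evol R k L *ᵥ x k) ≤ (1 - η) * osc (x k) :=
      osc_mulVec_le_of_le (hevR k L) (hRη k o ho) (x k)
    have h2 := adapted_step hosc_le hL hη.le h1
    have h3 : osc (γ • restrict S (s k)) ≤ 2 * (γ * l1 (s k)) := by
      refine osc_le_two_mul (fun a => ?_) (mul_nonneg hγ.le (l1_nonneg _))
      rw [Pi.smul_apply, smul_eq_mul, abs_mul, abs_of_pos hγ]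
      exact mul_le_mul_of_nonneg_left ((abs_restrict_le S _ a).trans (abs_le_l1 _ a)) hγ.le
    have h4 : adapted R osc L (k + 1) (γ • restrict S (s k)) ≤ L * (2 * (γ * l1 (s k))) :=
      (adapted_le hosc_le _ _).trans (mul_le_mul_of_nonneg_left h3 hL'.le)
    have h5 : d (k + 1) ≤ adapted R osc L (k + 1) (R k *ᵥ x k)
        + adapted R osc L (k + 1) (γ • restrict S (s k)) := by
      simp only [d]
      rw [hit.state_step k]
      exact adapted_add osc_add _ _ _
    have h6 : L * (2 * (γ * l1 (s k))) ≤ 2 * L * (n + 1) * γ * (M K k + d k + e k) := by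
      have h7 := hsM K k
      have : (0 : ℝ) ≤ M K k := abs_nonneg _
      have h8 : n * M K k + n * d k + e k ≤ (n + 1) * (M K k + d k + e k) := by
        nlinarith [hd0 k, he0 k]
      calc L * (2 * (γ * l1 (s k))) = 2 * L * γ * l1 (s k) := by ring
        _ ≤ 2 * L * γ * ((n + 1) * (M K k + d k + e k)) :=
          mul_le_mul_of_nonneg_left (h7.trans h8) (by positivity)
        _ = _ := by ring
    linarith
  have hestep : ∀ K k, e (k + 1) ≤ (1 - η / L) * e k + 2 * L * (n + 1) * d k
      + 2 * L * (n + 1) * γ * (M K k + d k + e k) := by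
    intro K k
    have h1 : l1 (evol C k L *ᵥ r k) ≤ (1 - η) * l1 (r k) :=
      l1_mulVec_le_of_le (hevC k L) (hCη k o ho) (hr0 k)
    have h2 := adapted_step hl1_le hL hη.le h1
    have h3 : l1 (g k) ≤ n * d k + γ * l1 (s k) := by
      have h31 : l1 (restrict S (x k - R k *ᵥ x k)) ≤ n * d k :=
        l1_restrict_le_card S fun a =>
          (abs_sub_mulVec_le (hit.pull_mem k) (x k) a a).trans (hd k)
      have h32 : l1 ((-γ) • restrict S (s k)) ≤ γ * l1 (s k) := by
        rw [l1_smul, abs_neg, abs_of_pos hγ]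
        exact mul_le_mul_of_nonneg_left (l1_restrict_le S _) hγ.le
      have h33 : g k = restrict S (x k - R k *ᵥ x k) + (-γ) • restrict S (s k) := by
        simp [g, sub_eq_add_neg]
      rw [h33]
      exact (l1_add _ _).trans (add_le_add h31 h32)
    have h4 : l1 (g k - (∑ a, g k a) • π (k + 1)) ≤ 2 * l1 (g k) := by
      have h41 : g k - (∑ a, g k a) • π (k + 1) = g k + (-∑ a, g k a) • π (k + 1) := by
        simp [sub_eq_add_neg]
      rw [h41]
      refine (l1_add _ _).trans ?_
      rw [l1_smul, abs_neg, hπl1]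
      linarith [abs_sum_le_l1 (g k)]
    have h5 : e (k + 1) ≤ adapted C l1 L (k + 1) (C k *ᵥ r k)
        + adapted C l1 L (k + 1) (g k - (∑ a, g k a) • π (k + 1)) := by
      simp only [e]
      rw [hrstep k]
      exact adapted_add l1_add _ _ _
    have h6 : adapted C l1 L (k + 1) (g k - (∑ a, g k a) • π (k + 1)) ≤
        L * (2 * (n * d k + γ * l1 (s k))) :=
      (adapted_le hl1_le _ _).trans (mul_le_mul_of_nonneg_left (by linarith) hL'.le)
    have h7 : L * (2 * (n * d k + γ * l1 (s k))) ≤ 2 * L * (n + 1) * d k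
        + 2 * L * (n + 1) * γ * (M K k + d k + e k) := by
      have h71 := hsM K k
      have : (0 : ℝ) ≤ M K k := abs_nonneg _
      have h8 : n * M K k + n * d k + e k ≤ (n + 1) * (M K k + d k + e k) := by
        nlinarith [hd0 k, he0 k]
      have h9 : 2 * L * n * d k ≤ 2 * L * (n + 1) * d k :=
        mul_le_mul_of_nonneg_right (by nlinarith) (hd0 k)
      calc L * (2 * (n * d k + γ * l1 (s k))) = 2 * L * n * d k + 2 * L * γ * l1 (s k) := by ring
        _ ≤ 2 * L * (n + 1) * d k + 2 * L * γ * ((n + 1) * (M K k + d k + e k)) :=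
          add_le_add h9 (mul_le_mul_of_nonneg_left (h71.trans h8) (by positivity))
        _ = _ := by ring
    linarith
  have hMstep : ∀ K k, L ≤ k → k < K → M K (k + 1) ≤
      (1 - n ^ 2 * η ^ 2 * γ) * M K k + 2 * L * (n + 1) * γ * (d k + e k) := by
    intro K k hLk hkK
    have h1 : K + L - k = (K + L - (k + 1)) + 1 := by omega
    have h2 : evol R k (K + L - k) = evol R (k + 1) (K + L - (k + 1)) * R k := by
      rw [h1, evol_succ']
    have h3 : ∀ a ∈ S, η ≤ evol R (k + 1) (K + L - (k + 1)) o a := by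
      intro a ha
      have : K + L - (k + 1) = L + (K - (k + 1)) := by omega
      rw [this, evol_add]
      exact le_mul_apply_of_rowStochastic (hevR _ _) (hRη _ a ha) o
    have h4 := abs_slow_mode_le (hevR (k + 1) (K + L - (k + 1))) (hit.pull_mem k) hη.le hγ.le
      hγS h3 (hπ0 k) (hπ1 k) (hπη k hLk) (r := r k) (y := x k) (hσ k)
    simp only [M]
    rw [h2, hit.state_step k]
    nth_rewrite 1 [hs k]
    refine h4.trans (add_le_add le_rfl ?_)
    have h5 : n * osc (x k) + l1 (r k) ≤ 2 * L * (n + 1) * (d k + e k) := by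
      have h51 : (1 : ℝ) * n * d k ≤ 2 * L * (n + 1) * d k :=
        mul_le_mul_of_nonneg_right (by nlinarith) (hd0 k)
      have h52 : 1 * e k ≤ 2 * L * (n + 1) * e k :=
        mul_le_mul_of_nonneg_right (by nlinarith) (he0 k)
      have h53 := mul_le_mul_of_nonneg_left (hd k) hn0.le
      linarith [he k]
    have := mul_le_mul_of_nonneg_left h5 hγ.le
    linarith
  -- geometric decay of the weighted sum of the modes
  let B : ℝ := l1 (x L) + wa * d L + wb * e L
  have hVK : ∀ K, L ≤ K → M K K + wa * d K + wb * e K ≤ lam ^ (K - L) * B := by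
    intro K hK
    have h1 : ∀ i ≤ K - L, M K (L + i) + wa * d (L + i) + wb * e (L + i) ≤ lam ^ i * B := by
      intro i
      induction i with
      | zero =>
        intro _
        have : M K L ≤ l1 (x L) := abs_mulVec_le_l1 (hevR _ _) _ _
        simp only [add_zero, pow_zero, one_mul, B]
        linarith
      | succ i ih =>
        intro hi
        have h2 := hstep (M K (L + i)) (d (L + i)) (e (L + i)) _ _ _ (abs_nonneg _) (hd0 _) (he0 _)
          (hMstep K (L + i) (by omega) (by omega)) (hdstep K (L + i)) (hestep K (L + i))
        rw [pow_succ, mul_comm _ lam, mul_assoc]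
        exact h2.trans (mul_le_mul_of_nonneg_left (ih (by omega)) hlam0)
    have h2 := h1 (K - L) le_rfl
    rwa [Nat.add_sub_cancel' hK] at h2
  have hlim : Tendsto (fun K => (n + 1) * ((1 + 1 / wa + 1 / wb) * (lam ^ (K - L) * B))) atTop
      (𝓝 0) := by
    have h1 : Tendsto (fun K => lam ^ (K - L)) atTop (𝓝 0) :=
      (tendsto_pow_atTop_nhds_zero_of_lt_one hlam0 hlam1).comp (tendsto_sub_atTop_nat L)
    have h2 := ((h1.mul_const B).const_mul (1 + 1 / wa + 1 / wb)).const_mul (n + 1)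
    rwa [zero_mul, mul_zero, mul_zero] at h2
  have hmodes : ∀ K, L ≤ K → M K K + d K + e K ≤ (1 + 1 / wa + 1 / wb) * (lam ^ (K - L) * B) := by
    intro K hK
    have h1 := hVK K hK
    have hM0 : 0 ≤ M K K := abs_nonneg _
    have h3 : 0 ≤ wa * d K := mul_nonneg hwa.le (hd0 K)
    have h4 : 0 ≤ wb * e K := mul_nonneg hwb.le (he0 K)
    have h5 : d K ≤ 1 / wa * (lam ^ (K - L) * B) := by
      rw [one_div, ← div_eq_inv_mul, le_div_iff₀ hwa]; linarith
    have h6 : e K ≤ 1 / wb * (lam ^ (K - L) * B) := by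
      rw [one_div, ← div_eq_inv_mul, le_div_iff₀ hwb]; linarith
    have h7 : M K K ≤ lam ^ (K - L) * B := by linarith
    linarith
  intro a
  have hfin : ∀ K, L ≤ K → |x K a| ≤ (n + 1) * ((1 + 1 / wa + 1 / wb) * (lam ^ (K - L) * B)) ∧
      |s K a| ≤ (n + 1) * ((1 + 1 / wa + 1 / wb) * (lam ^ (K - L) * B)) := by
    intro K hK
    have hM0 : 0 ≤ M K K := abs_nonneg _
    have h1 := mul_le_mul_of_nonneg_left (hmodes K hK) (add_nonneg hn0.le zero_le_one)
    refine ⟨(hxM K K a).trans (le_trans ?_ h1), ((abs_le_l1 _ a).trans (hsM K K)).trans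
      (le_trans ?_ h1)⟩ <;>
    nlinarith [hd0 K, he0 K, mul_nonneg hn0.le hM0, mul_nonneg hn0.le (hd0 K),
      mul_nonneg hn0.le (he0 K)]
  constructor
  · exact squeeze_zero_norm' (eventually_atTop.2 ⟨L, fun K hK => (hfin K hK).1⟩) hlim
  · exact squeeze_zero_norm' (eventually_atTop.2 ⟨L, fun K hK => (hfin K hK).2⟩) hlim

end Consensus

/-! ### Bounded delays: the augmented weights mix uniformly -/

section Bounded

variable {V : Type u}

/-- Links, read from the receiver to the sender: the direction of the entries of the weights. -/
def Pulls (G : Digraph V) (j i : V) : Prop := IsLink G i j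

lemma StronglyConnected.reflTransGen_pulls {G : Digraph V} (h : StronglyConnected G) (j i : V) :
    Relation.ReflTransGen (Pulls G) j i := by
  induction h i j with
  | refl => exact .refl
  | @tail b c _ hbc ih =>
    by_cases hb : b = c
    · exact hb ▸ ih
    · exact .head ⟨hb, hbc⟩ ih

lemma finite_levels (t : ℕ) : Finite {δ : ℕ // (δ : ℕ∞) ≤ (t : ℕ∞)} :=
  Finite.of_injective (fun δ => (⟨δ.1, Nat.lt_succ_of_le (by exact_mod_cast δ.2)⟩ : Fin (t + 1)))
    fun a b h => Subtype.ext (by simpa using h)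

noncomputable instance instFintypeLevels (t : ℕ) : Fintype {δ : ℕ // (δ : ℕ∞) ≤ (t : ℕ∞)} :=
  @Fintype.ofFinite _ (finite_levels t)

/-- The node of level `δ` of agent `j`. -/
def level {t : ℕ} (δ : ℕ) (h : δ ≤ t) (j : V) : Node V (t : ℕ∞) := (⟨δ, by exact_mod_cast h⟩, j)

lemma Node.eq_level {t : ℕ} (a : Node V (t : ℕ∞)) :
    ∃ (δ : ℕ) (h : δ ≤ t) (j : V), a = level δ h j :=
  ⟨a.1.1, by exact_mod_cast a.1.2, a.2, rfl⟩

lemma arrives_self {τ : V → V → ℕ → ℕ} (hself : ∀ j k, τ j j k = 0) (j : V) (k δ : ℕ) :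
    Arrives τ j j k δ ↔ δ = 0 := by
  simp only [Arrives, hself]
  omega

lemma pull_eq (G : Digraph V) (τ : V → V → ℕ → ℕ) (k δ : ℕ) (j i : V)
    [Decidable ((i = j ∨ IsLink G i j) ∧ Arrives τ j i k δ)] :
    pull G τ k δ j i = if (i = j ∨ IsLink G i j) ∧ Arrives τ j i k δ then
      1 / (1 + (virtualInDegree G τ j k : ℝ)) else 0 := by
  simp only [pull, Matrix.of_apply]
  congr

lemma push_eq (G : Digraph V) (τ : V → V → ℕ → ℕ) (k δ : ℕ) (j i : V)
    [Decidable ((i = j ∨ IsLink G i j) ∧ τ j i k = δ)] :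
    push G τ k δ j i = if (i = j ∨ IsLink G i j) ∧ τ j i k = δ then
      1 / (1 + (outDegree G i : ℝ)) else 0 := by
  simp only [push, Matrix.of_apply]
  congr

lemma pull_nonneg (G : Digraph V) (τ : V → V → ℕ → ℕ) (k δ : ℕ) (j i : V) : 0 ≤ pull G τ k δ j i := by
  simp only [pull, Matrix.of_apply]; split_ifs <;> positivity

lemma push_nonneg (G : Digraph V) (τ : V → V → ℕ → ℕ) (k δ : ℕ) (j i : V) : 0 ≤ push G τ k δ j i := by
  simp only [push, Matrix.of_apply]; split_ifs <;> positivity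

/-- The delays are at most `t` on every link, and vanish on the self-loops. -/
structure DelayBound (G : Digraph V) (τ : V → V → ℕ → ℕ) (t : ℕ) : Prop where
  self : ∀ j k, τ j j k = 0
  le : ∀ j i, IsLink G i j → ∀ k, τ j i k ≤ t

variable {G : Digraph V} {τ : V → V → ℕ → ℕ} {t : ℕ}

lemma DelayBound.le' (h : DelayBound G τ t) {j i : V} (hij : i = j ∨ IsLink G i j) (k : ℕ) :
    τ j i k ≤ t := by
  rcases hij with rfl | hij
  · simp [h.self]
  · exact h.le j i hij k

variable [Fintype V]

lemma finite_arrivals (G : Digraph V) (τ : V → V → ℕ → ℕ) (j : V) (k : ℕ) :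
    {p : V × ℕ | IsLink G p.1 j ∧ Arrives τ j p.1 k p.2}.Finite :=
  (Set.finite_univ.prod (Set.finite_Iic k)).subset fun _ hp => ⟨trivial, hp.2.1⟩

lemma ncard_active (hself : ∀ j k, τ j j k = 0) (j : V) (k : ℕ) :
    {p : V × ℕ | (p.1 = j ∨ IsLink G p.1 j) ∧ Arrives τ j p.1 k p.2}.ncard
      = 1 + virtualInDegree G τ j k := by
  have h : {p : V × ℕ | (p.1 = j ∨ IsLink G p.1 j) ∧ Arrives τ j p.1 k p.2}
      = insert (j, 0) {p : V × ℕ | IsLink G p.1 j ∧ Arrives τ j p.1 k p.2} := by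
    ext ⟨i, δ⟩
    simp only [Set.mem_ofPred_eq, Set.mem_insert_iff, Prod.mk.injEq]
    constructor
    · rintro ⟨rfl | h, h'⟩
      · exact Or.inl ⟨rfl, (arrives_self hself i k δ).1 h'⟩
      · exact Or.inr ⟨h, h'⟩
    · rintro (⟨rfl, rfl⟩ | ⟨h, h'⟩)
      · exact ⟨Or.inl rfl, (arrives_self hself i k 0).2 rfl⟩
      · exact ⟨Or.inr h, h'⟩
  rw [h, Set.ncard_insert_of_notMem _ (finite_arrivals G τ j k), add_comm]
  · rfl
  · exact fun h => h.1.1 rfl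

lemma virtualInDegree_le (h : DelayBound G τ t) (j : V) (k : ℕ) :
    virtualInDegree G τ j k ≤ Fintype.card V * (t + 1) := by
  have h1 : {p : V × ℕ | IsLink G p.1 j ∧ Arrives τ j p.1 k p.2} ⊆
      ((Finset.univ ×ˢ Finset.range (t + 1) : Finset (V × ℕ)) : Set (V × ℕ)) := by
    rintro ⟨i, δ⟩ ⟨hl, ha⟩
    have := h.le j i hl (k - δ)
    have h2 : τ j i (k - δ) = δ := ha.2
    simp only [Finset.coe_product, Set.mem_prod, Finset.coe_univ, Set.mem_univ, Finset.coe_range,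
      Set.mem_Iio, true_and]
    omega
  have h2 := Set.ncard_le_ncard h1 (Finset.finite_toSet _)
  rwa [Set.ncard_coe_finset, Finset.card_product, Finset.card_univ, Finset.card_range] at h2

/-- A lower bound for all active weights. -/
noncomputable def minWeight (V : Type u) [Fintype V] (t : ℕ) : ℝ :=
  1 / (1 + (Fintype.card V * (t + 1) : ℕ))

lemma minWeight_pos : 0 < minWeight V t := by unfold minWeight; positivity

lemma minWeight_le_one : minWeight V t ≤ 1 := by
  unfold minWeight
  rw [div_le_one (by positivity)]
  exact le_add_of_nonneg_right (Nat.cast_nonneg _)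

lemma minWeight_le_pull (h : DelayBound G τ t) {k δ : ℕ} {j i : V} (hij : i = j ∨ IsLink G i j)
    (ha : Arrives τ j i k δ) : minWeight V t ≤ pull G τ k δ j i := by
  simp only [pull, Matrix.of_apply, if_pos (And.intro hij ha), minWeight]
  have : (virtualInDegree G τ j k : ℝ) ≤ (Fintype.card V * (t + 1) : ℕ) := by
    exact_mod_cast virtualInDegree_le h j k
  gcongr

lemma minWeight_le_push {k δ : ℕ} {j i : V} (hij : i = j ∨ IsLink G i j) (ha : τ j i k = δ) :
    minWeight V t ≤ push G τ k δ j i := by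
  simp only [push, Matrix.of_apply, if_pos (And.intro hij ha), minWeight]
  have h1 : outDegree G i ≤ Fintype.card V * (t + 1) := by
    have : outDegree G i ≤ Fintype.card V := by
      rw [← Nat.card_eq_fintype_card]; exact Set.ncard_le_card _
    nlinarith
  have : (outDegree G i : ℝ) ≤ (Fintype.card V * (t + 1) : ℕ) := by exact_mod_cast h1
  gcongr

lemma le_Rtilde_self (h : DelayBound G τ t) (k : ℕ) (j : V) :
    minWeight V t ≤ Rtilde G τ (t : ℕ∞) k (level 0 t.zero_le j) (level 0 t.zero_le j) := by
  simpa [Rtilde, level] using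
    minWeight_le_pull h (k := k) (Or.inl rfl) ((arrives_self h.self j k 0).2 rfl)

lemma le_Ctilde_self (h : DelayBound G τ t) (k : ℕ) (j : V) :
    minWeight V t ≤ Ctilde G τ (t : ℕ∞) k (level 0 t.zero_le j) (level 0 t.zero_le j) := by
  simpa [Ctilde, level] using
    minWeight_le_push (t := t) (k := k) (Or.inl rfl) (h.self j k)

variable [DecidableEq V]

lemma sum_pull (h : DelayBound G τ t) (k : ℕ) (j : V) :
    ∑ b : Node V (t : ℕ∞), pull G τ k b.1.1 j b.2 = 1 := by
  classical
  simp only [pull_eq]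
  rw [← Finset.sum_filter, Finset.sum_const, nsmul_eq_mul]
  have h1 : (Finset.univ.filter fun b : Node V (t : ℕ∞) =>
      (b.2 = j ∨ IsLink G b.2 j) ∧ Arrives τ j b.2 k b.1.1).card = 1 + virtualInDegree G τ j k := by
    rw [← ncard_active h.self, ← Set.ncard_coe_finset]
    refine Set.ncard_congr (fun b _ => (b.2, b.1.1)) ?_ ?_ ?_
    · intro b hb; simpa using hb
    · rintro ⟨⟨a, ha⟩, v⟩ ⟨⟨b, hb⟩, w⟩ _ _ hab
      simp only [Prod.mk.injEq] at hab
      obtain ⟨rfl, rfl⟩ := hab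
      rfl
    · rintro ⟨i, δ⟩ ⟨hl, ha⟩
      have h2 := h.le' hl (k - δ)
      rw [show τ j i (k - δ) = δ from ha.2] at h2
      exact ⟨level δ h2 i, by simpa [level] using ⟨hl, ha⟩, rfl⟩
  rw [h1]
  push_cast
  field_simp

lemma Rtilde_mem (h : DelayBound G τ t) (k : ℕ) :
    Rtilde G τ (t : ℕ∞) k ∈ rowStochastic ℝ (Node V (t : ℕ∞)) := by
  classical
  rw [mem_rowStochastic_iff_sum]
  refine ⟨fun a b => ?_, fun a => ?_⟩
  · simp only [Rtilde, Matrix.of_apply]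
    split_ifs
    · exact pull_nonneg ..
    · exact zero_le_one
    · exact le_rfl
  · obtain ⟨δ, hδ, j, rfl⟩ := a.eq_level
    rcases δ with _ | δ
    · simpa [Rtilde, level] using sum_pull h k j
    · rw [Finset.sum_eq_single (level δ (by omega) j)]
      · simp [Rtilde, level]
      · intro b _ hb
        obtain ⟨δ', hδ', j', rfl⟩ := b.eq_level
        simp only [Rtilde, Matrix.of_apply, level]
        rw [if_neg (by simp), if_neg]
        rintro ⟨h1, h2⟩
        apply hb
        obtain rfl : δ' = δ := by omega
        rw [h2]
      · simp

lemma sum_push (h : DelayBound G τ t) (k : ℕ) (i : V) :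
    ∑ a : Node V (t : ℕ∞), push G τ k a.1.1 a.2 i = 1 := by
  classical
  simp only [push_eq]
  rw [← Finset.sum_filter, Finset.sum_const, nsmul_eq_mul]
  have h0 : {j : V | i = j ∨ IsLink G i j}.ncard = 1 + outDegree G i := by
    have : {j : V | i = j ∨ IsLink G i j} = insert i {l : V | IsLink G i l} := by
      ext j; simp [eq_comm]
    rw [this, Set.ncard_insert_of_notMem (fun h => h.1 rfl) (Set.toFinite _), add_comm]
    rfl
  have h1 : (Finset.univ.filter fun a : Node V (t : ℕ∞) =>
      (i = a.2 ∨ IsLink G i a.2) ∧ τ a.2 i k = a.1.1).card = 1 + outDegree G i := by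
    rw [← h0, ← Set.ncard_coe_finset]
    refine Set.ncard_congr (fun b _ => b.2) ?_ ?_ ?_
    · intro b hb; exact (by simpa using hb : (i = b.2 ∨ IsLink G i b.2) ∧ _).1
    · rintro ⟨⟨a, ha⟩, v⟩ ⟨⟨b, hb⟩, w⟩ h1 h2 hab
      simp only [Finset.coe_filter, Finset.mem_univ, true_and, Set.mem_ofPred_eq] at h1 h2 hab
      subst hab
      obtain rfl : a = b := h1.2.symm.trans h2.2
      rfl
    · intro j hj
      exact ⟨level (τ j i k) (h.le' hj k) j, by simpa [level] using hj, rfl⟩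
  rw [h1]
  push_cast
  field_simp

lemma Ctilde_mem (h : DelayBound G τ t) (k : ℕ) :
    Ctilde G τ (t : ℕ∞) k ∈ colStochastic ℝ (Node V (t : ℕ∞)) := by
  classical
  rw [mem_colStochastic_iff_sum]
  refine ⟨fun a b => ?_, fun b => ?_⟩
  · simp only [Ctilde, Matrix.of_apply]
    split_ifs
    · exact push_nonneg ..
    · exact zero_le_one
    · exact le_rfl
  · obtain ⟨δ, hδ, j, rfl⟩ := b.eq_level
    rcases δ with _ | δ
    · simpa [Ctilde, level] using sum_push h k j
    · rw [Finset.sum_eq_single (level δ (by omega) j)]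
      · simp [Ctilde, level]
      · intro b _ hb
        obtain ⟨δ', hδ', j', rfl⟩ := b.eq_level
        simp only [Ctilde, Matrix.of_apply, level]
        rw [if_neg (by simp), if_neg]
        rintro ⟨h1, h2⟩
        apply hb
        obtain rfl : δ' = δ := by omega
        rw [h2]
      · simp

lemma Rtilde_nonneg (h : DelayBound G τ t) (k : ℕ) (a b : Node V (t : ℕ∞)) :
    0 ≤ Rtilde G τ (t : ℕ∞) k a b := nonneg_of_mem_rowStochastic (Rtilde_mem h k)

lemma Ctilde_nonneg (h : DelayBound G τ t) (k : ℕ) (a b : Node V (t : ℕ∞)) :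
    0 ≤ Ctilde G τ (t : ℕ∞) k a b := (mem_colStochastic_iff_sum.1 (Ctilde_mem h k)).1 a b

/-- A state moves up the buffer levels, one level at each step. -/
lemma reach_level_up (h : DelayBound G τ t) (k δ : ℕ) (hδ : δ ≤ t) (j : V) :
    Reach (Rtilde G τ (t : ℕ∞)) (minWeight V t) k δ (level δ hδ j) (level 0 t.zero_le j) := by
  induction δ with
  | zero => exact Reach.refl ..
  | succ δ ih =>
    refine (ih (by omega)).trans (Rtilde_nonneg h) minWeight_pos.le (Reach.one ?_)
    simpa [Rtilde, level] using minWeight_le_one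

/-- A surplus moves down the buffer levels, one level at each step. -/
lemma reach_level_down (h : DelayBound G τ t) (k δ : ℕ) (hδ : δ ≤ t) (j : V) :
    Reach (Ctilde G τ (t : ℕ∞)) (minWeight V t) k δ (level 0 t.zero_le j) (level δ hδ j) := by
  induction δ generalizing k with
  | zero => exact Reach.refl ..
  | succ δ ih =>
    have h1 : Reach (Ctilde G τ (t : ℕ∞)) (minWeight V t) k 1 (level δ (by omega) j)
        (level (δ + 1) hδ j) := Reach.one (by simpa [Ctilde, level] using minWeight_le_one)
    have h2 := h1.trans (Ctilde_nonneg h) minWeight_pos.le (ih (k + 1) (by omega))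
    rwa [add_comm 1 δ] at h2

lemma reach_pull_link (h : DelayBound G τ t) (k : ℕ) {j i : V} (hij : IsLink G i j) :
    Reach (Rtilde G τ (t : ℕ∞)) (minWeight V t) k (t + 1) (level 0 t.zero_le j)
      (level 0 t.zero_le i) := by
  have hle := h.le j i hij k
  have h0 := Rtilde_nonneg h
  have h1 := reach_level_up h k (τ j i k) hle i
  have h2 : Reach (Rtilde G τ (t : ℕ∞)) (minWeight V t) (k + τ j i k) 1 (level 0 t.zero_le j)
      (level (τ j i k) hle i) := by
    refine Reach.one ?_
    simpa [Rtilde, level] using minWeight_le_pull h (k := k + τ j i k) (δ := τ j i k)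
      (Or.inr hij) ⟨by omega, by simp⟩
  have h3 := Reach.stay h0 minWeight_pos.le (fun k => le_Rtilde_self h k j)
    (k + (τ j i k + 1)) (t - τ j i k)
  have h4 := (h1.trans h0 minWeight_pos.le h2).trans h0 minWeight_pos.le h3
  rwa [show τ j i k + 1 + (t - τ j i k) = t + 1 by omega] at h4

lemma reach_push_link (h : DelayBound G τ t) (k : ℕ) {j i : V} (hij : IsLink G i j) :
    Reach (Ctilde G τ (t : ℕ∞)) (minWeight V t) k (t + 1) (level 0 t.zero_le j)
      (level 0 t.zero_le i) := by
  have hle := h.le j i hij k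
  have h0 := Ctilde_nonneg h
  have h2 : Reach (Ctilde G τ (t : ℕ∞)) (minWeight V t) k 1 (level (τ j i k) hle j)
      (level 0 t.zero_le i) := by
    refine Reach.one ?_
    simpa [Ctilde, level] using minWeight_le_push (t := t) (k := k) (Or.inr hij) rfl
  have h1 := reach_level_down h (k + 1) (τ j i k) hle j
  have h3 := Reach.stay h0 minWeight_pos.le (fun k => le_Ctilde_self h k j)
    (k + (1 + τ j i k)) (t - τ j i k)
  have h4 := (h2.trans h0 minWeight_pos.le h1).trans h0 minWeight_pos.le h3
  rwa [show 1 + τ j i k + (t - τ j i k) = t + 1 by omega] at h4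

/-- The agents among the nodes of the augmented digraph. -/
noncomputable def agents (V : Type u) [Fintype V] [DecidableEq V] (t : ℕ) :
    Finset (Node V (t : ℕ∞)) :=
  Finset.univ.filter fun a => a.1.1 = 0

lemma mem_agents {a : Node V (t : ℕ∞)} : a ∈ agents V t ↔ a.1.1 = 0 := by simp [agents]

lemma exists_mixing_window (G : Digraph V) (hG : StronglyConnected G) (t : ℕ) :
    ∃ L, 0 < L ∧ ∀ τ, DelayBound G τ t → ∀ k, ∀ a ∈ agents V t, ∀ b,
      minWeight V t ^ L ≤ evol (Rtilde G τ (t : ℕ∞)) k L b a ∧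
      minWeight V t ^ L ≤ evol (Ctilde G τ (t : ℕ∞)) k L a b := by
  -- a hop takes `t + 1` steps whatever the delay, and another `t + 1` steps cover the levels of the
  -- buffers, where waiting at the agent makes up for the missing levels
  obtain ⟨m, hm⟩ := Reach.exists_uniform (ι := Node V (t : ℕ∞)) (Pulls G)
  refine ⟨m * (t + 1) + (t + 1), by omega, fun τ h k a ha b => ?_⟩
  obtain ⟨δ, hδ, j, rfl⟩ := b.eq_level
  obtain ⟨δ', hδ', i, rfl⟩ := a.eq_level
  obtain rfl : δ' = 0 := mem_agents.1 ha
  have hp := (minWeight_pos (V := V) (t := t)).le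
  constructor
  · have h0 := Rtilde_nonneg h
    have h1 := hm (fun j => level 0 t.zero_le j) h0 hp (fun j k => le_Rtilde_self h k j)
      (fun k j i hij => reach_pull_link h k hij) j i (hG.reflTransGen_pulls j i) k
    have h2 := Reach.stay h0 hp (fun k => le_Rtilde_self h k j) (k + m * (t + 1)) (t + 1 - δ)
    have h3 := reach_level_up h (k + (m * (t + 1) + (t + 1 - δ))) δ hδ j
    have h4 := (h1.trans h0 hp h2).trans h0 hp h3
    rwa [show m * (t + 1) + (t + 1 - δ) + δ = m * (t + 1) + (t + 1) by omega] at h4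
  · have h0 := Ctilde_nonneg h
    have h1 := reach_level_down h k δ hδ j
    have h2 := Reach.stay h0 hp (fun k => le_Ctilde_self h k j) (k + δ) (t + 1 - δ)
    have h3 := hm (fun j => level 0 t.zero_le j) h0 hp (fun j k => le_Ctilde_self h k j)
      (fun k j i hij => reach_push_link h k hij) i j (hG.reflTransGen_pulls i j)
      (k + (δ + (t + 1 - δ)))
    have h4 := (h1.trans h0 hp h2).trans h0 hp h3
    rwa [show δ + (t + 1 - δ) + m * (t + 1) = m * (t + 1) + (t + 1) by omega] at h4

lemma Hmat_mulVec (γ : ℝ) (y : Node V (t : ℕ∞) → ℝ) :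
    Hmat (t : ℕ∞) γ *ᵥ y = γ • restrict (agents V t) y := by
  ext a
  have : ∀ b, Hmat (t : ℕ∞) γ a b * y b = if a = b then (if a.1.1 = 0 then γ * y b else 0) else 0 := by
    intro b
    simp only [Hmat, Matrix.of_apply]
    by_cases h1 : a.1.1 = 0 <;> by_cases h2 : a = b <;> simp [h1, h2]
  simp only [mulVec, dotProduct, this, Finset.sum_ite_eq, Finset.mem_univ, if_true, Pi.smul_apply,
    restrict, mem_agents, smul_eq_mul]
  split_ifs <;> simp

lemma Jmat_mulVec (k : ℕ) (y : Node V (t : ℕ∞) → ℝ) :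
    Jmat G τ (t : ℕ∞) k *ᵥ y = restrict (agents V t) (y - Rtilde G τ (t : ℕ∞) k *ᵥ y) := by
  ext a
  by_cases h : a.1.1 = 0
  · have h1 : ∀ b, Jmat G τ (t : ℕ∞) k a b * y b
        = (if a = b then y b else 0) - Rtilde G τ (t : ℕ∞) k a b * y b := by
      intro b
      simp only [Jmat, Rtilde, Matrix.of_apply, if_pos h]
      by_cases h2 : a = b <;> simp [h2, sub_mul]
    simp [mulVec, dotProduct, h1, restrict, mem_agents, h]
  · simp [mulVec, dotProduct, Jmat, restrict, mem_agents, h]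

lemma traj_inl_succ (γ : ℝ) (x₀ : V → ℝ) (k : ℕ) :
    (fun a => traj G τ (t : ℕ∞) γ x₀ (k + 1) (Sum.inl a)) =
      Rtilde G τ (t : ℕ∞) k *ᵥ (fun a => traj G τ (t : ℕ∞) γ x₀ k (Sum.inl a)) +
      γ • restrict (agents V t) (fun a => traj G τ (t : ℕ∞) γ x₀ k (Sum.inr a)) := by
  rw [← Hmat_mulVec]
  ext a
  change ∑ᶠ b, Mmat G τ (t : ℕ∞) γ k (Sum.inl a) b * traj G τ (t : ℕ∞) γ x₀ k b = _
  rw [finsum_eq_sum_of_fintype, Fintype.sum_sum_type]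
  rfl

lemma traj_inr_succ (γ : ℝ) (x₀ : V → ℝ) (k : ℕ) :
    (fun a => traj G τ (t : ℕ∞) γ x₀ (k + 1) (Sum.inr a)) =
      Ctilde G τ (t : ℕ∞) k *ᵥ (fun a => traj G τ (t : ℕ∞) γ x₀ k (Sum.inr a)) +
      (restrict (agents V t) ((fun a => traj G τ (t : ℕ∞) γ x₀ k (Sum.inl a)) -
          Rtilde G τ (t : ℕ∞) k *ᵥ (fun a => traj G τ (t : ℕ∞) γ x₀ k (Sum.inl a))) -
        γ • restrict (agents V t) (fun a => traj G τ (t : ℕ∞) γ x₀ k (Sum.inr a))) := by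
  rw [← Hmat_mulVec, ← Jmat_mulVec, add_sub_left_comm, ← Matrix.sub_mulVec]
  ext a
  change ∑ᶠ b, Mmat G τ (t : ℕ∞) γ k (Sum.inr a) b * traj G τ (t : ℕ∞) γ x₀ k b = _
  rw [finsum_eq_sum_of_fintype, Fintype.sum_sum_type]
  rfl

lemma sum_agents (y : Node V (t : ℕ∞) → ℝ) :
    ∑ a ∈ agents V t, y a = ∑ j, y (level 0 t.zero_le j) := by
  symm
  refine Finset.sum_bij (fun j _ => level 0 t.zero_le j) (fun j _ => by simp [mem_agents, level])
    (fun i _ j _ h => by simpa [level] using h) (fun a ha => ?_) (fun _ _ => rfl)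
  obtain ⟨δ, hδ, j, rfl⟩ := a.eq_level
  obtain rfl : δ = 0 := mem_agents.1 ha
  exact ⟨j, Finset.mem_univ _, rfl⟩

lemma surplusIteration_traj [Nonempty V] (h : DelayBound G τ t) (γ : ℝ) (x₀ : V → ℝ) :
    SurplusIteration (agents V t) (Rtilde G τ (t : ℕ∞)) (Ctilde G τ (t : ℕ∞)) γ
      (fun k => (fun a => traj G τ (t : ℕ∞) γ x₀ k (Sum.inl a)) -
        ((∑ i, x₀ i) / (Fintype.card V : ℝ)) • 1)
      (fun k a => traj G τ (t : ℕ∞) γ x₀ k (Sum.inr a)) where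
  pull_mem := Rtilde_mem h
  push_mem := Ctilde_mem h
  state_step k := by
    rw [traj_inl_succ, Matrix.mulVec_sub, Matrix.mulVec_smul, (mem_rowStochastic.1 (Rtilde_mem h k)).2]
    abel
  surplus_step k := by
    rw [traj_inr_succ, Matrix.mulVec_sub, Matrix.mulVec_smul, (mem_rowStochastic.1 (Rtilde_mem h k)).2,
      sub_sub_sub_cancel_right]
  mass_zero := by
    rw [sum_agents]
    simp [traj, level]
    field_simp
    ring

end Bounded

theorem exists_gain_achieves {V : Type u} [Fintype V] [Nonempty V] {G : Digraph V}
    {B : V → V → ℕ∞} (hG : StronglyConnected G) (hB : BoundedDelays G B) :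
    ∃ γ₀ > 0, ∀ γ, 0 < γ → γ < γ₀ → AchievesAverageConsensus G B γ := by
  classical
  obtain ⟨t, ht⟩ : ∃ t : ℕ, maxDelay G B = t := by
    obtain ⟨D, hD⟩ := hB
    have : maxDelay G B ≤ D := iSup_le fun j => iSup_le fun i => iSup_le fun h => hD j i h
    exact ⟨_, (ENat.natCast_toNat (ne_top_of_le_ne_top (ENat.natCast_ne_top D) this)).symm⟩
  obtain ⟨L, hL, hmix⟩ := exists_mixing_window G hG t
  obtain ⟨o⟩ := ‹Nonempty V›
  obtain ⟨γ₀, hγ₀, hconv⟩ := exists_gain_tendsto_zero (agents V t)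
    (o := level 0 t.zero_le o) (by simp [mem_agents, level]) hL
    (pow_pos (minWeight_pos (V := V) (t := t)) L)
  refine ⟨γ₀, hγ₀, fun γ hγ hγ' τ hτ x₀ j => ?_⟩
  have hle : ∀ j i, IsLink G i j → B j i ≤ t := fun j i h => ht ▸ le_iSup_of_le j
    (le_iSup_of_le i (le_iSup_of_le h le_rfl))
  have hD : DelayBound G τ t :=
    ⟨hτ.2, fun j i h k => by exact_mod_cast (hτ.1 j i h k).trans (hle j i h)⟩
  rw [ht]
  have := hconv γ hγ hγ' _ _ _ _ (surplusIteration_traj hD γ x₀)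
    (fun k a ha b => (hmix τ hD k a ha b).1) (fun k a ha b => (hmix τ hD k a ha b).2)
    (agent (t : ℕ∞) j)
  refine ⟨?_, this.2⟩
  have h1 := this.1.add_const ((∑ i, x₀ i) / (Fintype.card V : ℝ))
  simpa using h1

/-- No information leaves the set of nodes that cannot be reached from `i`, so the states there stay
zero if they are zero at first. -/
theorem not_achieves_of_not_stronglyConnected {V : Type u} [Fintype V] {G : Digraph V}
    (B : V → V → ℕ∞) (hG : ¬ StronglyConnected G) (γ : ℝ) : ¬ AchievesAverageConsensus G B γ := by
  classical
  unfold StronglyConnected at hG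
  push Not at hG
  obtain ⟨i, j, hij⟩ := hG
  intro h
  have h1 := (h (fun _ _ _ => 0) ⟨fun _ _ _ _ => by simp, fun _ _ => rfl⟩ (Pi.single i 1) j).1
  set T := maxDelay G B
  have hzero : ∀ k (a : Node V T), ¬ Relation.ReflTransGen G.Adj i a.2 →
      traj G (fun _ _ _ => 0) T γ (Pi.single i 1) k (Sum.inl a) = 0 ∧
      traj G (fun _ _ _ => 0) T γ (Pi.single i 1) k (Sum.inr a) = 0 := by
    intro k
    induction k with
    | zero =>
      intro a ha
      have : a.2 ≠ i := fun h => ha (h ▸ .refl)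
      simp [traj, this]
    | succ k ih =>
      intro a ha
      have hb : ∀ b : Node V T, b.2 = a.2 ∨ IsLink G b.2 a.2 →
          ¬ Relation.ReflTransGen G.Adj i b.2 := by
        rintro b (hb | hb) hr
        · exact ha (hb ▸ hr)
        · exact ha (hr.tail hb.2)
      constructor <;>
      · refine finsum_eq_zero_of_forall_eq_zero ?_
        rintro (b | b) <;>
        · by_cases hl : b.2 = a.2 ∨ IsLink G b.2 a.2
          · simp [ih b (hb b hl)]
          · have h2 : a ≠ b := fun h => hl (Or.inl (h ▸ rfl))
            have h3 : ¬ a.2 = b.2 := fun h => hl (Or.inl h.symm)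
            simp [Mmat, Rtilde, Ctilde, Jmat, Hmat, pull, push, hl, h2, h3]
  have h2 : Tendsto (fun _ : ℕ => (0 : ℝ)) atTop
      (𝓝 ((∑ l, Pi.single i (1 : ℝ) l) / (Fintype.card V : ℝ))) :=
    h1.congr fun k => (hzero k (agent T j) hij).1
  have h3 := tendsto_nhds_unique h2 tendsto_const_nhds
  have : Nonempty V := ⟨i⟩
  simp at h3

/-! ### The iteration with unbounded delays at the level of the agents -/

section Unbounded

variable {V : Type u}

/-- The node of level `δ` of agent `j` when there are infinitely many levels. -/
def topLevel (δ : ℕ) (j : V) : Node V ⊤ := (⟨δ, le_top⟩, j)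

@[simp] lemma topLevel_fst (δ : ℕ) (j : V) : (topLevel δ j).1.1 = δ := rfl

lemma finsum_topLevel [Fintype V] (f : Node V ⊤ ⊕ Node V ⊤ → ℝ) (m : ℕ)
    (hf : ∀ b : Node V ⊤, m ≤ b.1.1 → f (Sum.inl b) = 0 ∧ f (Sum.inr b) = 0) :
    ∑ᶠ b, f b = ∑ δ ∈ range m, ∑ i, f (Sum.inl (topLevel δ i)) +
      ∑ δ ∈ range m, ∑ i, f (Sum.inr (topLevel δ i)) := by
  classical
  have hinj : Function.Injective (fun p : ℕ × V => topLevel p.1 p.2) := by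
    rintro ⟨a, i⟩ ⟨b, j⟩ h
    simpa [topLevel] using h
  let N : Finset (Node V ⊤) := (range m ×ˢ Finset.univ).map ⟨_, hinj⟩
  have hN : ∀ b : Node V ⊤, b ∉ N → m ≤ b.1.1 := by
    rintro ⟨⟨δ, hδ⟩, i⟩ h
    by_contra hlt
    exact h (Finset.mem_map.2 ⟨(δ, i), by simpa using hlt, rfl⟩)
  rw [finsum_eq_sum_of_support_subset (s := N.disjSum N)]
  · rw [Finset.sum_disjSum]
    simp only [N, Finset.sum_map, Finset.sum_product, Function.Embedding.coeFn_mk]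
  · rintro (b | b) hb
    · by_contra h
      exact hb (hf b (hN b (by simpa using h))).1
    · by_contra h
      exact hb (hf b (hN b (by simpa using h))).2

variable (G : Digraph V) (τ : V → V → ℕ → ℕ) (γ : ℝ) (x₀ : V → ℝ)

/-- The states of the agents. -/
noncomputable def state (k : ℕ) (j : V) : ℝ := traj G τ ⊤ γ x₀ k (Sum.inl (agent ⊤ j))

/-- The surpluses of the agents. -/
noncomputable def surplus (k : ℕ) (j : V) : ℝ := traj G τ ⊤ γ x₀ k (Sum.inr (agent ⊤ j))

lemma traj_inl_topLevel [Fintype V] (k δ : ℕ) (j : V) :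
    traj G τ ⊤ γ x₀ k (Sum.inl (topLevel δ j)) =
      if δ ≤ k then state G τ γ x₀ (k - δ) j else 0 := by
  induction δ generalizing k with
  | zero => simp [state, topLevel, agent]
  | succ δ ih =>
    cases k with
    | zero => simp [traj, topLevel]
    | succ k =>
      change ∑ᶠ b, Mmat G τ ⊤ γ k (Sum.inl (topLevel (δ + 1) j)) b * traj G τ ⊤ γ x₀ k b = _
      rw [finsum_eq_single _ (Sum.inl (topLevel δ j))]
      · rw [ih]
        simp [Mmat, Rtilde, topLevel]
      · rintro (b | b) hb
        · have : ¬ (δ = b.1.1 ∧ j = b.2) := by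
            rintro ⟨rfl, rfl⟩
            exact hb rfl
          simp [Mmat, Rtilde, topLevel, this]
        · simp [Mmat, Hmat, topLevel]

/-- The weighted mean of the values that arrive at agent `j` at time `k`. -/
noncomputable def pulled [Fintype V] (k : ℕ) (j : V) : ℝ :=
  ∑ t ∈ range (k + 1), ∑ i, pull G τ k (k - t) j i * state G τ γ x₀ t i

lemma sum_pull_eq_pulled [Fintype V] {m k : ℕ} (hm : k < m) (j : V) :
    ∑ δ ∈ range m, ∑ i, pull G τ k δ j i * traj G τ ⊤ γ x₀ k (Sum.inl (topLevel δ i)) =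
      pulled G τ γ x₀ k j := by
  have h1 : ∑ δ ∈ range m, ∑ i, pull G τ k δ j i * traj G τ ⊤ γ x₀ k (Sum.inl (topLevel δ i)) =
      ∑ δ ∈ range (k + 1), ∑ i, pull G τ k δ j i * state G τ γ x₀ (k - δ) i := by
    symm
    refine Finset.sum_subset_zero_on_sdiff (Finset.range_subset_range.2 hm) ?_ ?_
    · intro δ hδ
      have : ¬ δ ≤ k := by simp at hδ; omega
      simp [traj_inl_topLevel, this]
    · intro δ hδ
      have : δ ≤ k := by simp at hδ; omega
      simp [traj_inl_topLevel, this]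
  rw [h1, pulled, ← Finset.sum_range_reflect]
  refine Finset.sum_congr rfl fun t ht => Finset.sum_congr rfl fun i _ => ?_
  have : t ≤ k := by simp at ht; omega
  rw [show k + 1 - 1 - t = k - t by omega, show k - (k - t) = t by omega]

lemma state_succ [Fintype V] (k : ℕ) (j : V) :
    state G τ γ x₀ (k + 1) j = pulled G τ γ x₀ k j + γ * surplus G τ γ x₀ k j := by
  classical
  change ∑ᶠ b, Mmat G τ ⊤ γ k (Sum.inl (topLevel 0 j)) b * traj G τ ⊤ γ x₀ k b = _
  rw [finsum_topLevel _ (k + 1)]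
  · congr 1
    · rw [← sum_pull_eq_pulled G τ γ x₀ (Nat.lt_succ_self k)]
      simp [Mmat, Rtilde, topLevel]
    · rw [Finset.sum_eq_single 0]
      · rw [Finset.sum_eq_single j]
        · simp [Mmat, Hmat, topLevel, surplus, agent]
        · intro i _ hi
          simp [Mmat, Hmat, topLevel, hi.symm]
        · simp
      · intro δ _ hδ
        simp [Mmat, Hmat, topLevel, hδ.symm]
      · simp
  · intro b hb
    have h1 : ¬ b.1.1 ≤ k := by omega
    have h2 : topLevel 0 j ≠ b := by rintro rfl; simp [topLevel] at hb
    simp [Mmat, Rtilde, Hmat, pull, Arrives, h1, h2]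

lemma traj_inr_topLevel_succ [Fintype V] (k δ : ℕ) (j : V) :
    traj G τ ⊤ γ x₀ (k + 1) (Sum.inr (topLevel δ j)) =
      (if δ = 0 then state G τ γ x₀ k j - pulled G τ γ x₀ k j - γ * surplus G τ γ x₀ k j else 0) +
      (∑ i, push G τ k δ j i * surplus G τ γ x₀ k i +
        traj G τ ⊤ γ x₀ k (Sum.inr (topLevel (δ + 1) j))) := by
  classical
  change ∑ᶠ b, Mmat G τ ⊤ γ k (Sum.inr (topLevel δ j)) b * traj G τ ⊤ γ x₀ k b = _
  have hC : ∑ δ' ∈ range (k + δ + 2), ∑ i, Ctilde G τ ⊤ k (topLevel δ j) (topLevel δ' i) *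
      traj G τ ⊤ γ x₀ k (Sum.inr (topLevel δ' i)) =
      ∑ i, push G τ k δ j i * surplus G τ γ x₀ k i +
        traj G τ ⊤ γ x₀ k (Sum.inr (topLevel (δ + 1) j)) := by
    rw [Finset.sum_range_succ', add_comm]
    congr 1
    rw [Finset.sum_eq_single δ, Finset.sum_eq_single j]
    · simp [Ctilde, topLevel]
    · intro i _ hi
      simp [Ctilde, topLevel, hi.symm]
    · simp
    · intro δ' _ hδ'
      simp [Ctilde, topLevel, hδ']
    · intro h
      simp at h
  have hH : ∑ δ' ∈ range (k + δ + 2), ∑ i, Hmat ⊤ γ (topLevel δ j) (topLevel δ' i) *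
      traj G τ ⊤ γ x₀ k (Sum.inr (topLevel δ' i)) =
      if δ = 0 then γ * surplus G τ γ x₀ k j else 0 := by
    rw [Finset.sum_eq_single 0, Finset.sum_eq_single j]
    · by_cases h : δ = 0 <;> simp [Hmat, topLevel, surplus, agent, h]
    · intro i _ hi
      simp [Hmat, topLevel, hi.symm]
    · simp
    · intro δ' _ hδ'
      refine Finset.sum_eq_zero fun i _ => ?_
      by_cases h : δ = 0
      · subst h; simp [Hmat, topLevel, Ne.symm hδ']
      · simp [Hmat, topLevel, h]
    · simp
  have hJ : ∑ δ' ∈ range (k + δ + 2), ∑ i, Jmat G τ ⊤ k (topLevel δ j) (topLevel δ' i) *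
      traj G τ ⊤ γ x₀ k (Sum.inl (topLevel δ' i)) =
      if δ = 0 then state G τ γ x₀ k j - pulled G τ γ x₀ k j else 0 := by
    by_cases h : δ = 0
    · subst h
      have h1 : ∀ δ' i, Jmat G τ ⊤ k (topLevel 0 j) (topLevel δ' i) *
          traj G τ ⊤ γ x₀ k (Sum.inl (topLevel δ' i)) =
          (if 0 = δ' then if j = i then state G τ γ x₀ k j else 0 else 0) -
          pull G τ k δ' j i * traj G τ ⊤ γ x₀ k (Sum.inl (topLevel δ' i)) := by
        intro δ' i
        rw [Jmat, Matrix.of_apply, if_pos (topLevel_fst 0 j), sub_mul]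
        congr 1
        by_cases h2 : 0 = δ'
        · subst h2
          by_cases h3 : j = i
          · subst h3; simp [state, agent, topLevel]
          · simp [topLevel, h3]
        · simp [topLevel, h2]
      simp only [h1, Finset.sum_sub_distrib]
      rw [sum_pull_eq_pulled G τ γ x₀ (show k < k + 0 + 2 by omega)]
      congr 1
      rw [Finset.sum_eq_single 0]
      · simp
      · intro δ' _ h2; simp [Ne.symm h2]
      · simp
    · simp [Jmat, topLevel, h]
  rw [finsum_topLevel _ (k + δ + 2)]
  · simp only [Mmat, Matrix.fromBlocks_apply₂₁, Matrix.fromBlocks_apply₂₂, Matrix.sub_apply,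
      sub_mul, Finset.sum_sub_distrib]
    rw [hC, hH, hJ]
    split_ifs <;> ring
  · intro b hb
    have h1 : ¬ b.1.1 ≤ k := by omega
    have h2 : topLevel δ j ≠ b := by rintro rfl; simp [topLevel] at hb; omega
    have h3 : b.1.1 ≠ 0 := by omega
    have h4 : b.1.1 ≠ δ + 1 := by omega
    simp [Mmat, Ctilde, Jmat, Hmat, pull, Arrives, h1, h2, h3, h4]

lemma traj_inr_topLevel [Fintype V] (k δ : ℕ) (hδ : δ ≠ 0) (j : V) :
    traj G τ ⊤ γ x₀ k (Sum.inr (topLevel δ j)) =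
      ∑ t ∈ range k, ∑ i, push G τ t (δ + (k - 1 - t)) j i * surplus G τ γ x₀ t i := by
  induction k generalizing δ with
  | zero => simp [traj]
  | succ k ih =>
    rw [traj_inr_topLevel_succ, if_neg hδ, zero_add, ih (δ + 1) (by omega), Finset.sum_range_succ,
      add_comm]
    congr 1
    · refine Finset.sum_congr rfl fun t ht => Finset.sum_congr rfl fun i _ => ?_
      have : t < k := by simpa using ht
      rw [show δ + 1 + (k - 1 - t) = δ + (k + 1 - 1 - t) by omega]
    · simp

lemma surplus_succ [Fintype V] (k : ℕ) (j : V) :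
    surplus G τ γ x₀ (k + 1) j =
      state G τ γ x₀ k j - pulled G τ γ x₀ k j - γ * surplus G τ γ x₀ k j +
      ∑ t ∈ range (k + 1), ∑ i, push G τ t (k - t) j i * surplus G τ γ x₀ t i := by
  have h := traj_inr_topLevel_succ G τ γ x₀ k 0 j
  rw [if_pos rfl, traj_inr_topLevel G τ γ x₀ k 1 one_ne_zero] at h
  rw [Finset.sum_range_succ, Nat.sub_self, add_comm (∑ t ∈ range k, _)]
  have h2 : ∑ t ∈ range k, ∑ i, push G τ t (0 + 1 + (k - 1 - t)) j i * surplus G τ γ x₀ t i =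
      ∑ t ∈ range k, ∑ i, push G τ t (k - t) j i * surplus G τ γ x₀ t i := by
    refine Finset.sum_congr rfl fun t ht => Finset.sum_congr rfl fun i _ => ?_
    have : t < k := by simpa using ht
    rw [show 0 + 1 + (k - 1 - t) = k - t by omega]
  rw [← h2]
  exact h

end Unbounded

/-! ### Delays on a single link -/

section SingleLink

variable {V : Type u}

open Classical in
/-- The delays `θ` on the link `p → q`, no delay elsewhere. -/
noncomputable def linkDelay (p q : V) (θ : ℕ → ℕ) : V → V → ℕ → ℕ :=
  fun j i k => if i = p ∧ j = q then θ k else 0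

lemma arrives_linkDelay {p q : V} {θ : ℕ → ℕ} {j i : V} {k t : ℕ} (ht : t ≤ k) :
    Arrives (linkDelay p q θ) j i k (k - t) ↔ linkDelay p q θ j i t = k - t := by
  unfold Arrives
  rw [Nat.sub_sub_self ht]
  exact and_iff_right (Nat.sub_le _ _)

variable [Fintype V]

open Classical in
/-- The agent `j` and its in-neighbours, where the link `p → q` is ignored. -/
noncomputable def nbrs (G : Digraph V) (p q j : V) : Finset V :=
  Finset.univ.filter fun i => i = j ∨ (IsLink G i j ∧ ¬(i = p ∧ j = q))

lemma mem_nbrs {G : Digraph V} {p q i j : V} :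
    i ∈ nbrs G p q j ↔ i = j ∨ (IsLink G i j ∧ ¬(i = p ∧ j = q)) := by
  simp only [nbrs, Finset.mem_filter, Finset.mem_univ, true_and]

/-- The sending times of the packets that arrive over the link `p → q` at time `k`. -/
def arrivalSet (θ : ℕ → ℕ) (k : ℕ) : Finset ℕ := (range (k + 1)).filter fun t => t + θ t = k

/-- The share of its surplus that agent `i` sends to each out-neighbour. -/
noncomputable def share (G : Digraph V) (i : V) : ℝ := 1 / (1 + (outDegree G i : ℝ))

open Classical in
/-- The mean of the values that `q` and the other agents receive at time `k`, if the packets sent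
over the link `p → q` at the times in `A` arrive now. -/
noncomputable def linkMean (G : Digraph V) (p q : V) (A : Finset ℕ) (x : ℕ → V → ℝ) (k : ℕ) (j : V) :
    ℝ :=
  (∑ i ∈ nbrs G p q j, x k i + if j = q then ∑ t ∈ A, x t p else 0) /
    ((nbrs G p q j).card + if j = q then (A.card : ℝ) else 0)

open Classical in
/-- The iteration in which only the link `p → q` has delays; `A k` is the set of sending times of the
packets that arrive over this link at time `k`. -/
structure LinkRun (G : Digraph V) (p q : V) (γ : ℝ) (A : ℕ → Finset ℕ) (x s : ℕ → V → ℝ) :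
    Prop where
  state_step : ∀ k j, x (k + 1) j = linkMean G p q (A k) x k j + γ * s k j
  surplus_step : ∀ k j, s (k + 1) j = x k j - linkMean G p q (A k) x k j - γ * s k j +
    (∑ i ∈ nbrs G p q j, share G i * s k i +
      if j = q then ∑ t ∈ A k, share G p * s t p else 0)

open Classical in
lemma sum_active {G : Digraph V} {p q : V} (hpq : IsLink G p q) (θ : ℕ → ℕ) (f : ℕ → V → ℝ) (k : ℕ)
    (j : V) :
    ∑ t ∈ range (k + 1), ∑ i,
      (if (i = j ∨ IsLink G i j) ∧ linkDelay p q θ j i t = k - t then f t i else 0) =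
    ∑ i ∈ nbrs G p q j, f k i + if j = q then ∑ t ∈ arrivalSet θ k, f t p else 0 := by
  have h1 : ∀ t ∈ range (k + 1), ∀ i,
      (if (i = j ∨ IsLink G i j) ∧ linkDelay p q θ j i t = k - t then f t i else 0) =
      (if t = k then if i ∈ nbrs G p q j then f t i else 0 else 0) +
      (if i = p then if j = q then if t + θ t = k then f t p else 0 else 0 else 0) := by
    intro t ht i
    have ht' : t ≤ k := by simp at ht; omega
    by_cases h : i = p ∧ j = q
    · obtain ⟨rfl, rfl⟩ := h
      have h2 : i ∉ nbrs G i j j := by simp [mem_nbrs, hpq.1]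
      have h3 : (θ t = k - t) ↔ t + θ t = k := by omega
      simp [hpq, linkDelay, h2, h3]
    · have h2 : i ∈ nbrs G p q j ↔ i = j ∨ IsLink G i j := by
        simp only [mem_nbrs, h, not_false_eq_true, and_true]
      have h3 : (0 = k - t) ↔ t = k := by omega
      have h4 : (if i = p then if j = q then if t + θ t = k then f t p else 0 else 0 else 0) = 0 := by
        by_cases h5 : i = p
        · have : j ≠ q := fun h6 => h ⟨h5, h6⟩
          simp [this]
        · simp [h5]
      rw [h4, add_zero]
      simp only [linkDelay, if_neg h, h2, h3]
      by_cases h6 : t = k <;> simp [h6]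
  rw [Finset.sum_congr rfl fun t ht => Finset.sum_congr rfl fun i _ => h1 t ht i]
  simp only [Finset.sum_add_distrib]
  congr 1
  · rw [Finset.sum_eq_single k]
    · simp
    · intro t _ ht; simp [ht]
    · simp
  · simp only [Finset.sum_ite_eq', Finset.mem_univ, if_true, arrivalSet, Finset.sum_filter]
    split_ifs <;> simp

open Classical in
lemma virtualInDegree_linkDelay {G : Digraph V} {p q : V} (hpq : IsLink G p q) (θ : ℕ → ℕ) (k : ℕ)
    (j : V) : 1 + (virtualInDegree G (linkDelay p q θ) j k : ℝ) =
      (nbrs G p q j).card + if j = q then ((arrivalSet θ k).card : ℝ) else 0 := by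
  have hself : ∀ j k, linkDelay p q θ j j k = 0 := by
    intro j k
    simp only [linkDelay]
    rw [if_neg]
    rintro ⟨rfl, h⟩
    exact hpq.1 h
  have h1 := sum_active hpq θ (fun _ _ => (1 : ℝ)) k j
  simp only [Finset.sum_const, nsmul_eq_mul, mul_one] at h1
  rw [← h1, Finset.sum_comm, ← Finset.sum_product', ← Finset.sum_filter, Finset.sum_const,
    nsmul_eq_mul, mul_one]
  have h2 := ncard_active (G := G) hself j k
  have h3 : {p' : V × ℕ | (p'.1 = j ∨ IsLink G p'.1 j) ∧ Arrives (linkDelay p q θ) j p'.1 k p'.2}.ncard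
      = (Finset.filter (fun a : V × ℕ => (a.1 = j ∨ IsLink G a.1 j) ∧
        linkDelay p q θ j a.1 a.2 = k - a.2) (Finset.univ ×ˢ range (k + 1))).card := by
    rw [← Set.ncard_coe_finset]
    symm
    refine Set.ncard_congr (fun a _ => (a.1, k - a.2)) ?_ ?_ ?_
    · rintro ⟨i, t⟩ ht
      simp only [Finset.coe_filter, Finset.mem_product, Finset.mem_univ, true_and, Finset.mem_range,
        Set.mem_ofPred_eq] at ht ⊢
      exact ⟨ht.2.1, (arrives_linkDelay (by omega)).2 ht.2.2⟩
    · rintro ⟨i, t⟩ ⟨i', t'⟩ ht ht' h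
      simp only [Finset.coe_filter, Finset.mem_product, Finset.mem_univ, true_and, Finset.mem_range,
        Set.mem_ofPred_eq] at ht ht'
      simp only [Prod.mk.injEq] at h ⊢
      exact ⟨h.1, by omega⟩
    · rintro ⟨i, δ⟩ ⟨hl, ha⟩
      have h4 : δ ≤ k := ha.1
      refine ⟨(i, k - δ), ?_, by simp [Nat.sub_sub_self h4]⟩
      simp only [Finset.coe_filter, Finset.mem_product, Finset.mem_univ, true_and, Finset.mem_range,
        Set.mem_ofPred_eq]
      exact ⟨by omega, hl, by rw [Nat.sub_sub_self h4]; exact ha.2⟩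
  rw [← h3, h2]
  push_cast
  ring

theorem linkRun_traj {G : Digraph V} {p q : V} (hpq : IsLink G p q) (θ : ℕ → ℕ) (γ : ℝ)
    (x₀ : V → ℝ) : LinkRun G p q γ (arrivalSet θ) (state G (linkDelay p q θ) γ x₀)
      (surplus G (linkDelay p q θ) γ x₀) := by
  classical
  have hp : ∀ k j, pulled G (linkDelay p q θ) γ x₀ k j =
      linkMean G p q (arrivalSet θ k) (state G (linkDelay p q θ) γ x₀) k j := by
    intro k j
    have h1 := sum_active hpq θ (state G (linkDelay p q θ) γ x₀) k j
    unfold linkMean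
    rw [← virtualInDegree_linkDelay hpq θ k j, ← h1, pulled, Finset.sum_div]
    refine Finset.sum_congr rfl fun t ht => ?_
    rw [Finset.sum_div]
    refine Finset.sum_congr rfl fun i _ => ?_
    simp only [pull_eq, arrives_linkDelay (show t ≤ k by simp at ht; omega)]
    split_ifs
    · ring
    · simp
  constructor
  · intro k j
    rw [state_succ, hp]
  · intro k j
    rw [surplus_succ, hp]
    congr 1
    have h1 := sum_active hpq θ (fun t i => share G i * surplus G (linkDelay p q θ) γ x₀ t i) k j
    rw [← h1]
    refine Finset.sum_congr rfl fun t _ => Finset.sum_congr rfl fun i _ => ?_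
    simp only [push_eq, share]
    split_ifs <;> simp

end SingleLink

/-! ### Exponential estimates for constant weights -/

section Phase

variable {ι κ : Type*} [Fintype ι] [DecidableEq ι] [Fintype κ] [DecidableEq κ]

lemma exists_window {P : Matrix ι ι ℝ} (hP : ∀ a b, 0 ≤ P a b) {β : ℝ} (hβ : 0 < β)
    (r : ι → ι → Prop) (hr : ∀ a c, r a c → β ≤ P a c) (hself : ∀ a, β ≤ P a a) :
    ∃ L, 0 < L ∧ ∃ η, 0 < η ∧ ∀ a c, Relation.ReflTransGen r a c →
      ∀ k, η ≤ evol (fun _ => P) k L a c := by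
  obtain ⟨m, hm⟩ := Reach.exists_uniform (ι := ι) r
  refine ⟨m * 1 + 1, by omega, β ^ (m * 1 + 1), by positivity, fun a c h k => ?_⟩
  exact (hm id (fun _ => hP) hβ.le (fun a _ => hself a) (fun k a c h => Reach.one (hr a c h)) a c h
    k).trans (fun _ => hP) hβ.le (Reach.stay (fun _ => hP) hβ.le (fun _ => hself a) _ 1)

/-- The stability of a fixed pair of mixing weights that are coupled with a small gain, over a finite
time span: the initial deviation decays exponentially, and the disturbance `F` enters with a bounded
gain. -/
lemma exists_phase {R : Matrix ι ι ℝ} (hR : R ∈ rowStochastic ℝ ι) {C : Matrix κ κ ℝ}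
    (hC : C ∈ colStochastic ℝ κ) {o : ι} {o' : κ} {L : ℕ} (hL : 0 < L) {η : ℝ} (hη : 0 < η)
    (hRη : ∀ k a, η ≤ evol (fun _ => R) k L a o) {L' : ℕ} (hL' : 0 < L') {η' : ℝ} (hη' : 0 < η')
    (hCη : ∀ k b, η' ≤ evol (fun _ => C) k L' o' b) {K : ℝ} (hK : 0 ≤ K) :
    ∃ γ₀ > 0, ∃ c ≥ 1, ∃ lam, 0 < lam ∧ lam < 1 ∧ ∀ γ, 0 < γ → γ < γ₀ →
      ∀ (N : ℕ) (F : ℝ), 0 ≤ F → ∀ (x : ℕ → ι → ℝ) (r : ℕ → κ → ℝ), (∀ k, ∑ a, r k a = 0) →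
        (∀ k < N, osc (x (k + 1) - R *ᵥ x k) ≤ K * (γ * l1 (r k) + F)) →
        (∀ k < N, l1 (r (k + 1) - C *ᵥ r k) ≤ K * (osc (x k) + γ * l1 (r k) + F)) →
        ∀ k ≤ N, osc (x k) + l1 (r k) ≤ c * (lam ^ k * (osc (x 0) + l1 (r 0)) + F) := by
  have hη1 : η ≤ 1 := (hRη 0 o).trans (le_one_of_mem_rowStochastic (evol_mem (fun _ => hR) 0 L))
  have hη1' : η' ≤ 1 := (hCη 0 o').trans (by
    have h := mem_colStochastic_iff_sum.1 (evol_mem (fun _ => hC) 0 L')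
    rw [← h.2 o']
    exact Finset.single_le_sum (fun b _ => h.1 b o') (Finset.mem_univ o'))
  have hLr : (1 : ℝ) ≤ L := by exact_mod_cast hL
  have hLr' : (1 : ℝ) ≤ L' := by exact_mod_cast hL'
  set ρ := max (1 - η / L) (1 - η' / L') with hρ
  have hρ1 : ρ < 1 := by
    have h1 : 0 < η / L := by positivity
    have h2 : 0 < η' / L' := by positivity
    exact max_lt (by linarith) (by linarith)
  have hρ0 : 0 ≤ ρ := by
    have h1 : η / L ≤ 1 := by rw [div_le_one (by linarith)]; linarith
    exact le_max_of_le_left (by linarith)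
  set Λ : ℝ := (L : ℝ) + L' with hΛ
  obtain ⟨γ₀, hγ₀, b, hb, lam, hlam0, hlam1, hgain⟩ :=
    exists_small_gain_two (C := Λ * K) (ρ := ρ) (by positivity) hρ0 hρ1
  have h1lam : 0 < 1 - lam := by linarith
  have hb1 : 0 < 1 + 1 / b := by positivity
  set B := Λ * K + b * (Λ * K) with hB
  have hB0 : 0 ≤ B := by positivity
  -- `c` absorbs the equivalence constants of the adapted functionals and the summed disturbance
  set c := 1 + (1 + 1 / b) * (Λ * (1 + b) + B / (1 - lam)) with hc
  refine ⟨γ₀, hγ₀, c, ?_, lam, hlam0, hlam1, ?_⟩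
  · have : 0 ≤ (1 + 1 / b) * (Λ * (1 + b) + B / (1 - lam)) := by positivity
    linarith
  intro γ hγ hγ' N F hF x r hr0 hx hrr
  have hosc_le : ∀ (k : ℕ) y, osc (R *ᵥ y) ≤ osc y := fun k y => osc_mulVec_le hR y
  have hl1_le : ∀ (k : ℕ) y, l1 (C *ᵥ y) ≤ l1 y := fun k y => l1_mulVec_le_self hC y
  let d : ℕ → ℝ := fun k => adapted (fun _ => R) osc L k (x k)
  let e : ℕ → ℝ := fun k => adapted (fun _ => C) l1 L' k (r k)
  have hd0 : ∀ k, 0 ≤ d k := fun k => adapted_nonneg osc_nonneg _ _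
  have he0 : ∀ k, 0 ≤ e k := fun k => adapted_nonneg l1_nonneg _ _
  have hd : ∀ k, osc (x k) ≤ d k := fun k => le_adapted osc_nonneg hL _ _
  have he : ∀ k, l1 (r k) ≤ e k := fun k => le_adapted l1_nonneg hL' _ _
  have hdstep : ∀ k < N, d (k + 1) ≤ ρ * d k + Λ * K * γ * e k + Λ * K * F := by
    intro k hk
    have h1 : osc (evol (fun _ => R) k L *ᵥ x k) ≤ (1 - η) * osc (x k) :=
      osc_mulVec_le_of_le (evol_mem (fun _ => hR) k L) (hRη k) (x k)
    have h2 := adapted_step (P := fun _ => R) hosc_le hL hη.le h1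
    have h3 : d (k + 1) ≤ adapted (fun _ => R) osc L (k + 1) (R *ᵥ x k)
        + adapted (fun _ => R) osc L (k + 1) (x (k + 1) - R *ᵥ x k) := by
      have h := adapted_add (P := fun _ => R) (L := L) osc_add (k + 1) (R *ᵥ x k)
        (x (k + 1) - R *ᵥ x k)
      rwa [add_sub_cancel] at h
    have h4 : adapted (fun _ => R) osc L (k + 1) (x (k + 1) - R *ᵥ x k) ≤
        Λ * (K * (γ * e k + F)) := by
      refine (adapted_le (P := fun _ => R) hosc_le _ _).trans ?_
      refine mul_le_mul (by linarith) ((hx k hk).trans ?_) (osc_nonneg _) (by linarith)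
      have := mul_le_mul_of_nonneg_left (he k) hγ.le
      exact mul_le_mul_of_nonneg_left (by linarith) hK
    have h5 : (1 - η / L) * d k ≤ ρ * d k := mul_le_mul_of_nonneg_right (le_max_left _ _) (hd0 k)
    have h6 : adapted (fun _ => R) osc L (k + 1) (R *ᵥ x k) ≤ (1 - η / L) * d k := h2
    linarith
  have hestep : ∀ k < N, e (k + 1) ≤
      ρ * e k + Λ * K * d k + Λ * K * γ * e k + Λ * K * F := by
    intro k hk
    have h1 : l1 (evol (fun _ => C) k L' *ᵥ r k) ≤ (1 - η') * l1 (r k) :=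
      l1_mulVec_le_of_le (evol_mem (fun _ => hC) k L') (hCη k) (hr0 k)
    have h2 := adapted_step (P := fun _ => C) hl1_le hL' hη'.le h1
    have h3 : e (k + 1) ≤ adapted (fun _ => C) l1 L' (k + 1) (C *ᵥ r k)
        + adapted (fun _ => C) l1 L' (k + 1) (r (k + 1) - C *ᵥ r k) := by
      have h := adapted_add (P := fun _ => C) (L := L') l1_add (k + 1) (C *ᵥ r k)
        (r (k + 1) - C *ᵥ r k)
      rwa [add_sub_cancel] at h
    have h4 : adapted (fun _ => C) l1 L' (k + 1) (r (k + 1) - C *ᵥ r k) ≤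
        Λ * (K * (d k + γ * e k + F)) := by
      refine (adapted_le (P := fun _ => C) hl1_le _ _).trans ?_
      refine mul_le_mul (by linarith) ((hrr k hk).trans ?_) (l1_nonneg _) (by linarith)
      have := mul_le_mul_of_nonneg_left (he k) hγ.le
      exact mul_le_mul_of_nonneg_left (by linarith [hd k]) hK
    have h5 : (1 - η' / L') * e k ≤ ρ * e k :=
      mul_le_mul_of_nonneg_right (le_max_right _ _) (he0 k)
    have h6 : adapted (fun _ => C) l1 L' (k + 1) (C *ᵥ r k) ≤ (1 - η' / L') * e k := h2
    linarith
  intro k hk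
  have hV := le_pow_of_step (V := fun k => d k + b * e k) hlam0.le hlam1 (mul_nonneg hB0 hF)
    (fun k hk => hgain γ hγ hγ' (d k) (e k) _ _ F (hd0 k) (he0 k) (hdstep k hk) (hestep k hk)) k hk
  have h0 : d 0 + b * e 0 ≤ Λ * (1 + b) * (osc (x 0) + l1 (r 0)) := by
    have h1 : d 0 ≤ L * osc (x 0) := adapted_le (P := fun _ => R) hosc_le _ _
    have h2 : e 0 ≤ L' * l1 (r 0) := adapted_le (P := fun _ => C) hl1_le _ _
    have h3 : L * osc (x 0) ≤ Λ * osc (x 0) :=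
      mul_le_mul_of_nonneg_right (by linarith) (osc_nonneg _)
    have h4 : L' * l1 (r 0) ≤ Λ * l1 (r 0) :=
      mul_le_mul_of_nonneg_right (by linarith) (l1_nonneg _)
    have h5 := mul_le_mul_of_nonneg_left (h2.trans h4) hb.le
    have h6 : 0 ≤ Λ * l1 (r 0) := mul_nonneg (by positivity) (l1_nonneg _)
    have h7 : 0 ≤ b * (Λ * osc (x 0)) :=
      mul_nonneg hb.le (mul_nonneg (by positivity) (osc_nonneg _))
    linarith
  have hpow : 0 ≤ lam ^ k := by positivity
  set Y := osc (x 0) + l1 (r 0) with hY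
  have hY0 : 0 ≤ Y := add_nonneg (osc_nonneg _) (l1_nonneg _)
  have h1 : osc (x k) + l1 (r k) ≤ (1 + 1 / b) * (d k + b * e k) := by
    have h11 : (1 + 1 / b) * (d k + b * e k) = d k + e k + (1 / b * d k + b * e k) := by
      field_simp; ring
    have : 0 ≤ 1 / b * d k := mul_nonneg (by positivity) (hd0 k)
    have : 0 ≤ b * e k := mul_nonneg hb.le (he0 k)
    linarith [hd k, he k]
  have h2 : d k + b * e k ≤ (Λ * (1 + b) + B / (1 - lam)) * (lam ^ k * Y + F) := by
    have h21 := mul_le_mul_of_nonneg_left h0 hpow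
    have h22 : 0 ≤ Λ * (1 + b) * F := by positivity
    have h23 : 0 ≤ B / (1 - lam) * (lam ^ k * Y) := by positivity
    have h24 : B * F / (1 - lam) = B / (1 - lam) * F := by ring
    have hV' : d k + b * e k ≤ lam ^ k * (d 0 + b * e 0) + B * F / (1 - lam) := hV
    linarith
  have h3 : 0 ≤ lam ^ k * Y + F := by positivity
  calc osc (x k) + l1 (r k) ≤ (1 + 1 / b) * ((Λ * (1 + b) + B / (1 - lam)) * (lam ^ k * Y + F)) :=
        h1.trans (mul_le_mul_of_nonneg_left h2 hb1.le)
    _ ≤ c * (lam ^ k * Y + F) := by rw [hc]; linarith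

end Phase

/-! ### Weights of the phases without and with arrivals -/

section Weights

variable {V : Type u}

lemma share_pos (G : Digraph V) (i : V) : 0 < share G i := by unfold share; positivity

lemma share_le_one (G : Digraph V) (i : V) : share G i ≤ 1 := by
  unfold share
  rw [div_le_one (by positivity)]
  exact le_add_of_nonneg_right (Nat.cast_nonneg _)

/-- A vector on `V`, extended by the value `v` at an additional node. -/
def ext (v : ℝ) (x : V → ℝ) : Option V → ℝ := fun a => a.elim v x

@[simp] lemma ext_none (v : ℝ) (x : V → ℝ) : ext v x none = v := rfl
@[simp] lemma ext_some (v : ℝ) (x : V → ℝ) (j : V) : ext v x (some j) = x j := rfl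

variable [Fintype V]

/-- The surplus, extended by its negative total at an additional node: a sink that balances what is
withheld on the link. -/
def balanced (s : V → ℝ) : Option V → ℝ := ext (-∑ j, s j) s

lemma sum_balanced (s : V → ℝ) : ∑ a, balanced s a = 0 := by
  simp [balanced, Fintype.sum_option]

lemma balanced_add (s s' : V → ℝ) : balanced (s + s') = balanced s + balanced s' := by
  ext (_ | j)
  · simp [balanced, Finset.sum_add_distrib]; ring
  · simp [balanced]

lemma l1_le_l1_balanced (s : V → ℝ) : l1 s ≤ l1 (balanced s) := by
  simp [l1, balanced, Fintype.sum_option]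

lemma l1_balanced_le (s : V → ℝ) : l1 (balanced s) ≤ 2 * l1 s := by
  have := abs_sum_le_l1 s
  simp only [l1, balanced, Fintype.sum_option, ext_none, ext_some, abs_neg] at this ⊢
  linarith

variable (G : Digraph V) (p q : V)

open Classical in
/-- The pull weights while no packet arrives over the link `p → q`. -/
noncomputable def withheldPull : Matrix V V ℝ :=
  Matrix.of fun j i => if i ∈ nbrs G p q j then 1 / ((nbrs G p q j).card : ℝ) else 0

open Classical in
/-- The pull weights while exactly one packet arrives over the link `p → q` at each step. The
additional node is the source of the value that arrives. -/
noncomputable def pinnedPull : Matrix (Option V) (Option V) ℝ :=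
  Matrix.of fun a b => match a, b with
    | none, b => if b = none then 1 else 0
    | some j, some i =>
      if i ∈ nbrs G p q j then 1 / ((nbrs G p q j).card + if j = q then 1 else 0 : ℝ) else 0
    | some j, none => if j = q then 1 / ((nbrs G p q j).card + 1 : ℝ) else 0

open Classical in
/-- The push weights; what `p` sends over the link `p → q` goes to the additional node. -/
noncomputable def withheldPush : Matrix (Option V) (Option V) ℝ :=
  Matrix.of fun a b => match a, b with
    | a, none => if a = none then 1 else 0
    | some j, some i => if i ∈ nbrs G p q j then share G i else 0
    | none, some i => if i = p then share G p else 0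

variable {G p q}

lemma withheldPush_some_some (j i : V) [Decidable (i ∈ nbrs G p q j)] :
    withheldPush G p q (some j) (some i) = if i ∈ nbrs G p q j then share G i else 0 := by
  simp only [withheldPush, Matrix.of_apply]
  congr

lemma withheldPush_none_some (i : V) [Decidable (i = p)] :
    withheldPush G p q none (some i) = if i = p then share G p else 0 := by
  simp only [withheldPush, Matrix.of_apply]
  congr

lemma self_mem_nbrs (j : V) : j ∈ nbrs G p q j := by simp [mem_nbrs]

lemma card_nbrs_pos (j : V) : 0 < ((nbrs G p q j).card : ℝ) := by
  exact_mod_cast Finset.card_pos.2 ⟨j, self_mem_nbrs j⟩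

lemma card_nbrs_le (j : V) : ((nbrs G p q j).card : ℝ) ≤ Fintype.card V := by
  exact_mod_cast Finset.card_le_univ _

lemma le_share (i : V) : 1 / ((Fintype.card V : ℝ) + 1) ≤ share G i := by
  unfold share
  have h1 : outDegree G i ≤ Fintype.card V := by
    rw [← Nat.card_eq_fintype_card]; exact Set.ncard_le_card _
  have : (outDegree G i : ℝ) ≤ Fintype.card V := by exact_mod_cast h1
  exact one_div_le_one_div_of_le (by positivity) (by linarith)

variable [DecidableEq V]

lemma withheldPull_mem : withheldPull G p q ∈ rowStochastic ℝ V := by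
  rw [mem_rowStochastic_iff_sum]
  constructor
  · intro j i
    simp only [withheldPull, Matrix.of_apply]
    split_ifs <;> positivity
  · intro j
    simp only [withheldPull, Matrix.of_apply, Finset.sum_ite_mem, Finset.univ_inter,
      Finset.sum_const, nsmul_eq_mul]
    have := card_nbrs_pos (G := G) (p := p) (q := q) j
    field_simp

lemma pinnedPull_mem : pinnedPull G p q ∈ rowStochastic ℝ (Option V) := by
  rw [mem_rowStochastic_iff_sum]
  constructor
  · rintro (_ | j) (_ | i) <;> simp only [pinnedPull, Matrix.of_apply] <;> split_ifs <;> positivity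
  · rintro (_ | j)
    · simp [pinnedPull]
    · have := card_nbrs_pos (G := G) (p := p) (q := q) j
      simp only [pinnedPull, Matrix.of_apply, Fintype.sum_option, Finset.sum_ite_mem,
        Finset.univ_inter, Finset.sum_const, nsmul_eq_mul]
      split_ifs <;> field_simp <;> ring

lemma withheldPush_mem (hpq : IsLink G p q) : withheldPush G p q ∈ colStochastic ℝ (Option V) := by
  classical
  rw [mem_colStochastic_iff_sum]
  constructor
  · rintro (_ | j) (_ | i) <;> simp only [withheldPush, Matrix.of_apply] <;> split_ifs <;>
      first | exact (share_pos _ _).le | positivity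
  · rintro (_ | i)
    · simp [withheldPush]
    · simp only [Fintype.sum_option, withheldPush_some_some, withheldPush_none_some]
      rw [← Finset.sum_filter, Finset.sum_const, nsmul_eq_mul]
      have h0 : {j : V | i = j ∨ IsLink G i j}.ncard = 1 + outDegree G i := by
        have : {j : V | i = j ∨ IsLink G i j} = insert i {l : V | IsLink G i l} := by
          ext j; simp [eq_comm]
        rw [this, Set.ncard_insert_of_notMem (fun h => h.1 rfl) (Set.toFinite _), add_comm]
        rfl
      have h1 : (Finset.univ.filter fun j => i ∈ nbrs G p q j).card + (if i = p then 1 else 0)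
          = 1 + outDegree G i := by
        rw [← h0]
        by_cases hi : i = p
        · subst hi
          rw [if_pos rfl, ← Finset.card_insert_of_notMem (a := q), ← Set.ncard_coe_finset]
          · congr 1
            ext j
            simp only [mem_nbrs, Finset.mem_univ, true_and, Finset.coe_insert,
              Finset.coe_filter, Set.mem_insert_iff, Set.mem_ofPred_eq]
            by_cases hj : j = q
            · subst hj; simp [hpq]
            · simp [hj]
          · simp [mem_nbrs, hpq.1]
        · rw [if_neg hi, add_zero, ← Set.ncard_coe_finset]
          congr 1
          ext j
          simp [mem_nbrs, hi]
      have h2 : ((Finset.univ.filter fun j => i ∈ nbrs G p q j).card : ℝ) +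
          (if i = p then 1 else 0) = 1 + outDegree G i := by
        exact_mod_cast h1
      have h3 : (if i = p then share G p else 0) = (if i = p then 1 else 0) * share G i := by
        split_ifs with h
        · rw [h, one_mul]
        · simp
      rw [h3, ← add_mul, add_comm, h2, share]
      field_simp

/-- `q` still influences all agents if the link `p → q` is ignored: a path from `q` need not return
to `q`. -/
lemma reflTransGen_nbrs_from (hG : StronglyConnected G) (j : V) :
    Relation.ReflTransGen (fun a b => b ∈ nbrs G p q a) j q := by
  induction hG q j with
  | refl => exact .refl
  | @tail b c _ hbc ih =>
    by_cases hc : c = q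
    · exact hc ▸ .refl
    · refine .head (b := b) ?_ ih
      by_cases h : b = c
      · simp [mem_nbrs, h]
      · simp [mem_nbrs, hc, IsLink, h, hbc]

/-- Surplus of each agent still reaches `p` if the link `p → q` is ignored: a path to `p` need not
leave `p`. -/
lemma reflTransGen_nbrs_to (hG : StronglyConnected G) (i : V) :
    Relation.ReflTransGen (fun a b => b ∈ nbrs G p q a) p i := by
  induction hG i p using Relation.ReflTransGen.head_induction_on with
  | refl => exact .refl
  | @head b c hbc _ ih =>
    by_cases hb : b = p
    · exact hb ▸ .refl
    · refine .tail ih ?_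
      by_cases h : b = c
      · simp [mem_nbrs, h]
      · simp [mem_nbrs, hb, IsLink, h, hbc]

lemma withheldPull_window (hG : StronglyConnected G) : ∃ L, 0 < L ∧ ∃ η, 0 < η ∧
    ∀ k a, η ≤ evol (fun _ => withheldPull G p q) k L a q := by
  have hβ : ∀ a c, c ∈ nbrs G p q a →
      1 / ((Fintype.card V : ℝ) + 1) ≤ withheldPull G p q a c := by
    intro a c h
    simp only [withheldPull, Matrix.of_apply, if_pos h]
    exact one_div_le_one_div_of_le (card_nbrs_pos a) (by linarith [card_nbrs_le (G := G) (p := p) (q := q) a])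
  obtain ⟨L, hL, η, hη, h⟩ := exists_window (P := withheldPull G p q)
    (fun a b => nonneg_of_mem_rowStochastic withheldPull_mem)
    (show 0 < 1 / ((Fintype.card V : ℝ) + 1) by positivity) (fun a b => b ∈ nbrs G p q a) hβ
    (fun a => hβ a a (self_mem_nbrs a))
  exact ⟨L, hL, η, hη, fun k a => h a q (reflTransGen_nbrs_from hG a) k⟩

lemma pinnedPull_window (hG : StronglyConnected G) : ∃ L, 0 < L ∧ ∃ η, 0 < η ∧
    ∀ k a, η ≤ evol (fun _ => pinnedPull G p q) k L a none := by
  have h01 : 1 / ((Fintype.card V : ℝ) + 1) ≤ 1 := by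
    rw [div_le_one (by positivity)]; linarith [Nat.cast_nonneg (α := ℝ) (Fintype.card V)]
  let r : Option V → Option V → Prop := fun a b => match a, b with
    | some j, some i => i ∈ nbrs G p q j
    | some j, none => j = q
    | none, _ => False
  have hsome : ∀ j i, i ∈ nbrs G p q j →
      1 / ((Fintype.card V : ℝ) + 1) ≤ pinnedPull G p q (some j) (some i) := by
    intro j i h
    simp only [pinnedPull, Matrix.of_apply, if_pos h]
    have := card_nbrs_le (G := G) (p := p) (q := q) j
    have := card_nbrs_pos (G := G) (p := p) (q := q) j
    refine one_div_le_one_div_of_le (by positivity) ?_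
    split_ifs <;> linarith
  have hβ : ∀ a c, r a c → 1 / ((Fintype.card V : ℝ) + 1) ≤ pinnedPull G p q a c := by
    rintro (_ | j) (_ | i) h
    · exact h.elim
    · exact h.elim
    · obtain rfl : j = q := h
      simp only [pinnedPull, Matrix.of_apply, if_true]
      exact one_div_le_one_div_of_le (by positivity)
        (by linarith [card_nbrs_le (G := G) (p := p) (q := j) j])
    · exact hsome j i h
  obtain ⟨L, hL, η, hη, h⟩ := exists_window (P := pinnedPull G p q)
    (fun a b => nonneg_of_mem_rowStochastic pinnedPull_mem)
    (show 0 < 1 / ((Fintype.card V : ℝ) + 1) by positivity) r hβ (by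
      rintro (_ | a)
      · simpa [pinnedPull] using h01
      · exact hsome a a (self_mem_nbrs a))
  refine ⟨L, hL, η, hη, fun k a => h a none ?_ k⟩
  rcases a with _ | j
  · exact .refl
  · exact .tail ((reflTransGen_nbrs_from hG j).lift some fun _ _ h => h) rfl

lemma withheldPush_window (hpq : IsLink G p q) (hG : StronglyConnected G) :
    ∃ L, 0 < L ∧ ∃ η, 0 < η ∧ ∀ k b, η ≤ evol (fun _ => withheldPush G p q) k L none b := by
  have h01 : 1 / ((Fintype.card V : ℝ) + 1) ≤ 1 := by
    rw [div_le_one (by positivity)]; linarith [Nat.cast_nonneg (α := ℝ) (Fintype.card V)]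
  let r : Option V → Option V → Prop := fun a b => match a, b with
    | some j, some i => i ∈ nbrs G p q j
    | none, some i => i = p
    | _, none => False
  have hsome : ∀ j i, i ∈ nbrs G p q j →
      1 / ((Fintype.card V : ℝ) + 1) ≤ withheldPush G p q (some j) (some i) := by
    intro j i h
    simp only [withheldPush, Matrix.of_apply, if_pos h]
    exact le_share i
  have hβ : ∀ a c, r a c → 1 / ((Fintype.card V : ℝ) + 1) ≤ withheldPush G p q a c := by
    rintro (_ | j) (_ | i) h
    · exact h.elim
    · obtain rfl : i = p := h
      simp only [withheldPush, Matrix.of_apply, if_true]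
      exact le_share i
    · exact h.elim
    · exact hsome j i h
  obtain ⟨L, hL, η, hη, h⟩ := exists_window (P := withheldPush G p q)
    (mem_colStochastic_iff_sum.1 (withheldPush_mem hpq)).1
    (show 0 < 1 / ((Fintype.card V : ℝ) + 1) by positivity) r hβ (by
      rintro (_ | a)
      · simpa [withheldPush] using h01
      · exact hsome a a (self_mem_nbrs a))
  refine ⟨L, hL, η, hη, fun k a => h none a ?_ k⟩
  rcases a with _ | j
  · exact .refl
  · exact .head (b := some p) rfl ((reflTransGen_nbrs_to hG j).lift some fun _ _ h => h)

end Weights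

/-! ### Phases of the iteration with delays on one link -/

section LinkPhases

variable {V : Type u}

lemma osc_ext_le {v : ℝ} {x : V → ℝ} {c : ℝ} (hc : 0 ≤ c) (h : ∀ j, |x j - v| ≤ c) :
    osc (ext v x) ≤ 2 * c := by
  refine osc_le (by linarith) ?_
  rintro (_ | i) (_ | j)
  · simpa using hc
  · rw [abs_sub_comm]; exact (h j).trans (by linarith)
  · exact (h i).trans (by linarith)
  · have h1 : x i - x j = (x i - v) - (x j - v) := by ring
    change |x i - x j| ≤ _
    rw [h1]
    exact (abs_sub _ _).trans (by linarith [h i, h j])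

variable [Fintype V] {G : Digraph V} {p q : V} {γ : ℝ}

lemma abs_sub_le_osc_ext (v : ℝ) (x : V → ℝ) (j : V) : |x j - v| ≤ osc (ext v x) :=
  abs_sub_le_osc (ext v x) (some j) none

lemma osc_le_osc_ext (v : ℝ) (x : V → ℝ) : osc x ≤ osc (ext v x) :=
  osc_le (osc_nonneg _) fun i j => abs_sub_le_osc (ext v x) (some i) (some j)

/-- The distance of a state from the rest state in which all agents have the value `v`. -/
noncomputable def deviation (v : ℝ) (x s : V → ℝ) : ℝ := osc (ext v x) + l1 (balanced s)

/-- The distance of a state from the rest states. -/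
noncomputable def unrest (x s : V → ℝ) : ℝ := osc x + l1 (balanced s)

lemma unrest_nonneg (x s : V → ℝ) : 0 ≤ unrest x s := add_nonneg (osc_nonneg _) (l1_nonneg _)

lemma deviation_nonneg (v : ℝ) (x s : V → ℝ) : 0 ≤ deviation v x s :=
  add_nonneg (osc_nonneg _) (l1_nonneg _)

lemma unrest_le_deviation (v : ℝ) (x s : V → ℝ) : unrest x s ≤ deviation v x s :=
  add_le_add (osc_le_osc_ext v x) le_rfl

lemma abs_sub_le_deviation (v : ℝ) (x s : V → ℝ) (j : V) : |x j - v| ≤ deviation v x s :=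
  (abs_sub_le_osc_ext v x j).trans (le_add_of_nonneg_right (l1_nonneg _))

lemma l1_le_unrest (x s : V → ℝ) : l1 s ≤ unrest x s :=
  (l1_le_l1_balanced s).trans (le_add_of_nonneg_left (osc_nonneg _))

variable (G p q) in
/-- The surplus that arrives at each agent in a step, without the link `p → q`. -/
noncomputable def pushed (s : V → ℝ) (j : V) : ℝ := ∑ i ∈ nbrs G p q j, share G i * s i

variable (G p q γ) in
/-- A step of the iteration in which no packet arrives over the link `p → q`. -/
def WithheldStep (x s x' s' : V → ℝ) : Prop :=
  x' = withheldPull G p q *ᵥ x + γ • s ∧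
    s' = pushed G p q s + (x - withheldPull G p q *ᵥ x - γ • s)

lemma pushed_sub (s s' : V → ℝ) : pushed G p q (s - s') = pushed G p q s - pushed G p q s' := by
  ext j; simp [pushed, mul_sub]

lemma WithheldStep.sub {x s x' s' y u y' u' : V → ℝ} (h : WithheldStep G p q γ x s x' s')
    (h' : WithheldStep G p q γ y u y' u') :
    WithheldStep G p q γ (x - y) (s - u) (x' - y') (s' - u') := by
  obtain ⟨h1, h2⟩ := h
  obtain ⟨h3, h4⟩ := h'
  refine ⟨?_, ?_⟩
  · rw [h1, h3, Matrix.mulVec_sub, smul_sub]; abel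
  · rw [h2, h4, Matrix.mulVec_sub, smul_sub, pushed_sub]; abel

lemma linkMean_empty (x : ℕ → V → ℝ) (k : ℕ) (j : V) :
    linkMean G p q ∅ x k j = (withheldPull G p q *ᵥ x k) j := by
  simp [linkMean, withheldPull, mulVec, dotProduct, ite_mul, Finset.sum_ite_mem, Finset.mul_sum,
    div_eq_inv_mul]

lemma linkMean_singleton (t : ℕ) (x : ℕ → V → ℝ) (v : ℝ) (k : ℕ) (j : V) :
    ∃ w, linkMean G p q {t} x k j = (pinnedPull G p q *ᵥ ext v (x k)) (some j) + w ∧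
      |w| ≤ |x t p - v| := by
  classical
  have hpos := card_nbrs_pos (G := G) (p := p) (q := q) j
  refine ⟨if j = q then (x t p - v) / ((nbrs G p q j).card + 1) else 0, ?_, ?_⟩
  · have h1 : (pinnedPull G p q *ᵥ ext v (x k)) (some j) =
        (if j = q then 1 / ((nbrs G p q j).card + 1 : ℝ) else 0) * v +
        ∑ i ∈ nbrs G p q j, 1 / ((nbrs G p q j).card + if j = q then 1 else 0 : ℝ) * x k i := by
      simp [pinnedPull, mulVec, dotProduct, Fintype.sum_option, ite_mul, Finset.sum_ite_mem]
    rw [h1, ← Finset.mul_sum, linkMean]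
    by_cases h : j = q
    · simp only [h, if_true, Finset.sum_singleton, Finset.card_singleton, Nat.cast_one]
      rw [h] at hpos
      field_simp
      ring
    · simp only [h, if_false, add_zero, zero_mul, zero_add]
      field_simp
  · split_ifs
    · rw [abs_div, abs_of_pos (show (0 : ℝ) < (nbrs G p q j).card + 1 by linarith)]
      exact div_le_self (abs_nonneg _) (by linarith)
    · simp

lemma abs_linkMean_sub_le {A : Finset ℕ} {x : ℕ → V → ℝ} {v c : ℝ} {k : ℕ}
    (h : ∀ i, |x k i - v| ≤ c) (hA : ∀ t ∈ A, |x t p - v| ≤ c) (j : V) :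
    |linkMean G p q A x k j - v| ≤ c := by
  classical
  have hpos := card_nbrs_pos (G := G) (p := p) (q := q) j
  have hden : 0 < ((nbrs G p q j).card + if j = q then (A.card : ℝ) else 0 : ℝ) := by
    split_ifs <;> positivity
  unfold linkMean
  rw [div_sub' hden.ne', abs_div, abs_of_pos hden, div_le_iff₀ hden]
  have h1 : ∑ i ∈ nbrs G p q j, x k i + (if j = q then ∑ t ∈ A, x t p else 0) -
      ((nbrs G p q j).card + if j = q then (A.card : ℝ) else 0) * v =
      ∑ i ∈ nbrs G p q j, (x k i - v) + if j = q then ∑ t ∈ A, (x t p - v) else 0 := by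
    split_ifs
    · simp only [Finset.sum_sub_distrib, Finset.sum_const, nsmul_eq_mul]; ring
    · simp only [Finset.sum_sub_distrib, Finset.sum_const, nsmul_eq_mul]; ring
  rw [h1]
  refine (abs_add_le _ _).trans ?_
  rw [mul_add]
  refine add_le_add ?_ ?_
  · rw [mul_comm, ← nsmul_eq_mul]
    exact (Finset.abs_sum_le_sum_abs _ _).trans (Finset.sum_le_card_nsmul _ _ _ fun i _ => h i)
  · split_ifs
    · rw [mul_comm, ← nsmul_eq_mul]
      exact (Finset.abs_sum_le_sum_abs _ _).trans (Finset.sum_le_card_nsmul _ _ _ hA)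
    · simp

lemma LinkRun.withheldStep {A : ℕ → Finset ℕ} {x s : ℕ → V → ℝ} (h : LinkRun G p q γ A x s) {k : ℕ}
    (hk : A k = ∅) : WithheldStep G p q γ (x k) (s k) (x (k + 1)) (s (k + 1)) := by
  constructor
  · ext j
    rw [h.state_step, hk, linkMean_empty]
    rfl
  · ext j
    rw [h.surplus_step, hk, linkMean_empty]
    simp only [Finset.sum_empty, ite_self, add_zero, pushed, Pi.add_apply, Pi.sub_apply,
      Pi.smul_apply, smul_eq_mul]
    ring

variable [DecidableEq V]

lemma withheldPush_mulVec (hpq : IsLink G p q) (s : V → ℝ) :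
    withheldPush G p q *ᵥ balanced s = balanced (pushed G p q s) := by
  classical
  have hsome : ∀ j, (withheldPush G p q *ᵥ balanced s) (some j) = pushed G p q s j := by
    intro j
    simp [mulVec, dotProduct, Fintype.sum_option, pushed, balanced,
      Finset.sum_ite_mem, withheldPush]
  have h := sum_mulVec (withheldPush_mem hpq) (balanced s)
  rw [sum_balanced, Fintype.sum_option] at h
  simp only [hsome] at h
  ext (_ | j)
  · simp only [balanced, ext_none]
    exact eq_neg_of_add_eq_zero_left h
  · rw [hsome]; rfl

lemma l1_balanced_sub_le (hpq : IsLink G p q) {s s' g : V → ℝ} (h : s' = pushed G p q s + g) :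
    l1 (balanced s' - withheldPush G p q *ᵥ balanced s) ≤ 2 * l1 g := by
  rw [withheldPush_mulVec hpq, h, balanced_add, add_sub_cancel_left]
  exact l1_balanced_le g

/-- The surplus created in a step is controlled by the differences of the states, the surplus turned
into state, and the arriving surplus. -/
lemma LinkRun.surplus_step' (hγ : 0 ≤ γ) {A : ℕ → Finset ℕ} {x s : ℕ → V → ℝ}
    (h : LinkRun G p q γ A x s) {k : ℕ} {c : ℝ}
    (hc : ∀ j, |x k j - linkMean G p q (A k) x k j| ≤ c) :
    ∃ g, s (k + 1) = pushed G p q (s k) + g ∧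
      l1 g ≤ Fintype.card V * c + γ * l1 (s k) + ∑ t ∈ A k, |s t p| := by
  classical
  refine ⟨fun j => x k j - linkMean G p q (A k) x k j - γ * s k j +
    if j = q then ∑ t ∈ A k, share G p * s t p else 0, ?_, ?_⟩
  · ext j
    rw [h.surplus_step]
    simp only [pushed, Pi.add_apply]
    ring_nf
  · have h1 : ∀ j, |x k j - linkMean G p q (A k) x k j - γ * s k j +
        if j = q then ∑ t ∈ A k, share G p * s t p else 0| ≤
        c + γ * |s k j| + if j = q then ∑ t ∈ A k, |s t p| else 0 := by
      intro j
      refine (abs_add_le _ _).trans (add_le_add ((abs_sub _ _).trans (add_le_add (hc j) ?_)) ?_)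
      · rw [abs_mul, abs_of_nonneg hγ]
      · split_ifs
        · refine (Finset.abs_sum_le_sum_abs _ _).trans (Finset.sum_le_sum fun t _ => ?_)
          rw [abs_mul, abs_of_pos (share_pos G p)]
          exact mul_le_of_le_one_left (abs_nonneg _) (share_le_one G p)
        · simp
    refine (Finset.sum_le_sum fun j _ => h1 j).trans ?_
    simp [Finset.sum_add_distrib, l1, Finset.mul_sum]

variable (G p q γ) in
/-- Exponential estimates for the two kinds of phases, with constants `c` and rate `lam`. While
packets are withheld, the iteration approaches some rest state. While the packets that arrive, one at
each step, have values close to `v` and small surplus, it approaches the rest state `v`. -/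
structure PhaseBounds (c lam : ℝ) : Prop where
  withheld : ∀ (x s : ℕ → V → ℝ) (N : ℕ),
    (∀ k < N, WithheldStep G p q γ (x k) (s k) (x (k + 1)) (s (k + 1))) → ∀ k ≤ N,
      unrest (x k) (s k) ≤ c * (lam ^ k * unrest (x 0) (s 0)) ∧
      (∀ j, |x k j - x 0 q| ≤ c * unrest (x 0) (s 0)) ∧
      ∑ i ∈ range k, l1 (s i) ≤ c * unrest (x 0) (s 0)
  pinned : ∀ (A : ℕ → Finset ℕ) (x s : ℕ → V → ℝ), LinkRun G p q γ A x s →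
    ∀ (a N : ℕ) (v F : ℝ), 0 ≤ F →
      (∀ k < N, ∃ t, A (a + k) = {t} ∧ |x t p - v| ≤ F ∧ |s t p| ≤ F) → ∀ k ≤ N,
        deviation v (x (a + k)) (s (a + k)) ≤ c * (lam ^ k * deviation v (x a) (s a) + F)

lemma geom_sum_le {lam : ℝ} (h0 : 0 ≤ lam) (h1 : lam < 1) (k : ℕ) :
    ∑ i ∈ range k, lam ^ i ≤ 1 / (1 - lam) := by
  rw [le_div_iff₀ (by linarith), geom_sum_mul_neg]
  linarith [pow_nonneg h0 k]

lemma exists_withheld_bounds (hpq : IsLink G p q) (hG : StronglyConnected G) :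
    ∃ γ₀ > 0, ∃ c ≥ 1, ∃ lam, 0 < lam ∧ lam < 1 ∧ ∀ γ, 0 < γ → γ < γ₀ → γ ≤ 1 →
    ∀ (x s : ℕ → V → ℝ) (N : ℕ),
    (∀ k < N, WithheldStep G p q γ (x k) (s k) (x (k + 1)) (s (k + 1))) → ∀ k ≤ N,
      unrest (x k) (s k) ≤ c * (lam ^ k * unrest (x 0) (s 0)) ∧
      (∀ j, |x k j - x 0 q| ≤ c * unrest (x 0) (s 0)) ∧
      ∑ i ∈ range k, l1 (s i) ≤ c * unrest (x 0) (s 0) := by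
  obtain ⟨L, hL, η, hη, hR⟩ := withheldPull_window (p := p) (q := q) hG
  obtain ⟨L', hL', η', hη', hC⟩ := withheldPush_window hpq hG
  obtain ⟨γ₀, hγ₀, c, hc, lam, hlam0, hlam1, hph⟩ := exists_phase withheldPull_mem
    (withheldPush_mem hpq) hL hη hR hL' hη' hC (K := 2 * Fintype.card V + 2) (by positivity)
  have h1lam : 0 < 1 - lam := by linarith
  have hc0 : 0 ≤ c := by linarith
  refine ⟨γ₀, hγ₀, c + c / (1 - lam), ?_, lam, hlam0, hlam1, ?_⟩
  · have : 0 ≤ c / (1 - lam) := by positivity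
    linarith
  intro γ hγ hγ' hγ1 x s N hstep
  have hdec : ∀ k ≤ N, unrest (x k) (s k) ≤ c * (lam ^ k * unrest (x 0) (s 0)) := by
    have h := hph γ hγ hγ' N 0 le_rfl x (fun k => balanced (s k)) (fun k => sum_balanced _) ?_ ?_
    · intro k hk
      have h' := h k hk
      rwa [add_zero] at h'
    · intro k hk
      rw [(hstep k hk).1, add_sub_cancel_left, add_zero]
      have h1 : ∀ j, |(γ • s k) j| ≤ γ * l1 (balanced (s k)) := by
        intro j
        rw [Pi.smul_apply, smul_eq_mul, abs_mul, abs_of_pos hγ]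
        exact mul_le_mul_of_nonneg_left ((abs_le_l1 _ j).trans (l1_le_l1_balanced _)) hγ.le
      have h2 : 0 ≤ γ * l1 (balanced (s k)) := mul_nonneg hγ.le (l1_nonneg _)
      refine (osc_le_two_mul h1 h2).trans (mul_le_mul_of_nonneg_right ?_ h2)
      linarith [Nat.cast_nonneg (α := ℝ) (Fintype.card V)]
    · intro k hk
      refine (l1_balanced_sub_le hpq (hstep k hk).2).trans ?_
      have h1 : l1 (x k - withheldPull G p q *ᵥ x k) ≤ Fintype.card V * osc (x k) := by
        rw [← nsmul_eq_mul, ← Finset.card_univ]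
        exact Finset.sum_le_card_nsmul _ _ _ fun j _ =>
          abs_sub_mulVec_le withheldPull_mem (x k) j j
      have h2 : l1 (x k - withheldPull G p q *ᵥ x k - γ • s k) ≤
          Fintype.card V * osc (x k) + γ * l1 (s k) := by
        have h3 := l1_add (x k - withheldPull G p q *ᵥ x k) ((-γ) • s k)
        rw [l1_smul, abs_neg, abs_of_pos hγ, neg_smul, ← sub_eq_add_neg] at h3
        linarith
      have h3 := mul_le_mul_of_nonneg_left (l1_le_l1_balanced (s k)) hγ.le
      have h4 : 0 ≤ γ * l1 (balanced (s k)) := mul_nonneg hγ.le (l1_nonneg _)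
      have h5 := osc_nonneg (x k)
      have h6 : 0 ≤ (Fintype.card V : ℝ) * (γ * l1 (balanced (s k))) := by positivity
      linarith
  set Y := unrest (x 0) (s 0) with hY
  have hY0 : 0 ≤ Y := unrest_nonneg _ _
  have hsum : ∀ k ≤ N, ∑ i ∈ range k, unrest (x i) (s i) ≤ c / (1 - lam) * Y := by
    intro k hk
    calc ∑ i ∈ range k, unrest (x i) (s i) ≤ ∑ i ∈ range k, c * (lam ^ i * Y) :=
          Finset.sum_le_sum fun i hi => hdec i (by simp at hi; omega)
      _ = c * Y * ∑ i ∈ range k, lam ^ i := by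
          rw [Finset.mul_sum]; exact Finset.sum_congr rfl fun i _ => by ring
      _ ≤ c * Y * (1 / (1 - lam)) :=
          mul_le_mul_of_nonneg_left (geom_sum_le hlam0.le hlam1 k) (by positivity)
      _ = _ := by ring
  have hdrift : ∀ k ≤ N, |x k q - x 0 q| ≤ ∑ i ∈ range k, unrest (x i) (s i) := by
    intro k
    induction k with
    | zero => intro _; simp
    | succ k ih =>
      intro hk
      rw [Finset.sum_range_succ]
      have h1 : |x (k + 1) q - x k q| ≤ unrest (x k) (s k) := by
        rw [(hstep k (by omega)).1]
        have h2 : (withheldPull G p q *ᵥ x k + γ • s k) q - x k q =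
            -(x k q - (withheldPull G p q *ᵥ x k) q) + γ * s k q := by
          simp only [Pi.add_apply, Pi.smul_apply, smul_eq_mul]; ring
        rw [h2]
        refine (abs_add_le _ _).trans (add_le_add ?_ ?_)
        · rw [abs_neg]; exact abs_sub_mulVec_le withheldPull_mem _ _ _
        · rw [abs_mul, abs_of_pos hγ]
          exact (mul_le_of_le_one_left (abs_nonneg _) hγ1).trans
            ((abs_le_l1 _ q).trans (l1_le_l1_balanced _))
      have h3 : x (k + 1) q - x 0 q = (x k q - x 0 q) + (x (k + 1) q - x k q) := by ring
      rw [h3]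
      exact (abs_add_le _ _).trans (add_le_add (ih (by omega)) h1)
  have hcl : 0 ≤ c / (1 - lam) * Y := by positivity
  intro k hk
  have hpow : 0 ≤ lam ^ k := by positivity
  have hpow1 : lam ^ k ≤ 1 := pow_le_one₀ hlam0.le hlam1.le
  refine ⟨(hdec k hk).trans ?_, fun j => ?_, ?_⟩
  · refine mul_le_mul_of_nonneg_right ?_ (by positivity)
    have : 0 ≤ c / (1 - lam) := by positivity
    linarith
  · have h1 : x k j - x 0 q = (x k j - x k q) + (x k q - x 0 q) := by ring
    rw [h1, add_mul]
    refine (abs_add_le _ _).trans (add_le_add ?_ ((hdrift k hk).trans (hsum k hk)))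
    refine (abs_sub_le_osc _ _ _).trans (le_trans ?_ ((hdec k hk).trans ?_))
    · exact le_add_of_nonneg_right (l1_nonneg _)
    · exact mul_le_mul_of_nonneg_left (mul_le_of_le_one_left hY0 hpow1) hc0
  · have h1 : ∑ i ∈ range k, l1 (s i) ≤ c / (1 - lam) * Y :=
      (Finset.sum_le_sum fun i _ => l1_le_unrest (x i) (s i)).trans (hsum k hk)
    have h2 : 0 ≤ c * Y := by positivity
    linarith

lemma exists_pinned_bounds (hpq : IsLink G p q) (hG : StronglyConnected G) :
    ∃ γ₀ > 0, ∃ c ≥ 1, ∃ lam, 0 < lam ∧ lam < 1 ∧ ∀ γ, 0 < γ → γ < γ₀ →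
    ∀ (A : ℕ → Finset ℕ) (x s : ℕ → V → ℝ), LinkRun G p q γ A x s →
    ∀ (a N : ℕ) (v F : ℝ), 0 ≤ F →
      (∀ k < N, ∃ t, A (a + k) = {t} ∧ |x t p - v| ≤ F ∧ |s t p| ≤ F) → ∀ k ≤ N,
        deviation v (x (a + k)) (s (a + k)) ≤ c * (lam ^ k * deviation v (x a) (s a) + F) := by
  classical
  obtain ⟨L, hL, η, hη, hR⟩ := pinnedPull_window (p := p) (q := q) hG
  obtain ⟨L', hL', η', hη', hC⟩ := withheldPush_window hpq hG
  obtain ⟨γ₀, hγ₀, c, hc, lam, hlam0, hlam1, hph⟩ := exists_phase pinnedPull_mem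
    (withheldPush_mem hpq) hL hη hR hL' hη' hC (K := 2 * Fintype.card V + 2) (by positivity)
  refine ⟨γ₀, hγ₀, c, hc, lam, hlam0, hlam1, ?_⟩
  intro γ hγ hγ' A x s hrun a N v F hF hA
  have hcard : (0 : ℝ) ≤ Fintype.card V := Nat.cast_nonneg _
  refine hph γ hγ hγ' N F hF (fun k => ext v (x (a + k))) (fun k => balanced (s (a + k)))
    (fun k => sum_balanced _) ?_ ?_
  · intro k hk
    obtain ⟨t, ht, htv, hts⟩ := hA k hk
    have h2 : 0 ≤ γ * l1 (balanced (s (a + k))) := mul_nonneg hγ.le (l1_nonneg _)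
    have h1 : ∀ b, |(ext v (x (a + (k + 1))) - pinnedPull G p q *ᵥ ext v (x (a + k))) b| ≤
        γ * l1 (balanced (s (a + k))) + F := by
      rintro (_ | j)
      · have h3 : (pinnedPull G p q *ᵥ ext v (x (a + k))) none = v := by
          simp [pinnedPull, mulVec, dotProduct]
        rw [Pi.sub_apply, h3, ext_none, sub_self, abs_zero]
        linarith
      · obtain ⟨w, hw, hw'⟩ := linkMean_singleton (G := G) (q := q) t x v (a + k) j
        rw [Pi.sub_apply, ext_some, ← add_assoc, hrun.state_step, ht, hw]
        have h5 : |γ * s (a + k) j| ≤ γ * l1 (balanced (s (a + k))) := by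
          rw [abs_mul, abs_of_pos hγ]
          exact mul_le_mul_of_nonneg_left ((abs_le_l1 _ j).trans (l1_le_l1_balanced _)) hγ.le
        rw [add_assoc, add_sub_cancel_left]
        exact (abs_add_le _ _).trans (by linarith)
    refine (osc_le_two_mul h1 (by linarith)).trans (mul_le_mul_of_nonneg_right ?_ (by linarith))
    linarith
  · intro k hk
    obtain ⟨t, ht, htv, hts⟩ := hA k hk
    have h1 : ∀ j, |x (a + k) j - linkMean G p q (A (a + k)) x (a + k) j| ≤
        osc (ext v (x (a + k))) + F := by
      intro j
      obtain ⟨w, hw, hw'⟩ := linkMean_singleton (G := G) (q := q) t x v (a + k) j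
      rw [ht, hw]
      rw [← sub_sub]
      exact (abs_sub _ _).trans (add_le_add
        (abs_sub_mulVec_le pinnedPull_mem (ext v (x (a + k))) (some j) (some j)) (hw'.trans htv))
    obtain ⟨g, hg, hg'⟩ := hrun.surplus_step' hγ.le h1
    rw [ht, Finset.sum_singleton] at hg'
    change l1 (balanced (s (a + k + 1)) - _) ≤ _
    refine (l1_balanced_sub_le hpq hg).trans ?_
    have h3 := mul_le_mul_of_nonneg_left (l1_le_l1_balanced (s (a + k))) hγ.le
    have h4 : 0 ≤ γ * l1 (balanced (s (a + k))) := mul_nonneg hγ.le (l1_nonneg _)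
    have h5 := osc_nonneg (ext v (x (a + k)))
    have h6 : 0 ≤ (Fintype.card V : ℝ) * (γ * l1 (balanced (s (a + k)))) := by positivity
    linarith

lemma exists_phaseBounds (hpq : IsLink G p q) (hG : StronglyConnected G) :
    ∃ γ₀ > 0, ∃ c ≥ 1, ∃ lam, 0 < lam ∧ lam < 1 ∧ ∀ γ, 0 < γ → γ < γ₀ → γ ≤ 1 →
      PhaseBounds G p q γ c lam := by
  obtain ⟨γ₁, hγ₁, c₁, hc₁, l₁, hl₁, hl₁', h₁⟩ := exists_withheld_bounds hpq hG
  obtain ⟨γ₂, hγ₂, c₂, hc₂, l₂, hl₂, hl₂', h₂⟩ := exists_pinned_bounds hpq hG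
  refine ⟨min γ₁ γ₂, lt_min hγ₁ hγ₂, max c₁ c₂, le_max_of_le_left hc₁, max l₁ l₂,
    lt_max_of_lt_left hl₁, max_lt hl₁' hl₂', fun γ hγ hγ' hγ1 => ⟨?_, ?_⟩⟩
  · intro x s N hstep k hk
    obtain ⟨ha, hb, hc⟩ := h₁ γ hγ (hγ'.trans_le (min_le_left _ _)) hγ1 x s N hstep k hk
    have h0 := unrest_nonneg (x 0) (s 0)
    have hcc := mul_le_mul_of_nonneg_right (le_max_left c₁ c₂) h0
    refine ⟨ha.trans ?_, fun j => (hb j).trans hcc, hc.trans hcc⟩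
    gcongr <;> exact le_max_left _ _
  · intro A x s hrun a N v F hF hA k hk
    refine (h₂ γ hγ (hγ'.trans_le (min_le_right _ _)) A x s hrun a N v F hF hA k hk).trans ?_
    have h0 := deviation_nonneg v (x a) (s a)
    gcongr <;> exact le_max_right _ _

end LinkPhases

/-! ### One block of the adversarial schedule -/

section Block

variable {V : Type u} [Fintype V] [DecidableEq V] {G : Digraph V} {p q : V} {γ c lam : ℝ}

/-- The situation at the beginning `T` of a block in which the packets sent at the times in `A T`
arrive together, followed by one packet at each of the next `P` steps, and by `Q + P'` steps without
arrivals. The state and the single packets are `F`-close to the rest state `v`; about the other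
packets there is only the bound `D`. -/
structure BlockStart (p : V) (A : ℕ → Finset ℕ) (x s : ℕ → V → ℝ) (T P Q P' : ℕ) (v F D : ℝ) :
    Prop where
  dev : deviation v (x T) (s T) ≤ F
  dump_state : ∀ t ∈ A T, |x t p - v| ≤ D
  dump_surplus : ∑ t ∈ A T, |s t p| ≤ D
  single : ∀ k < P, ∃ t, A (T + 1 + k) = {t} ∧ |x t p - v| ≤ F ∧ |s t p| ≤ F
  none : ∀ k < Q + P', A (T + 1 + P + k) = ∅

/-- A bound for all gains in the estimates of a block. -/
noncomputable def blockConst (V : Type u) [Fintype V] (c lam : ℝ) : ℝ :=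
  10 * c ^ 3 * (4 * Fintype.card V + 8) / (1 - lam)

/-- After a block, the iteration is close to a new rest state. This state is close to the previous one
and the rest is far better than before if `P` and `Q` are large, although the packets in `A T` have
disturbed the iteration by an amount of size `D`. -/
lemma PhaseBounds.block (hpq : IsLink G p q) (h : PhaseBounds G p q γ c lam) (hc : 1 ≤ c)
    (hlam0 : 0 < lam) (hlam1 : lam < 1) (hγ : 0 ≤ γ) (hγ1 : γ ≤ 1) {A : ℕ → Finset ℕ}
    {x s : ℕ → V → ℝ} (hrun : LinkRun G p q γ A x s) {T P Q P' : ℕ} {v F D : ℝ} (hD : 0 ≤ D)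
    (hb : BlockStart p A x s T P Q P' v F D) :
    let v' := x (T + 1 + P + Q) q
    let C := blockConst V c lam
    let Z := lam ^ P * (D + F) + F
    |v' - v| ≤ C * Z ∧
      (∀ k ≤ P', deviation v' (x (T + 1 + P + Q + k)) (s (T + 1 + P + Q + k)) ≤
        C * (lam ^ Q * Z)) ∧
      (∀ k < 1 + P + Q, |x (T + k) p - v'| ≤ C * (D + F)) ∧
      ∑ k ∈ range (1 + P + Q), |s (T + k) p| ≤ C * (D + F + P * F) := by
  intro v' C Z
  have hF : 0 ≤ F := (deviation_nonneg _ _ _).trans hb.dev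
  have hn : (0 : ℝ) ≤ Fintype.card V := Nat.cast_nonneg _
  set n : ℝ := (Fintype.card V : ℝ) with hn'
  set C₁ : ℝ := 4 * n + 8 with hC₁
  have h1lam : 0 < 1 - lam := by linarith
  have hinv : 1 ≤ 1 / (1 - lam) := by rw [le_div_iff₀ h1lam]; linarith
  have hpowP : 0 ≤ lam ^ P := by positivity
  have hpowP1 : lam ^ P ≤ 1 := pow_le_one₀ hlam0.le hlam1.le
  have hDF : 0 ≤ D + F := by linarith
  have hZ0 : 0 ≤ Z := by positivity
  have hZ : Z ≤ 2 * (D + F) := by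
    have := mul_le_of_le_one_left hDF hpowP1
    simp only [Z]
    linarith
  have hc2 : c ≤ c ^ 2 := by nlinarith
  have hc3 : c ^ 2 ≤ c ^ 3 := by nlinarith [sq_nonneg c]
  have hc0 : 0 < c := by linarith
  have hCge : 10 * c ^ 3 * C₁ * (1 / (1 - lam)) = C := by
    simp only [C, blockConst, ← hn', hC₁]; ring
  have hCge1 : 10 * c ^ 3 * C₁ ≤ C := by
    rw [← hCge]; exact le_mul_of_one_le_right (by positivity) hinv
  have hx : ∀ j, |x T j - v| ≤ F := fun j => (abs_sub_le_deviation v (x T) (s T) j).trans hb.dev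
  have hs : l1 (balanced (s T)) ≤ F := (le_add_of_nonneg_left (osc_nonneg _)).trans hb.dev
  have hs' : l1 (s T) ≤ F := (l1_le_l1_balanced _).trans hs
  -- right after the arrival of the packets in `A T`: a mean does not depend on their number, and
  -- the surplus is bounded by their total
  have hmean : ∀ j, |linkMean G p q (A T) x T j - v| ≤ D + F :=
    abs_linkMean_sub_le (fun i => (hx i).trans (by linarith))
      (fun t ht => (hb.dump_state t ht).trans (by linarith))
  have h1 : deviation v (x (T + 1)) (s (T + 1)) ≤ C₁ * (D + F) := by
    have h11 : ∀ j, |x (T + 1) j - v| ≤ D + F + F := by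
      intro j
      rw [hrun.state_step, add_sub_right_comm]
      refine (abs_add_le _ _).trans (add_le_add (hmean j) ?_)
      rw [abs_mul, abs_of_nonneg hγ]
      exact (mul_le_of_le_one_left (abs_nonneg _) hγ1).trans ((abs_le_l1 _ j).trans hs')
    have h12 : ∀ j, |x T j - linkMean G p q (A T) x T j| ≤ F + (D + F) := by
      intro j
      have : x T j - linkMean G p q (A T) x T j =
        (x T j - v) - (linkMean G p q (A T) x T j - v) := by ring
      rw [this]
      exact (abs_sub _ _).trans (add_le_add (hx j) (hmean j))
    obtain ⟨g, hg, hg'⟩ := hrun.surplus_step' hγ h12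
    have h13 : l1 (balanced (s (T + 1))) ≤ F + 2 * l1 g := by
      have h14 := l1_add (withheldPush G p q *ᵥ balanced (s T))
        (balanced (s (T + 1)) - withheldPush G p q *ᵥ balanced (s T))
      rw [add_sub_cancel] at h14
      have h15 := l1_mulVec_le_self (withheldPush_mem hpq) (balanced (s T))
      linarith [l1_balanced_sub_le hpq hg]
    have h16 : γ * l1 (s T) ≤ F := (mul_le_of_le_one_left (l1_nonneg _) hγ1).trans hs'
    have h17 := osc_ext_le (by linarith) h11
    have h18 := hb.dump_surplus
    have h19 : n * (F + (D + F)) ≤ n * (2 * (D + F)) :=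
      mul_le_mul_of_nonneg_left (by linarith) hn
    unfold deviation
    rw [hC₁]
    linarith
  have h2 : ∀ k ≤ P, deviation v (x (T + 1 + k)) (s (T + 1 + k)) ≤
      c * (lam ^ k * (C₁ * (D + F)) + F) := by
    intro k hk
    refine (h.pinned A x s hrun (T + 1) P v F hF hb.single k hk).trans ?_
    gcongr
  -- from time `a` on, no packets arrive
  set a := T + 1 + P with ha
  have h3 : deviation v (x a) (s a) ≤ c * C₁ * Z := by
    refine (h2 P le_rfl).trans ?_
    rw [mul_assoc]
    refine mul_le_mul_of_nonneg_left ?_ hc0.le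
    have : F ≤ C₁ * F := le_mul_of_one_le_left hF (by linarith)
    simp only [Z]
    linarith
  have h4 : unrest (x a) (s a) ≤ c * C₁ * Z := (unrest_le_deviation v _ _).trans h3
  have hstep : ∀ k < Q + P', WithheldStep G p q γ (x (a + k)) (s (a + k))
      (x (a + (k + 1))) (s (a + (k + 1))) := fun k hk => hrun.withheldStep (hb.none k hk)
  have hw := h.withheld (fun k => x (a + k)) (fun k => s (a + k)) (Q + P') hstep
  simp only [add_zero] at hw
  have h5 : ∀ k ≤ Q, ∀ j, |x (a + k) j - x a q| ≤ c ^ 2 * C₁ * Z := by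
    intro k hk j
    refine ((hw k (by omega)).2.1 j).trans ?_
    calc c * unrest (x a) (s a) ≤ c * (c * C₁ * Z) := mul_le_mul_of_nonneg_left h4 hc0.le
      _ = _ := by ring
  have hC₁1 : 1 ≤ C₁ := by linarith
  have hcC : 0 ≤ C₁ * Z := by positivity
  have hcC' : 0 ≤ C₁ * (D + F) := by positivity
  have hcc1 : c * (C₁ * Z) ≤ c ^ 2 * (C₁ * Z) := mul_le_mul_of_nonneg_right hc2 hcC
  have hcc2 : c ^ 2 * (C₁ * Z) ≤ c ^ 3 * (C₁ * Z) := mul_le_mul_of_nonneg_right hc3 hcC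
  have hcc1' : c * (C₁ * (D + F)) ≤ c ^ 2 * (C₁ * (D + F)) := mul_le_mul_of_nonneg_right hc2 hcC'
  have hcc2' : c ^ 2 * (C₁ * (D + F)) ≤ c ^ 3 * (C₁ * (D + F)) :=
    mul_le_mul_of_nonneg_right hc3 hcC'
  have hZC : c ^ 2 * (C₁ * Z) ≤ c ^ 2 * (C₁ * (2 * (D + F))) := by gcongr
  have h6 : |v' - v| ≤ 2 * (c ^ 2 * (C₁ * Z)) := by
    have h61 : v' - v = (x (a + Q) q - x a q) + (x a q - v) := by simp only [v', ha]; ring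
    rw [h61]
    refine (abs_add_le _ _).trans ?_
    linarith [h5 Q le_rfl q, (abs_sub_le_deviation v (x a) (s a) q).trans h3]
  have hcube : 0 ≤ c ^ 3 * (C₁ * Z) := by positivity
  have hcube' : 0 ≤ c ^ 3 * (C₁ * (D + F)) := by positivity
  refine ⟨?_, ?_, ?_, ?_⟩
  · have := mul_le_mul_of_nonneg_right hCge1 hZ0
    linarith
  · intro k hk
    have h7 := h.withheld (fun k => x (a + Q + k)) (fun k => s (a + Q + k)) P' (fun k hk => by
      have := hstep (Q + k) (by omega)
      simpa only [← add_assoc] using this) k hk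
    simp only [add_zero] at h7
    set U := unrest (x (a + Q)) (s (a + Q)) with hU
    have hU0 : 0 ≤ U := unrest_nonneg _ _
    have h8 : U ≤ c ^ 2 * (C₁ * (lam ^ Q * Z)) := by
      refine (hw Q (by omega)).1.trans ?_
      calc c * (lam ^ Q * unrest (x a) (s a)) ≤ c * (lam ^ Q * (c * C₁ * Z)) := by gcongr
        _ = _ := by ring
    have h9 : osc (ext v' (x (a + Q + k))) ≤ 2 * (c * U) := osc_ext_le (by positivity) h7.2.1
    have h10 : l1 (balanced (s (a + Q + k))) ≤ c * U := by
      refine (le_add_of_nonneg_left (osc_nonneg (x (a + Q + k)))).trans (h7.1.trans ?_)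
      exact mul_le_mul_of_nonneg_left
        (mul_le_of_le_one_left hU0 (pow_le_one₀ hlam0.le hlam1.le)) hc0.le
    have h11 : c * U ≤ c ^ 3 * (C₁ * (lam ^ Q * Z)) := by
      calc c * U ≤ c * (c ^ 2 * (C₁ * (lam ^ Q * Z))) := mul_le_mul_of_nonneg_left h8 hc0.le
        _ = _ := by ring
    have h12 : 0 ≤ lam ^ Q * Z := by positivity
    have h13 := mul_le_mul_of_nonneg_right hCge1 h12
    have h14 : 0 ≤ c ^ 3 * (C₁ * (lam ^ Q * Z)) := by positivity
    unfold deviation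
    linarith
  · intro k hk
    have hgoal : 7 * (c ^ 3 * (C₁ * (D + F))) ≤ C * (D + F) := by
      have := mul_le_mul_of_nonneg_right hCge1 hDF
      linarith
    have h61 : ∀ y, |y - v'| ≤ |y - v| + |v' - v| := fun y => by
      have : y - v' = (y - v) - (v' - v) := by ring
      rw [this]; exact abs_sub _ _
    rcases Nat.lt_or_ge k 1 with hk0 | hk0
    · obtain rfl : k = 0 := by omega
      have h62 := h61 (x (T + 0) p)
      have h63 := hx p
      have h64 : F ≤ c ^ 3 * (C₁ * (D + F)) := by
        have h65 : 1 * (1 * (D + F)) ≤ c ^ 3 * (C₁ * (D + F)) := by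
          gcongr
          exact one_le_pow₀ hc
        linarith
      rw [add_zero] at h62 ⊢
      linarith
    rcases Nat.lt_or_ge k (1 + P) with hk1 | hk1
    · have h62 := h61 (x (T + k) p)
      have h63 : |x (T + k) p - v| ≤ 2 * (c * (C₁ * (D + F))) := by
        have h64 := (abs_sub_le_deviation v _ _ p).trans (h2 (k - 1) (by omega))
        rw [show T + 1 + (k - 1) = T + k by omega] at h64
        refine h64.trans ?_
        have h65 : lam ^ (k - 1) * (C₁ * (D + F)) ≤ C₁ * (D + F) :=
          mul_le_of_le_one_left hcC' (pow_le_one₀ hlam0.le hlam1.le)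
        have h66 : F ≤ C₁ * (D + F) := by
          have : 1 * (D + F) ≤ C₁ * (D + F) := by gcongr
          linarith
        have := mul_le_mul_of_nonneg_left (add_le_add h65 h66) hc0.le
        linarith
      linarith
    · have h62 : x (T + k) p - v' = (x (a + (k - (1 + P))) p - x a q) - (x (a + Q) q - x a q) := by
        rw [show a + (k - (1 + P)) = T + k by omega]
        simp only [v', ha]; ring
      rw [h62]
      refine (abs_sub _ _).trans ?_
      linarith [h5 (k - (1 + P)) (by omega) p, h5 Q le_rfl q]
  · have hsplit : ∑ k ∈ range (1 + P + Q), |s (T + k) p| = |s T p| +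
        ∑ k ∈ range P, |s (T + 1 + k) p| + ∑ k ∈ range Q, |s (a + k) p| := by
      rw [Finset.sum_range_add, Finset.sum_range_add, Finset.sum_range_one, add_zero]
      simp only [ha, ← add_assoc]
    have hs1 : |s T p| ≤ F := (abs_le_l1 _ p).trans hs'
    have hs2 : ∑ k ∈ range P, |s (T + 1 + k) p| ≤
        c * (C₁ * (D + F)) * (1 / (1 - lam)) + c * (P * F) := by
      calc ∑ k ∈ range P, |s (T + 1 + k) p|
          ≤ ∑ k ∈ range P, (c * (C₁ * (D + F)) * lam ^ k + c * F) := by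
            refine Finset.sum_le_sum fun k hk => ?_
            have hk' : k ≤ P := by simp at hk; omega
            refine (abs_le_l1 _ p).trans ((l1_le_unrest (x (T + 1 + k)) _).trans
              ((unrest_le_deviation v _ _).trans ((h2 k hk').trans (le_of_eq ?_))))
            ring
        _ = c * (C₁ * (D + F)) * ∑ k ∈ range P, lam ^ k + c * (P * F) := by
            rw [Finset.sum_add_distrib, ← Finset.mul_sum, Finset.sum_const, Finset.card_range,
              nsmul_eq_mul]
            ring
        _ ≤ _ := by
            have := mul_le_mul_of_nonneg_left (geom_sum_le hlam0.le hlam1 P)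
              (show 0 ≤ c * (C₁ * (D + F)) by positivity)
            linarith
    have hs3 : ∑ k ∈ range Q, |s (a + k) p| ≤ c ^ 2 * (C₁ * Z) := by
      refine (Finset.sum_le_sum fun k _ => abs_le_l1 _ p).trans
        ((hw Q (by omega)).2.2.trans ?_)
      calc c * unrest (x a) (s a) ≤ c * (c * C₁ * Z) := mul_le_mul_of_nonneg_left h4 hc0.le
        _ = _ := by ring
    rw [hsplit, ← hCge]
    set ω := 1 / (1 - lam) with hω
    set W := c ^ 3 * (C₁ * (D + F)) with hW
    have hP : (0 : ℝ) ≤ P := Nat.cast_nonneg _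
    have hPF : 0 ≤ P * F := by positivity
    have e1 : F ≤ W := by
      have h65 : 1 * (1 * (D + F)) ≤ c ^ 3 * (C₁ * (D + F)) := by
        gcongr
        exact one_le_pow₀ hc
      linarith
    have e2 : c * (C₁ * (D + F)) * ω ≤ W * ω :=
      mul_le_mul_of_nonneg_right (hcc1'.trans hcc2') (by linarith)
    have e3 : W ≤ W * ω := le_mul_of_one_le_right hcube' hinv
    have e4 : c * (P * F) ≤ 10 * c ^ 3 * C₁ * ω * (P * F) := by
      refine mul_le_mul_of_nonneg_right ?_ hPF
      have e5 : c * 1 ≤ 10 * c ^ 3 * C₁ * ω := by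
        refine mul_le_mul ?_ hinv zero_le_one (by positivity)
        have : c ^ 3 * 1 ≤ c ^ 3 * C₁ := by gcongr
        linarith [pow_pos hc0 3]
      linarith
    have e6 : 10 * c ^ 3 * C₁ * ω * (D + F + P * F) =
        10 * (W * ω) + 10 * c ^ 3 * C₁ * ω * (P * F) := by rw [hW]; ring
    rw [e6]
    linarith

/-- Two runs in the withheld phase whose initial difference is `α` times a unit of state at `q`,
compensated by a unit of negative surplus, keep a distance: the state spreads to all agents, while
the surplus is mostly lost into the link before it acts. -/
lemma PhaseBounds.separation (h : PhaseBounds G p q γ c lam) (hc : 1 ≤ c) (hγ : 0 ≤ γ) {L : ℕ}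
    {η : ℝ} (hη : ∀ k a, η ≤ evol (fun _ => withheldPull G p q) k L a q) (hγη : 8 * c * γ ≤ η)
    {α : ℝ} (hα : 0 ≤ α) {y u : ℕ → V → ℝ} {N : ℕ}
    (hstep : ∀ k < N, WithheldStep G p q γ (y k) (u k) (y (k + 1)) (u (k + 1)))
    (hy : y 0 = α • Pi.single q 1) (hu : u 0 = -(α • Pi.single q 1)) {k : ℕ} (hk : k ≤ N)
    (hLk : L ≤ k) : α * η / 2 ≤ y k q := by
  -- the difference of the states is at least what it would be without the surplus terms
  have hlow : ∀ k ≤ N, ∀ a, α * evol (fun _ => withheldPull G p q) 0 k a q -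
      γ * ∑ i ∈ range k, l1 (u i) ≤ y k a := by
    intro k
    induction k with
    | zero =>
      intro _ a
      rw [hy]
      by_cases ha : a = q
      · subst ha; simp
      · simp [ha]
    | succ k ih =>
      intro hk a
      rw [(hstep k (by omega)).1, Finset.sum_range_succ, evol_succ]
      have h1 : γ * u k a ≥ -(γ * l1 (u k)) := by
        have := mul_le_mul_of_nonneg_left ((neg_le_abs (u k a)).trans (abs_le_l1 (u k) a)) hγ
        linarith
      have hrow := mem_rowStochastic_iff_sum.1 (withheldPull_mem (G := G) (p := p) (q := q))
      have h2 : α * (withheldPull G p q * evol (fun _ => withheldPull G p q) 0 k) a q -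
          γ * ∑ i ∈ range k, l1 (u i) ≤ (withheldPull G p q *ᵥ y k) a := by
        have h3 : α * (withheldPull G p q * evol (fun _ => withheldPull G p q) 0 k) a q -
          γ * ∑ i ∈ range k, l1 (u i) = ∑ b, withheldPull G p q a b *
            (α * evol (fun _ => withheldPull G p q) 0 k b q - γ * ∑ i ∈ range k, l1 (u i)) := by
          simp only [mul_sub, Finset.sum_sub_distrib]
          rw [← Finset.sum_mul, hrow.2, one_mul, Matrix.mul_apply, Finset.mul_sum]
          congr 1
          exact Finset.sum_congr rfl fun b _ => by ring
        rw [h3]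
        exact Finset.sum_le_sum fun b _ =>
          mul_le_mul_of_nonneg_left (ih (by omega) b) (hrow.1 a b)
      simp only [Pi.add_apply, Pi.smul_apply, smul_eq_mul]
      linarith
  have hu0 : unrest (y 0) (u 0) ≤ 4 * α := by
    have h1 : osc (y 0) ≤ 2 * α := osc_le_two_mul (fun a => by
      rw [hy]
      by_cases ha : a = q
      · subst ha; simp [abs_of_nonneg hα]
      · simpa [ha] using hα) hα
    have h2 : l1 (u 0) = α := by
      rw [hu]
      simp [l1, Pi.single_apply, abs_of_nonneg hα, apply_ite abs]
    have := l1_balanced_le (u 0)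
    unfold unrest
    rw [h2] at this
    linarith
  have hevol : η ≤ evol (fun _ => withheldPull G p q) 0 k q q := by
    obtain ⟨r, rfl⟩ := Nat.exists_eq_add_of_le hLk
    rw [evol_add]
    exact le_mul_apply_of_rowStochastic (evol_mem (fun _ => withheldPull_mem) _ _) (hη 0) q
  have hsum := (h.withheld y u N hstep k hk).2.2
  have h1 : c * unrest (y 0) (u 0) ≤ c * (4 * α) :=
    mul_le_mul_of_nonneg_left hu0 (by linarith)
  have h2 := mul_le_mul_of_nonneg_left (hsum.trans h1) hγ
  have h3 := mul_le_mul_of_nonneg_left hevol hα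
  have h4 := mul_le_mul_of_nonneg_left hγη hα
  linarith [hlow k hk q]

end Block

/-! ### The adversarial schedule -/

section Schedule

/-- The starting times of the blocks, if the block `m` consists of one step, `P m` steps at which
single packets arrive, and twice `P (m + 1)` steps without arrivals. -/
def blockTime (P : ℕ → ℕ) : ℕ → ℕ
  | 0 => 0
  | m + 1 => blockTime P m + (1 + P m + 2 * P (m + 1))

lemma blockTime_succ (P : ℕ → ℕ) (m : ℕ) :
    blockTime P (m + 1) = blockTime P m + (1 + P m + 2 * P (m + 1)) := rfl

lemma blockTime_mono (P : ℕ → ℕ) : Monotone (blockTime P) :=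
  monotone_nat_of_le_succ fun m => by rw [blockTime_succ]; omega

lemma le_blockTime (P : ℕ → ℕ) (m : ℕ) : m ≤ blockTime P m := by
  induction m with
  | zero => exact Nat.zero_le _
  | succ m ih => rw [blockTime_succ]; omega

lemma exists_blockTime_le (P : ℕ → ℕ) (t : ℕ) :
    ∃ m, blockTime P m ≤ t ∧ t < blockTime P (m + 1) := by
  induction t with
  | zero => exact ⟨0, le_rfl, by rw [blockTime_succ]; omega⟩
  | succ t ih =>
    obtain ⟨m, h1, h2⟩ := ih
    rcases Nat.lt_or_ge (t + 1) (blockTime P (m + 1)) with h | h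
    · exact ⟨m, by omega, h⟩
    · exact ⟨m + 1, h, by rw [blockTime_succ P (m + 1)]; omega⟩

/-- In each block, the packets sent during the last `P (m + 1)` steps are delivered one by one in the
next block, after all the other packets have been delivered together at its first step. The packet
sent at time `0` may be delivered at once or be treated as the others. -/
lemma exists_schedule (P : ℕ → ℕ) (immediate : Prop) [Decidable immediate] :
    ∃ θ : ℕ → ℕ, (arrivalSet θ 0 = if immediate then {0} else ∅) ∧
      (∀ m, ∀ t ∈ arrivalSet θ (blockTime P (m + 1)),
        blockTime P m ≤ t ∧ t < blockTime P m + (1 + P m + P (m + 1))) ∧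
      (∀ m, ∀ i < P (m + 1), arrivalSet θ (blockTime P (m + 1) + 1 + i) =
        {blockTime P m + (1 + P m + P (m + 1)) + i}) ∧
      (∀ m, ∀ k < P (m + 1) + P (m + 1), arrivalSet θ (blockTime P m + 1 + P m + k) = ∅) := by
  classical
  choose b hb1 hb2 using exists_blockTime_le P
  let a : ℕ → ℕ := fun t => if immediate ∧ t = 0 then 0 else
    blockTime P (b t + 1) + ((t + 1) - (blockTime P (b t) + (1 + P (b t) + P (b t + 1))))
  have ha : ∀ t, t ≤ a t := by
    intro t
    have := hb2 t
    simp only [a]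
    split_ifs with h <;> omega
  have hmem : ∀ k t, t ∈ arrivalSet (fun t => a t - t) k ↔ a t = k := by
    intro k t
    have := ha t
    simp only [arrivalSet, Finset.mem_filter, Finset.mem_range]
    omega
  -- a packet that is not delivered at once arrives in the block after the one in which it is sent
  have hblock : ∀ t m i, ¬ (immediate ∧ t = 0) → a t = blockTime P m + i →
      blockTime P m + i < blockTime P (m + 1) → b t + 1 = m := by
    intro t m i h0 h1 h2
    have h3 := hb1 t
    have h4 := hb2 t
    have h5 := blockTime_succ P (b t)
    have h6 := blockTime_succ P (b t + 1)
    simp only [a, if_neg h0] at h1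
    rcases Nat.lt_trichotomy (b t + 1) m with h | h | h
    · have h7 := blockTime_mono P (show b t + 1 + 1 ≤ m from h)
      omega
    · exact h
    · have h7 := blockTime_mono P (show m + 1 ≤ b t + 1 from h)
      omega
  have h00 : ∀ t, a t ≠ 0 → ¬ (immediate ∧ t = 0) := by
    intro t h1 h2
    exact h1 (if_pos h2)
  refine ⟨fun t => a t - t, ?_, ?_, ?_, ?_⟩
  · ext t
    rw [hmem]
    by_cases h : immediate ∧ t = 0
    · simp [a, h]
    · have h1 : a t ≠ 0 := by
        have h2 := hb1 t
        have h3 := blockTime_succ P (b t)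
        simp only [a, if_neg h]
        omega
      by_cases h2 : immediate
      · have h3 : t ≠ 0 := fun h3 => h ⟨h2, h3⟩
        simp [h1, h2, h3]
      · simp [h1, h2]
  · intro m t ht
    rw [hmem] at ht
    have h1 := blockTime_succ P m
    have h0 := h00 t (by omega)
    have h2 := hblock t (m + 1) 0 h0 ht (by rw [blockTime_succ P (m + 1)]; omega)
    obtain rfl : b t = m := by omega
    have h3 := hb1 t
    simp only [a, if_neg h0] at ht
    omega
  · intro m i hi
    ext t
    rw [hmem, Finset.mem_singleton]
    have h1 := blockTime_succ P m
    constructor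
    · intro ht
      have h0 := h00 t (by omega)
      have h2 := hblock t (m + 1) (1 + i) h0 (by omega) (by rw [blockTime_succ P (m + 1)]; omega)
      obtain rfl : b t = m := by omega
      simp only [a, if_neg h0] at ht
      omega
    · intro ht
      have h0 : ¬ (immediate ∧ t = 0) := by omega
      have h2 : b t = m := by
        have h3 := hb1 t
        have h4 := hb2 t
        rcases Nat.lt_trichotomy (b t) m with h | h | h
        · have := blockTime_mono P (show b t + 1 ≤ m from h)
          omega
        · exact h
        · have := blockTime_mono P (show m + 1 ≤ b t from h)
          omega
      simp only [a, if_neg h0, h2]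
      omega
  · intro m k hk
    refine Finset.eq_empty_of_forall_notMem fun t ht => ?_
    rw [hmem] at ht
    have h0 := h00 t (by omega)
    have h1 := blockTime_succ P m
    have h2 := hblock t m (1 + P m + k) h0 (by omega) (by omega)
    have h3 := hb2 t
    subst h2
    simp only [a, if_neg h0] at ht
    have h4 := blockTime_succ P (b t)
    omega

end Schedule

/-! ### Information held back by unbounded delays -/

section Adversary

variable {V : Type u} [Fintype V] {G : Digraph V} {p q : V} {γ c lam : ℝ}

lemma one_le_blockConst (hc : 1 ≤ c) (hlam0 : 0 < lam) (hlam1 : lam < 1) :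
    1 ≤ blockConst V c lam := by
  have h1 : 0 < 1 - lam := by linarith
  have h2 : (1 : ℝ) ≤ c ^ 3 := one_le_pow₀ hc
  have h3 : (0 : ℝ) ≤ Fintype.card V := Nat.cast_nonneg _
  have h4 : (1 : ℝ) * 1 ≤ c ^ 3 * (4 * Fintype.card V + 8) := by
    gcongr
    linarith
  unfold blockConst
  rw [le_div_iff₀ h1]
  linarith

variable [DecidableEq V]

/-- Under the adversarial schedule with blocks of lengths proportional to `K` the value of `q` after
the first block already determines the limit up to a small error. -/
lemma PhaseBounds.abs_limit_sub_le (hpq : IsLink G p q) (h : PhaseBounds G p q γ c lam) (hc : 1 ≤ c)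
    (hlam0 : 0 < lam) (hlam1 : lam < 1) (hγ : 0 ≤ γ) (hγ1 : γ ≤ 1) {K : ℕ} {ε : ℝ}
    (hε : ε = 3 * blockConst V c lam * (lam ^ K * (1 + K))) (hε2 : ε ≤ 1 / 2)
    {A : ℕ → Finset ℕ} (hA0 : ∀ t ∈ A 0, t = 0)
    (hdump : ∀ m, ∀ t ∈ A (blockTime (K * ·) (m + 1)), blockTime (K * ·) m ≤ t ∧
      t < blockTime (K * ·) m + (1 + K * m + K * (m + 1)))
    (hsingle : ∀ m, ∀ i < K * (m + 1), A (blockTime (K * ·) (m + 1) + 1 + i) =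
      {blockTime (K * ·) m + (1 + K * m + K * (m + 1)) + i})
    (hnone : ∀ m, ∀ k < K * (m + 1) + K * (m + 1), A (blockTime (K * ·) m + 1 + K * m + k) = ∅)
    {x s : ℕ → V → ℝ} (hrun : LinkRun G p q γ A x s) (hx : x 0 = Pi.single p 1) (hs : s 0 = 0)
    {l : ℝ} (hl : Tendsto (fun k => x k q) atTop (𝓝 l)) :
    |l - x (1 + K) q| ≤ 6 * blockConst V c lam * ε := by
  set C := blockConst V c lam with hC
  set T := blockTime (K * ·) with hT
  have hTs : ∀ m, T (m + 1) = T m + (1 + K * m + 2 * (K * (m + 1))) := fun m => rfl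
  have hC1 : 1 ≤ C := one_le_blockConst hc hlam0 hlam1
  set δ := lam ^ K * (1 + K) with hδ
  have hδ0 : 0 < δ := by positivity
  have hε0 : 0 < ε := by rw [hε]; positivity
  have hδε : δ ≤ ε := by rw [hε]; exact le_mul_of_one_le_left hδ0.le (by linarith)
  have hδ1 : δ ≤ 1 := by linarith
  -- `F` bounds the distance from the rest state at the beginning of a block; the denominator
  -- compensates for the number of single packets, whose surplus adds up in the next disturbance `D`
  let F : ℕ → ℝ := fun m => ε ^ m / (1 + K * m)
  let D : ℕ → ℝ := fun m => (3 * C) ^ m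
  -- the rest state before a block: the value of `q` in the middle of the previous silent phase
  let v : ℕ → ℝ := fun m => Nat.casesOn m 0 fun m => x (T m + 1 + K * m + K * (m + 1)) q
  have hF0 : ∀ m, 0 ≤ F m := fun m => by positivity
  have hKF : ∀ m : ℕ, F m + (K * m : ℕ) * F m = ε ^ m := by
    intro m
    have : (1 + K * m : ℝ) ≠ 0 := by positivity
    simp only [F]
    push_cast
    field_simp
  have hεm : ∀ m : ℕ, ε ^ m ≤ 1 := fun m => pow_le_one₀ hε0.le (by linarith)
  have hFε : ∀ m, F m ≤ ε ^ m := fun m => by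
    rw [← hKF m]
    exact le_add_of_nonneg_right (mul_nonneg (Nat.cast_nonneg _) (hF0 m))
  have hD1 : ∀ m, 1 ≤ D m := fun m => one_le_pow₀ (by linarith)
  -- Bernoulli's inequality
  have hlam : ∀ m : ℕ, lam ^ (K * m) ≤ δ ^ m / (1 + K * m) := by
    intro m
    rw [le_div_iff₀ (by positivity), hδ, mul_pow, ← pow_mul]
    refine mul_le_mul_of_nonneg_left ?_ (by positivity)
    have := one_add_mul_le_pow (show (-2 : ℝ) ≤ K by linarith [Nat.cast_nonneg (α := ℝ) K]) m
    linarith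
  have hlam' : ∀ m : ℕ, lam ^ (K * m) ≤ δ ^ m := fun m =>
    (hlam m).trans (div_le_self (by positivity) (by
      linarith [show (0 : ℝ) ≤ K * m by positivity]))
  have hZ : ∀ m : ℕ, lam ^ (K * m) * (D m + F m) + F m ≤ 3 * ε ^ m := by
    intro m
    have h1 : lam ^ (K * m) * D m ≤ ε ^ m := by
      calc lam ^ (K * m) * D m ≤ δ ^ m * (3 * C) ^ m :=
            mul_le_mul_of_nonneg_right (hlam' m) (by linarith [hD1 m])
        _ = ε ^ m := by rw [← mul_pow, hε, mul_comm]
    have h2 : lam ^ (K * m) * F m ≤ F m :=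
      mul_le_of_le_one_left (hF0 m) (pow_le_one₀ hlam0.le hlam1.le)
    have h3 := hFε m
    linarith
  have hF1 : ∀ m : ℕ, C * (lam ^ (K * (m + 1)) * (3 * ε ^ m)) ≤ F (m + 1) := by
    intro m
    have h1 := hlam (m + 1)
    have h2 : (δ ^ (m + 1) / (1 + K * ((m + 1 : ℕ) : ℝ))) * (3 * C * ε ^ m) ≤ F (m + 1) := by
      have h3 : δ ^ (m + 1) * (3 * C * ε ^ m) ≤ ε ^ (m + 1) := by
        have h4 : δ ^ m ≤ 1 := pow_le_one₀ hδ0.le hδ1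
        calc δ ^ (m + 1) * (3 * C * ε ^ m) = δ ^ m * ((3 * C * δ) * ε ^ m) := by ring
          _ = δ ^ m * ε ^ (m + 1) := by rw [← hε]; ring
          _ ≤ _ := mul_le_of_le_one_left (by positivity) h4
      simp only [F]
      rw [div_mul_eq_mul_div]
      gcongr
    refine le_trans (le_of_eq ?_) ((mul_le_mul_of_nonneg_right h1
      (show 0 ≤ 3 * C * ε ^ m by positivity)).trans h2)
    ring
  have hDF : ∀ m, C * (D m + ε ^ m) ≤ D (m + 1) := by
    intro m
    have h1 : D (m + 1) = 3 * C * D m := by simp only [D]; ring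
    have h2 : C * (D m + ε ^ m) ≤ C * (3 * D m) :=
      mul_le_mul_of_nonneg_left (by linarith [hD1 m, hεm m]) (by linarith)
    linarith
  have hblock : ∀ m, BlockStart p A x s (T m) (K * m) (K * (m + 1)) (K * (m + 1)) (v m) (F m)
      (D m) := by
    intro m
    induction m with
    | zero =>
      have hx0 : ∀ i j, |ext 0 (x 0) i - ext 0 (x 0) j| ≤ 1 := by
        have h1 : ∀ i, 0 ≤ ext 0 (x 0) i ∧ ext 0 (x 0) i ≤ 1 := by
          rintro (_ | i)
          · simp
          · rw [ext_some, hx]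
            by_cases hi : i = p
            · subst hi; simp
            · simp [hi]
        intro i j
        rw [abs_le]
        constructor <;> linarith [(h1 i).1, (h1 i).2, (h1 j).1, (h1 j).2]
      refine ⟨?_, ?_, ?_, ?_, ?_⟩
      · change deviation 0 (x 0) (s 0) ≤ _
        have h1 : l1 (balanced (s 0)) ≤ 0 := by
          have := l1_balanced_le (s 0)
          rw [hs] at this ⊢
          simpa [l1] using this
        have h2 : osc (ext 0 (x 0)) ≤ 1 := osc_le zero_le_one hx0
        have h3 : F 0 = 1 := by simp [F]
        rw [h3]
        unfold deviation
        linarith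
      · intro t ht
        rw [hA0 t ht, hx]
        simp [v, D]
      · have : ∑ t ∈ A 0, |s t p| = 0 := Finset.sum_eq_zero fun t ht => by rw [hA0 t ht, hs]; simp
        change ∑ t ∈ A 0, |s t p| ≤ _
        rw [this]
        linarith [hD1 0]
      · intro k hk
        simp at hk
      · exact hnone 0
    | succ m ih =>
      obtain ⟨-, h2, h3, h4⟩ := h.block hpq hc hlam0 hlam1 hγ hγ1 hrun (by linarith [hD1 m]) ih
      change ∀ k ≤ K * (m + 1), deviation (v (m + 1)) _ _ ≤ C * _ at h2
      change ∀ k < _, |x (T m + k) p - v (m + 1)| ≤ C * _ at h3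
      change _ ≤ C * _ at h4
      have h5 : ∀ k ≤ K * (m + 1), deviation (v (m + 1)) (x (T m + 1 + K * m + K * (m + 1) + k))
          (s (T m + 1 + K * m + K * (m + 1) + k)) ≤ F (m + 1) := by
        intro k hk
        refine (h2 k hk).trans (le_trans ?_ (hF1 m))
        refine mul_le_mul_of_nonneg_left ?_ (by linarith)
        exact mul_le_mul_of_nonneg_left (hZ m) (by positivity)
      have h6 := fun t ht => hdump m t ht
      refine ⟨?_, ?_, ?_, ?_, hnone (m + 1)⟩
      · have h7 := h5 _ le_rfl
        rwa [show T m + 1 + K * m + K * (m + 1) + K * (m + 1) = T (m + 1) by rw [hTs]; omega] at h7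
      · intro t ht
        obtain ⟨h7, h8⟩ := h6 t ht
        have h9 := h3 (t - T m) (by omega)
        rw [Nat.add_sub_cancel' h7] at h9
        refine h9.trans (le_trans ?_ (hDF m))
        exact mul_le_mul_of_nonneg_left (by linarith [hFε m]) (by linarith)
      · have h7 : ∑ t ∈ A (T (m + 1)), |s t p| ≤
            ∑ k ∈ range (1 + K * m + K * (m + 1)), |s (T m + k) p| := by
          rw [← Finset.sum_image (s := range (1 + K * m + K * (m + 1))) (g := fun k => T m + k)
            (f := fun t => |s t p|) (fun a _ b _ hab => by simpa using hab)]
          refine Finset.sum_le_sum_of_subset_of_nonneg (fun t ht => ?_) fun _ _ _ => abs_nonneg _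
          obtain ⟨h7, h8⟩ := h6 t ht
          exact Finset.mem_image.2 ⟨t - T m, Finset.mem_range.2 (by omega), by omega⟩
        refine h7.trans (h4.trans (le_trans (le_of_eq ?_) (hDF m)))
        rw [add_assoc, hKF]
      · intro k hk
        refine ⟨_, hsingle m k hk, ?_⟩
        have h7 := h5 k hk.le
        rw [show T m + 1 + K * m + K * (m + 1) + k = T m + (1 + K * m + K * (m + 1)) + k by ring]
          at h7
        exact ⟨(abs_sub_le_deviation _ _ _ p).trans h7, (abs_le_l1 _ p).trans
          ((l1_le_unrest _ _).trans ((unrest_le_deviation _ _ _).trans h7))⟩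
  have hv : ∀ m, |v (m + 1) - v m| ≤ 3 * C * ε ^ m := by
    intro m
    obtain ⟨h1, -, -, -⟩ := h.block hpq hc hlam0 hlam1 hγ hγ1 hrun (by linarith [hD1 m]) (hblock m)
    refine h1.trans ?_
    have := mul_le_mul_of_nonneg_left (hZ m) (show 0 ≤ C by linarith)
    linarith
  have hv1 : ∀ m, |v (m + 1) - v 1| ≤ 6 * C * (ε - ε ^ (m + 1)) := by
    intro m
    induction m with
    | zero => simp
    | succ m ih =>
      have h1 : v (m + 1 + 1) - v 1 = (v (m + 1 + 1) - v (m + 1)) + (v (m + 1) - v 1) := by ring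
      rw [h1]
      refine (abs_add_le _ _).trans ((add_le_add (hv (m + 1)) ih).trans ?_)
      have h2 : 3 * C * ε ^ (m + 1) * (2 * ε) ≤ 3 * C * ε ^ (m + 1) * 1 :=
        mul_le_mul_of_nonneg_left (by linarith) (by positivity)
      have h3 : ε ^ (m + 1 + 1) = ε ^ (m + 1) * ε := pow_succ _ _
      rw [h3]
      linarith
  have hlim : Tendsto (fun m => v (m + 1)) atTop (𝓝 l) := by
    refine hl.comp (tendsto_atTop_mono (fun m => ?_) tendsto_id)
    have := le_blockTime (K * ·) m
    change m ≤ T m at this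
    simp only [id]
    omega
  have h1 : v 1 = x (1 + K) q := by
    change x (0 + 1 + K * 0 + K * (0 + 1)) q = _
    simp
  rw [← h1]
  refine le_of_tendsto ((hlim.sub_const (v 1)).abs) (Eventually.of_forall fun m => ?_)
  refine (hv1 m).trans (mul_le_mul_of_nonneg_left ?_ (by positivity))
  linarith [pow_pos hε0 (m + 1)]

/-- If the delays on the link `p → q` are unbounded, then consensus on the average cannot be achieved
with a small gain: there are two delay sequences with different limits. -/
lemma exists_gain_not_achieves {B : V → V → ℕ∞} (hG : StronglyConnected G) (hpq : IsLink G p q)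
    (hB : B q p = ⊤) :
    ∃ γ₀ > 0, ∀ γ, 0 < γ → γ < γ₀ → ¬ AchievesAverageConsensus G B γ := by
  obtain ⟨γ₁, hγ₁, c, hc, lam, hlam0, hlam1, hph⟩ := exists_phaseBounds hpq hG
  obtain ⟨L, -, η, hη, hwin⟩ := withheldPull_window (p := p) (q := q) hG
  have hc0 : 0 < c := by linarith
  refine ⟨min γ₁ (min 1 (η / (8 * c))), by positivity, fun γ hγ hγ' hach => ?_⟩
  have hγγ₁ : γ < γ₁ := hγ'.trans_le (min_le_left _ _)
  have hγ1 : γ ≤ 1 := (hγ'.trans_le ((min_le_right _ _).trans (min_le_left _ _))).le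
  have hγη : 8 * c * γ ≤ η := by
    have h1 : γ < η / (8 * c) := hγ'.trans_le ((min_le_right _ _).trans (min_le_right _ _))
    rw [lt_div_iff₀ (by positivity)] at h1
    linarith
  have hphase := hph γ hγ hγγ₁ hγ1
  set C := blockConst V c lam with hC
  have hC1 : 1 ≤ C := one_le_blockConst hc hlam0 hlam1
  set α : ℝ := 1 / ((nbrs G p q q).card + 1) with hα
  have hα0 : 0 < α := by positivity
  obtain ⟨K, hKL, hK1, hK2⟩ : ∃ K : ℕ, L ≤ K ∧ 3 * C * (lam ^ K * (1 + K)) ≤ 1 / 2 ∧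
      12 * C * (3 * C * (lam ^ K * (1 + K))) < α * η / 2 := by
    have h1 : Tendsto (fun K : ℕ => 3 * C * (lam ^ K * (1 + K))) atTop (𝓝 0) := by
      have h2 := tendsto_self_mul_const_pow_of_lt_one hlam0.le hlam1
      have h3 := tendsto_pow_atTop_nhds_zero_of_lt_one hlam0.le hlam1
      have h4 := (h3.add h2).const_mul (3 * C)
      rw [add_zero, mul_zero] at h4
      exact h4.congr fun K => by ring
    have h2 := h1.const_mul (12 * C)
    rw [mul_zero] at h2
    have h3 := h1.eventually_le_const (show (0 : ℝ) < 1 / 2 by norm_num)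
    have h4 := h2.eventually_lt_const (show 0 < α * η / 2 by positivity)
    obtain ⟨K, hK⟩ := ((eventually_ge_atTop L).and (h3.and h4)).exists
    exact ⟨K, hK.1, hK.2.1, hK.2.2⟩
  have hmax : maxDelay G B = ⊤ := by
    refine top_le_iff.1 ?_
    rw [← hB]
    exact le_iSup_of_le q (le_iSup_of_le p (le_iSup_of_le hpq le_rfl))
  have hadm : ∀ θ, Admissible G B (linkDelay p q θ) := by
    intro θ
    refine ⟨fun j i hij k => ?_, fun j k => ?_⟩
    · by_cases h : i = p ∧ j = q
      · obtain ⟨rfl, rfl⟩ := h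
        rw [hB]; exact le_top
      · simp [linkDelay, h]
    · simp only [linkDelay]
      rw [if_neg]
      rintro ⟨rfl, h⟩
      exact hpq.1 h
  have hlim : ∀ θ, Tendsto (fun k => state G (linkDelay p q θ) γ (Pi.single p 1) k q) atTop
      (𝓝 (1 / Fintype.card V)) := by
    intro θ
    have h1 := (hach _ (hadm θ) (Pi.single p 1) q).1
    rw [hmax] at h1
    simpa [state] using h1
  obtain ⟨θ, hθ0, hθ1, hθ2, hθ3⟩ := exists_schedule (K * ·) False
  obtain ⟨θ', hθ0', hθ1', hθ2', hθ3'⟩ := exists_schedule (K * ·) True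
  simp only [if_false, if_true] at hθ0 hθ0'
  have hrun := linkRun_traj hpq θ γ (Pi.single p 1)
  have hrun' := linkRun_traj hpq θ' γ (Pi.single p 1)
  have hinit : ∀ θ, state G (linkDelay p q θ) γ (Pi.single p 1) 0 = Pi.single p 1 := by
    intro θ; ext j; simp [state, traj, agent]
  have hinit' : ∀ θ, surplus G (linkDelay p q θ) γ (Pi.single p 1) 0 = 0 := by
    intro θ; ext j; simp [surplus, traj]
  have hA := hphase.abs_limit_sub_le hpq hc hlam0 hlam1 hγ.le hγ1 rfl hK1 (by simp [hθ0])
    hθ1 hθ2 hθ3 hrun (hinit θ) (hinit' θ) (hlim θ)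
  have hA' := hphase.abs_limit_sub_le hpq hc hlam0 hlam1 hγ.le hγ1 rfl hK1 (by simp [hθ0'])
    hθ1' hθ2' hθ3' hrun' (hinit θ') (hinit' θ') (hlim θ')
  set x := state G (linkDelay p q θ) γ (Pi.single p 1)
  set s := surplus G (linkDelay p q θ) γ (Pi.single p 1)
  set x' := state G (linkDelay p q θ') γ (Pi.single p 1)
  set s' := surplus G (linkDelay p q θ') γ (Pi.single p 1)
  have hx : x 0 = Pi.single p 1 := hinit θ
  have hx' : x' 0 = Pi.single p 1 := hinit θ'
  have hs : s 0 = 0 := hinit' θ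
  have hs' : s' 0 = 0 := hinit' θ'
  -- the packet that carries the value `1` of `p` changes the mean of `q` only
  have hmean : ∀ j, linkMean G p q (arrivalSet θ' 0) x' 0 j =
      linkMean G p q (arrivalSet θ 0) x 0 j + (α • Pi.single q 1 : V → ℝ) j := by
    intro j
    rw [hθ0, hθ0', linkMean, linkMean, hx, hx']
    by_cases hj : j = q
    · subst hj
      have hp : p ∉ nbrs G p j j := by simp [mem_nbrs, hpq.1]
      simp [hp, hα, hx']
    · simp [hj]
  have hsep := hphase.separation hc hγ.le hwin hγη hα0.le
    (y := fun k => x' (1 + k) - x (1 + k)) (u := fun k => s' (1 + k) - s (1 + k)) (N := K)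
    (fun k hk => ?_) ?_ ?_ le_rfl hKL
  · simp only [Pi.sub_apply] at hsep
    have h1 := (abs_le.1 hA).2
    have h2 := (abs_le.1 hA').1
    linarith
  · have h1 := hθ3 0 k (by omega)
    have h1' := hθ3' 0 k (by omega)
    have h2 : blockTime (K * ·) 0 + 1 + K * 0 + k = 1 + k := by simp [blockTime]
    rw [h2] at h1 h1'
    exact (hrun'.withheldStep h1').sub (hrun.withheldStep h1)
  · ext j
    change x' (0 + 1) j - x (0 + 1) j = _
    rw [hrun.state_step, hrun'.state_step, hmean, hs, hs']
    simp
  · ext j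
    change s' (0 + 1) j - s (0 + 1) j = _
    rw [hrun.surplus_step, hrun'.surplus_step, hmean, hs, hs', hx, hx', hθ0, hθ0']
    simp [hs']

end Adversary

lemma exists_unbounded_link {V : Type u} [Finite V] {G : Digraph V} {B : V → V → ℕ∞}
    (h : ¬ BoundedDelays G B) : ∃ p q, IsLink G p q ∧ B q p = ⊤ := by
  classical
  have := Fintype.ofFinite V
  by_contra! hne
  refine h ⟨∑ j, ∑ i, (B j i).toNat, fun j i hij => ?_⟩
  rw [← ENat.natCast_toNat (hne i j hij)]
  refine Nat.cast_le.2 ((Finset.single_le_sum (f := fun i => (B j i).toNat)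
    (fun _ _ => Nat.zero_le _) (Finset.mem_univ i)).trans ?_)
  exact Finset.single_le_sum (f := fun j => ∑ i, (B j i).toNat) (fun _ _ => Nat.zero_le _)
    (Finset.mem_univ j)

end RPPAC

theorem theorem1 {V : Type*} [Fintype V] (hn : 1 < Fintype.card V) (G : Digraph V)
    (B : V → V → ℕ∞) :
    ∃ γ₀ : ℝ, 0 < γ₀ ∧ ∀ γ : ℝ, 0 < γ → γ < γ₀ →
      (RPPAC.AchievesAverageConsensus G B γ ↔
        RPPAC.StronglyConnected G ∧ RPPAC.BoundedDelays G B) := by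
  classical
  have : Nonempty V := Fintype.card_pos_iff.1 (by omega)
  by_cases hG : RPPAC.StronglyConnected G
  · by_cases hB : RPPAC.BoundedDelays G B
    · obtain ⟨γ₀, hγ₀, h⟩ := RPPAC.exists_gain_achieves hG hB
      exact ⟨γ₀, hγ₀, fun γ h0 h1 => iff_of_true (h γ h0 h1) ⟨hG, hB⟩⟩
    · obtain ⟨p, q, hpq, htop⟩ := RPPAC.exists_unbounded_link hB
      obtain ⟨γ₀, hγ₀, h⟩ := RPPAC.exists_gain_not_achieves hG hpq htop
      exact ⟨γ₀, hγ₀, fun γ h0 h1 => iff_of_false (h γ h0 h1) fun h2 => hB h2.2⟩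
  · exact ⟨1, one_pos, fun γ _ _ => iff_of_false
      (RPPAC.not_achieves_of_not_stronglyConnected B hG γ) fun h => hG h.1⟩
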